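/- **Setting.** For $c_1,c_2\ge -1$ let $\bar c_3(c_1,c_2)=-\frac12\big(\sqrt{1+c_1}+\sqrt{1+c_2}\big)\big(\sqrt{1+c_1}+\sqrt{1+c_2}+2\big)$, and let $J=\{c\in\mathbb R^3: c_1\ge-1,\ c_2\ge-1,\ c_3\ge\bar c_3(c_1,c_2)\}$. For $c\in J$ let $[\gamma^-(c),\gamma^+(c)]$ be the set of those $\gamma$ for which the equation $$(1-x^2)U_\theta'+2xU_\theta+\tfrac12U_\theta^2=P_c(x),\qquad P_c(x):=c_1(1-x)+c_2(1+x)+c_3(1-x^2),$$ has a $C^1$ solution on $(-1,1)$ with $U_\theta(0)=\gamma$; this (unique) solution is denoted $U^{c,\gamma}_\theta$, and $U^{c,\gamma}:=(U^{c,\gamma}_\theta,0)$. Let $$I_{4,1}=\{(c,\gamma)\in\mathbb R^3\times\mathbb R:\ c\in J,\ c_1=c_2=-1,\ c_3>\bar c_3(c_1,c_2),\ \gamma^-(c)<\gamma<\gamma^+(c)\}.$$ (For these parameters $\lim_{x\to-1}(U^{c,\gamma}_\theta-2)\ln(1+x)=4$ and $\lim_{x\to1}(U^{c,\gamma}_\theta+2)\ln(1-x)=-4$.)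 For functions $f,g$ on $(-1,1)$ put $$\psi[g](x)=\int_0^x\!\int_0^l\!\int_0^t\frac{2g(s)g'(s)}{1-s^2}\,ds\,dt\,dl,\qquad \varphi_{c,\gamma}[f]=(1-x^2)f'+(2x+U^{c,\gamma}_\theta)f+\tfrac12f^2 .$$ The reduced system with constants $\hat c=(\hat c_1,\hat c_2,\hat c_3)$, for $U=(U_\theta,U_\phi)$ with $U_\theta\in C^1(-1,1)$ and $U_\phi\in C^2(-1,1)$, is $$(1-x^2)U_\theta'+2xU_\theta+\tfrac12U_\theta^2+\psi[U_\phi](x)=P_{\hat c}(x),\qquad (1-x^2)U_\phi''+U_\theta U_\phi'=0\qquad\text{on }(-1,1).\tag{1}$$ With $a_{c,\gamma}(x)=\int_0^x\frac{2s+U^{c,\gamma}_\theta(s)}{1-s^2}ds$ and $b_{c,\gamma}(x)=\int_0^x\frac{U^{c,\gamma}_\theta(s)}{1-s^2}ds$, let $$V^1_{c,\gamma}=\big(e^{-a_{c,\gamma}(x)},0\big),\quad V^2_{c,\gamma}=\Big(e^{-a_{c,\gamma}(x)}\!\int_0^x e^{a_{c,\gamma}(s)}ds,\,0\Big),\quad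 V^3_{c,\gamma}=\Big(0,\int_0^x e^{-b_{c,\gamma}(t)}dt\Big),\quad V^4_{c,\gamma}=(0,1).$$ Fix $0<\epsilon<\frac12$ and put $w(x)=\ln\frac{1+x}3\,\ln\frac{1-x}3$. Let $\mathbf M_1$ be the space of all $f\in C^3(-\frac12,\frac12)\cap C^1(-1,1)\cap C[-1,1]$ with $f(\pm1)=0$ and $$\|f\|_{\mathbf M_1}=\|wf\|_{L^\infty(-1,1)}+\|(1-x^2)w^2f'\|_{L^\infty(-1,1)}+\|f''\|_{L^\infty(-\frac12,\frac12)}+\|f'''\|_{L^\infty(-\frac12,\frac12)}<\infty,$$ and $\mathbf M_2$ the space of all $g\in C^2(-1,1)$ with $$\|g\|_{\mathbf M_2}=\|(1-x^2)^{\epsilon}g\|_{L^\infty(-1,1)}+\|(1-x^2)^{1+\epsilon}g'\|_{L^\infty(-1,1)}+\|(1-x^2)^{2+\epsilon}g''\|_{L^\infty(-1,1)}<\infty.$$ Let $\mathbf X=\mathbf M_1\times\mathbf M_2$ with $\|(f,g)\|_{\mathbf X}=\|f\|_{\mathbf M_1}+\|g\|_{\mathbf M_2}$, and let $\mathbf X_1$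 be the subspace of those $(f,g)\in\mathbf X$ with $f(0)=f'(0)=g'(0)=g(0)=0$. Let $B_\delta(0)$ be the open ball of radius $\delta$ about $0$ in $\mathbb R^4$. A map on $K\times B_\delta(0)$ is called $C^\infty$ if it extends to a $C^\infty$ map on an open neighbourhood of $K\times B_\delta(0)$ in $\mathbb R^4\times\mathbb R^4$. **Theorem 5.1.** For every $0<\epsilon<\frac12$ and every compact $K\subset I_{4,1}$ there exist $\delta>0$ and $V\in C^\infty(K\times B_\delta(0),\mathbf X_1)$ such that $V(c,\gamma,0)=0$ and $\frac{\partial V}{\partial\beta_i}(c,\gamma,0)=0$ for all $(c,\gamma)\in K$ and $1\le i\le4$, and such that for all $(c,\gamma)\in K$ and $\beta=(\beta_1,\dots,\beta_4)\in B_\delta(0)$ the function $$U=U^{c,\gamma}+\sum_{i=1}^4\beta_iV^i_{c,\gamma}+V(c,\gamma,\beta)\tag{2}$$ satisfies (1) with $$\hat c_1=c_1+\tfrac12\psi[\tilde U_\phi](-1),\qquad \hat c_2=c_2+\tfrac12\psi[\tilde U_\phi](1),\qquad \hat c_3=c_3-\tfrac12\big(\varphi_{c,\gamma}[\tilde U_\theta]\big)''(0),$$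 where $\tilde U=(\tilde U_\theta,\tilde U_\phi):=U-U^{c,\gamma}$. Moreover, there is $\delta'>0$ such that, whenever $(c,\gamma)\in K$, $U-U^{c,\gamma}\in\mathbf X$, $\|U-U^{c,\gamma}\|_{\mathbf X}<\delta'$ and $U$ satisfies (1) with some constants $\hat c_1,\hat c_2,\hat c_3$, then (2) holds for some $|\beta|<\delta$. -/

import Mathlib

open Set MeasureTheory
open scoped ContDiff Topology

noncomputable section

namespace LogSwirl

/-! ## The no-swirl solutions and the parameter set -/

/-- The quantity `-(1/2) (√(1+c₁)+√(1+c₂)) (√(1+c₁)+√(1+c₂)+2)`. -/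
def cbar3 (c₁ c₂ : ℝ) : ℝ :=
  -(1 / 2) * (√(1 + c₁) + √(1 + c₂)) * (√(1 + c₁) + √(1 + c₂) + 2)

/-- `P_c(x) = c₁ (1-x) + c₂ (1+x) + c₃ (1-x²)`. -/
def P (c : Fin 3 → ℝ) (x : ℝ) : ℝ :=
  c 0 * (1 - x) + c 1 * (1 + x) + c 2 * (1 - x ^ 2)

/-- The set `J` of parameters `c = (c₁, c₂, c₃)`. -/
def J : Set (Fin 3 → ℝ) :=
  {c | -1 ≤ c 0 ∧ -1 ≤ c 1 ∧ cbar3 (c 0) (c 1) ≤ c 2}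

/-- The stratum `J₄` of `J`: `c₁ = c₂ = -1` and `c₃ > c̄₃`. -/
def J4 : Set (Fin 3 → ℝ) :=
  {c | c ∈ J ∧ c 0 = -1 ∧ c 1 = -1 ∧ cbar3 (c 0) (c 1) < c 2}

/-- `U` is a solution on `(-1,1)` of the no-swirl equation
`(1-x²) U' + 2 x U + U²/2 = P_c(x)`. -/
def IsNoSwirlSolution (c : Fin 3 → ℝ) (U : ℝ → ℝ) : Prop :=
  ContDiffOn ℝ 1 U (Ioo (-1) 1) ∧
    ∀ x ∈ Ioo (-1 : ℝ) 1,
      (1 - x ^ 2) * deriv U x + 2 * x * U x + 1 / 2 * U x ^ 2 = P c x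

/-- The values at `0` of the no-swirl solutions on all of `(-1,1)`. For `c ∈ J` this is a nonempty
compact interval `[γ⁻(c), γ⁺(c)]`. -/
def initialValues (c : Fin 3 → ℝ) : Set ℝ :=
  {γ | ∃ U : ℝ → ℝ, IsNoSwirlSolution c U ∧ U 0 = γ}

/-- `γ⁻(c)`. -/
def gammaMinus (c : Fin 3 → ℝ) : ℝ := sInf (initialValues c)

/-- `γ⁺(c)`. -/
def gammaPlus (c : Fin 3 → ℝ) : ℝ := sSup (initialValues c)

/-- The space of parameters `(c, γ) ∈ ℝ³ × ℝ`. -/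
abbrev Param : Type := (Fin 3 → ℝ) × ℝ

/-- The set `I` of all parameters `(c, γ)` of no-swirl solutions. -/
def I : Set Param :=
  {p | p.1 ∈ J ∧ gammaMinus p.1 ≤ p.2 ∧ p.2 ≤ gammaPlus p.1}

/-- The set `I_{4,1}`, on which both poles have the logarithmic behaviour. -/
def I41 : Set Param :=
  {p | p ∈ I ∧ p.1 ∈ J4 ∧ gammaMinus p.1 < p.2 ∧ p.2 < gammaPlus p.1}

open Classical in
/-- `U^{c,γ}_θ`: the solution on `(-1,1)` of the no-swirl equation with value `γ` at `0`
(unique on `(-1,1)`; only its values there are used, and it is `0` if there is none). -/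
def Ubar (p : Param) : ℝ → ℝ :=
  if h : ∃ U : ℝ → ℝ, IsNoSwirlSolution p.1 U ∧ U 0 = p.2 then Classical.choose h else 0

/-! ## The reduced system -/

/-- `ψ[f,g](x) = ∫₀ˣ ∫₀ˡ ∫₀ᵗ 2 f(s) g'(s) / (1-s²) ds dt dl`. -/
def psi (f g : ℝ → ℝ) (x : ℝ) : ℝ :=
  ∫ l in (0 : ℝ)..x, ∫ t in (0 : ℝ)..l, ∫ s in (0 : ℝ)..t, 2 * f s * deriv g s / (1 - s ^ 2)

/-- `φ_{c,γ}[f](x) = (1-x²) f' + (2x + U^{c,γ}_θ) f + f²/2`. -/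
def varphi (p : Param) (f : ℝ → ℝ) (x : ℝ) : ℝ :=
  (1 - x ^ 2) * deriv f x + (2 * x + Ubar p x) * f x + 1 / 2 * f x ^ 2

/-- `U = (Uθ, Uφ)` solves the reduced system on `(-1,1)` with constants `ĉ = (ĉ₁, ĉ₂, ĉ₃)`. -/
def IsReducedSolution (chat : Fin 3 → ℝ) (Uθ Uφ : ℝ → ℝ) : Prop :=
  ContDiffOn ℝ 1 Uθ (Ioo (-1) 1) ∧ ContDiffOn ℝ 2 Uφ (Ioo (-1) 1) ∧
    ∀ x ∈ Ioo (-1 : ℝ) 1,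
      (1 - x ^ 2) * deriv Uθ x + 2 * x * Uθ x + 1 / 2 * Uθ x ^ 2 + psi Uφ Uφ x = P chat x ∧
      (1 - x ^ 2) * deriv (deriv Uφ) x + Uθ x * deriv Uφ x = 0

/-- The constants `ĉ` attached to a perturbation `(f, g)` of `(U^{c,γ}_θ, 0)`:
`ĉ₁ = c₁ + ψ[g](-1)/2`, `ĉ₂ = c₂ + ψ[g](1)/2`, `ĉ₃ = c₃ - (φ_{c,γ}[f])''(0)/2`. -/
def cHat (p : Param) (f g : ℝ → ℝ) : Fin 3 → ℝ :=
  ![p.1 0 + 1 / 2 * psi g g (-1), p.1 1 + 1 / 2 * psi g g 1,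
    p.1 2 - 1 / 2 * iteratedDeriv 2 (varphi p f) 0]

/-- `a_{c,γ}(x) = ∫₀ˣ (2s + U^{c,γ}_θ(s)) / (1-s²) ds`. -/
def a (p : Param) (x : ℝ) : ℝ := ∫ s in (0 : ℝ)..x, (2 * s + Ubar p s) / (1 - s ^ 2)

/-- `b_{c,γ}(x) = ∫₀ˣ U^{c,γ}_θ(s) / (1-s²) ds`. -/
def b (p : Param) (x : ℝ) : ℝ := ∫ s in (0 : ℝ)..x, Ubar p s / (1 - s ^ 2)

/-- The `θ`-components of `V¹, V², V³, V⁴`. -/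
def Vθ (p : Param) : Fin 4 → ℝ → ℝ :=
  ![fun x => Real.exp (-a p x),
    fun x => Real.exp (-a p x) * ∫ s in (0 : ℝ)..x, Real.exp (a p s),
    fun _ => 0,
    fun _ => 0]

/-- The `φ`-components of `V¹, V², V³, V⁴`. -/
def Vφ (p : Param) : Fin 4 → ℝ → ℝ :=
  ![fun _ => 0,
    fun _ => 0,
    fun x => ∫ t in (0 : ℝ)..x, Real.exp (-b p t),
    fun _ => 1]

/-! ## Weighted spaces

A function on `(-1,1)` is represented by its extension by `0` to `ℝ`. -/

/-- `g` is bounded on `s`. -/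
def BddOn (s : Set ℝ) (g : ℝ → ℝ) : Prop := ∃ C : ℝ, ∀ x ∈ s, |g x| ≤ C

/-- The supremum of `|g|` on `s`; it is the `L^∞(s)` norm for `s` open and `g` continuous and
bounded on `s`. -/
def supNorm (s : Set ℝ) (g : ℝ → ℝ) : ℝ := ⨆ x : s, |g x|

theorem BddOn.bddAbove {s : Set ℝ} {g : ℝ → ℝ} (h : BddOn s g) :
    BddAbove (range fun x : s => |g x|) := by
  obtain ⟨C, hC⟩ := h
  exact ⟨C, by rintro _ ⟨x, rfl⟩; exact hC x x.2⟩

theorem BddOn.add {s : Set ℝ} {f g k : ℝ → ℝ} (hf : BddOn s f) (hg : BddOn s g)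
    (h : ∀ x ∈ s, k x = f x + g x) : BddOn s k := by
  obtain ⟨C, hC⟩ := hf
  obtain ⟨D, hD⟩ := hg
  exact ⟨C + D, fun x hx => by
    rw [h x hx]; exact (abs_add_le _ _).trans (add_le_add (hC x hx) (hD x hx))⟩

theorem BddOn.smul {s : Set ℝ} {f k : ℝ → ℝ} (r : ℝ) (hf : BddOn s f)
    (h : ∀ x ∈ s, k x = r * f x) : BddOn s k := by
  obtain ⟨C, hC⟩ := hf
  exact ⟨|r| * C, fun x hx => by
    rw [h x hx, abs_mul]; exact mul_le_mul_of_nonneg_left (hC x hx) (abs_nonneg _)⟩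

theorem BddOn.zero {s : Set ℝ} {k : ℝ → ℝ} (h : ∀ x ∈ s, k x = 0) : BddOn s k :=
  ⟨0, fun x hx => by simp [h x hx]⟩

theorem supNorm_nonneg (s : Set ℝ) (g : ℝ → ℝ) : 0 ≤ supNorm s g :=
  Real.iSup_nonneg fun _ => abs_nonneg _

theorem le_supNorm {s : Set ℝ} {g : ℝ → ℝ} (h : BddOn s g) {x : ℝ} (hx : x ∈ s) :
    |g x| ≤ supNorm s g :=
  le_ciSup h.bddAbove (⟨x, hx⟩ : s)

theorem supNorm_add_le {s : Set ℝ} {f g k : ℝ → ℝ} (hf : BddOn s f) (hg : BddOn s g)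
    (h : ∀ x ∈ s, k x = f x + g x) : supNorm s k ≤ supNorm s f + supNorm s g := by
  refine Real.iSup_le (fun x => ?_) (add_nonneg (supNorm_nonneg _ _) (supNorm_nonneg _ _))
  rw [h x x.2]
  exact (abs_add_le _ _).trans (add_le_add (le_supNorm hf x.2) (le_supNorm hg x.2))

theorem supNorm_smul {s : Set ℝ} {f k : ℝ → ℝ} (r : ℝ)
    (h : ∀ x ∈ s, k x = r * f x) : supNorm s k = |r| * supNorm s f := by
  unfold supNorm
  rw [Real.mul_iSup_of_nonneg (abs_nonneg r)]
  congr 1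
  ext x
  rw [h x x.2, abs_mul]

/-- The double logarithmic weight `ln((1+x)/3) ln((1-x)/3)`. -/
def logWeight (x : ℝ) : ℝ := Real.log ((1 + x) / 3) * Real.log ((1 - x) / 3)

theorem logWeight_ne_zero {x : ℝ} (hx : x ∈ Ioo (-1 : ℝ) 1) : logWeight x ≠ 0 := by
  have h1 := hx.1
  have h2 := hx.2
  refine mul_ne_zero (ne_of_lt (Real.log_neg ?_ ?_)) (ne_of_lt (Real.log_neg ?_ ?_)) <;> linarith

/-- The conditions defining membership in `M₁`. -/
structure MemM1 (f : ℝ → ℝ) : Prop where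
  /-- extension by zero; this contains `f (-1) = f 1 = 0` -/
  zero_off : ∀ x, x ∉ Ioo (-1 : ℝ) 1 → f x = 0
  c3 : ContDiffOn ℝ 3 f (Ioo (-1 / 2) (1 / 2))
  c1 : ContDiffOn ℝ 1 f (Ioo (-1) 1)
  cont : ContinuousOn f (Icc (-1) 1)
  bdd0 : BddOn (Ioo (-1) 1) fun x => logWeight x * f x
  bdd1 : BddOn (Ioo (-1) 1) fun x => (1 - x ^ 2) * logWeight x ^ 2 * deriv f x
  bdd2 : BddOn (Ioo (-1 / 2) (1 / 2)) (iteratedDeriv 2 f)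
  bdd3 : BddOn (Ioo (-1 / 2) (1 / 2)) (iteratedDeriv 3 f)

/-- The conditions defining membership in `M₂(ε)`. -/
structure MemM2 (ε : ℝ) (f : ℝ → ℝ) : Prop where
  /-- extension by zero -/
  zero_off : ∀ x, x ∉ Ioo (-1 : ℝ) 1 → f x = 0
  c2 : ContDiffOn ℝ 2 f (Ioo (-1) 1)
  bdd0 : BddOn (Ioo (-1) 1) fun x => (1 - x ^ 2) ^ ε * f x
  bdd1 : BddOn (Ioo (-1) 1) fun x => (1 - x ^ 2) ^ (1 + ε) * deriv f x
  bdd2 : BddOn (Ioo (-1) 1) fun x => (1 - x ^ 2) ^ (2 + ε) * iteratedDeriv 2 f x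

theorem contDiffAt_of_Ioo {n : ℕ∞ω} {f : ℝ → ℝ} {u v x : ℝ} (hf : ContDiffOn ℝ n f (Ioo u v))
    (hx : x ∈ Ioo u v) : ContDiffAt ℝ n f x :=
  hf.contDiffAt (Ioo_mem_nhds hx.1 hx.2)

theorem deriv_add_of_Ioo {n : ℕ∞ω} (hn : n ≠ 0) {f g : ℝ → ℝ} {u v x : ℝ}
    (hf : ContDiffOn ℝ n f (Ioo u v)) (hg : ContDiffOn ℝ n g (Ioo u v)) (hx : x ∈ Ioo u v) :
    deriv (f + g) x = deriv f x + deriv g x :=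
  deriv_add ((contDiffAt_of_Ioo hf hx).differentiableAt hn)
    ((contDiffAt_of_Ioo hg hx).differentiableAt hn)

theorem deriv_smul_of_Ioo {n : ℕ∞ω} (hn : n ≠ 0) {f : ℝ → ℝ} {u v x : ℝ} (r : ℝ)
    (hf : ContDiffOn ℝ n f (Ioo u v)) (hx : x ∈ Ioo u v) :
    deriv (r • f) x = r * deriv f x := by
  simpa using deriv_const_smul (R := ℝ) r ((contDiffAt_of_Ioo hf hx).differentiableAt hn)

theorem MemM1.add {f g : ℝ → ℝ} (hf : MemM1 f) (hg : MemM1 g) : MemM1 (f + g) where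
  zero_off x hx := by simp [hf.zero_off x hx, hg.zero_off x hx]
  c3 := hf.c3.add hg.c3
  c1 := hf.c1.add hg.c1
  cont := hf.cont.add hg.cont
  bdd0 := hf.bdd0.add hg.bdd0 fun x _ => by simp [mul_add]
  bdd1 := hf.bdd1.add hg.bdd1 fun x hx => by
    rw [deriv_add_of_Ioo one_ne_zero hf.c1 hg.c1 hx, mul_add]
  bdd2 := hf.bdd2.add hg.bdd2 fun x hx =>
    iteratedDeriv_add ((contDiffAt_of_Ioo hf.c3 hx).of_le (by norm_num))
      ((contDiffAt_of_Ioo hg.c3 hx).of_le (by norm_num))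
  bdd3 := hf.bdd3.add hg.bdd3 fun x hx =>
    iteratedDeriv_add (contDiffAt_of_Ioo hf.c3 hx) (contDiffAt_of_Ioo hg.c3 hx)

theorem MemM1.smul {f : ℝ → ℝ} (r : ℝ) (hf : MemM1 f) : MemM1 (r • f) where
  zero_off x hx := by simp [hf.zero_off x hx]
  c3 := contDiffOn_const.smul hf.c3
  c1 := contDiffOn_const.smul hf.c1
  cont := hf.cont.const_smul r
  bdd0 := hf.bdd0.smul r fun x _ => by simp only [Pi.smul_apply, smul_eq_mul]; ring
  bdd1 := hf.bdd1.smul r fun x hx => by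
    rw [deriv_smul_of_Ioo one_ne_zero r hf.c1 hx]; ring
  bdd2 := hf.bdd2.smul r fun x hx =>
    iteratedDeriv_const_smul ((contDiffAt_of_Ioo hf.c3 hx).of_le (by norm_num)) r
  bdd3 := hf.bdd3.smul r fun x hx =>
    iteratedDeriv_const_smul (contDiffAt_of_Ioo hf.c3 hx) r

theorem MemM1.zero : MemM1 0 := by
  refine ⟨fun _ _ => rfl, contDiffOn_const, contDiffOn_const, continuousOn_const,
    BddOn.zero ?_, BddOn.zero ?_, BddOn.zero ?_, BddOn.zero ?_⟩ <;> intro x _ <;> simp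

theorem MemM2.add {ε : ℝ} {f g : ℝ → ℝ} (hf : MemM2 ε f) (hg : MemM2 ε g) : MemM2 ε (f + g) where
  zero_off x hx := by simp [hf.zero_off x hx, hg.zero_off x hx]
  c2 := hf.c2.add hg.c2
  bdd0 := hf.bdd0.add hg.bdd0 fun x _ => by simp [mul_add]
  bdd1 := hf.bdd1.add hg.bdd1 fun x hx => by
    rw [deriv_add_of_Ioo two_ne_zero hf.c2 hg.c2 hx, mul_add]
  bdd2 := hf.bdd2.add hg.bdd2 fun x hx => by
    rw [iteratedDeriv_add (contDiffAt_of_Ioo hf.c2 hx) (contDiffAt_of_Ioo hg.c2 hx), mul_add]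

theorem MemM2.smul {ε : ℝ} {f : ℝ → ℝ} (r : ℝ) (hf : MemM2 ε f) : MemM2 ε (r • f) where
  zero_off x hx := by simp [hf.zero_off x hx]
  c2 := contDiffOn_const.smul hf.c2
  bdd0 := hf.bdd0.smul r fun x _ => by simp only [Pi.smul_apply, smul_eq_mul]; ring
  bdd1 := hf.bdd1.smul r fun x hx => by
    rw [deriv_smul_of_Ioo two_ne_zero r hf.c2 hx]; ring
  bdd2 := hf.bdd2.smul r fun x hx => by
    rw [iteratedDeriv_const_smul (contDiffAt_of_Ioo hf.c2 hx) r, smul_eq_mul]; ring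

theorem MemM2.zero (ε : ℝ) : MemM2 ε 0 := by
  refine ⟨fun _ _ => rfl, contDiffOn_const,
    BddOn.zero ?_, BddOn.zero ?_, BddOn.zero ?_⟩ <;> intro x _ <;> simp

/-- `M₁` as a set of functions. -/
def M1Submodule : Submodule ℝ (ℝ → ℝ) where
  carrier := {f | MemM1 f}
  add_mem' hf hg := hf.add hg
  zero_mem' := MemM1.zero
  smul_mem' r _ hf := hf.smul r

/-- `M₂(ε)` as a set of functions. -/
def M2Submodule (ε : ℝ) : Submodule ℝ (ℝ → ℝ) where
  carrier := {f | MemM2 ε f}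
  add_mem' hf hg := hf.add hg
  zero_mem' := MemM2.zero ε
  smul_mem' r _ hf := hf.smul r

/-- The space `M₁` (a type synonym, which carries the norm topology). -/
def M1 : Type := M1Submodule

/-- The space `M₂(ε)` (a type synonym, which carries the norm topology). -/
def M2 (ε : ℝ) : Type := M2Submodule ε

instance : AddCommGroup M1 := inferInstanceAs (AddCommGroup M1Submodule)
instance : Module ℝ M1 := inferInstanceAs (Module ℝ M1Submodule)
instance (ε : ℝ) : AddCommGroup (M2 ε) := inferInstanceAs (AddCommGroup (M2Submodule ε))
instance (ε : ℝ) : Module ℝ (M2 ε) := inferInstanceAs (Module ℝ (M2Submodule ε))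

/-- The function underlying an element of `M₁`. -/
def M1.fn (f : M1) : ℝ → ℝ := f.1

/-- The function underlying an element of `M₂(ε)`. -/
def M2.fn {ε : ℝ} (f : M2 ε) : ℝ → ℝ := f.1

theorem M1.mem (f : M1) : MemM1 f.fn := f.2
theorem M2.mem {ε : ℝ} (f : M2 ε) : MemM2 ε f.fn := f.2
theorem M1.fn_add (f g : M1) : (f + g).fn = f.fn + g.fn := rfl
theorem M1.fn_smul (r : ℝ) (f : M1) : (r • f).fn = r • f.fn := rfl
theorem M2.fn_add {ε : ℝ} (f g : M2 ε) : (f + g).fn = f.fn + g.fn := rfl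
theorem M2.fn_smul {ε : ℝ} (r : ℝ) (f : M2 ε) : (r • f).fn = r • f.fn := rfl

/-- The norm of `M₁`. -/
instance : Norm M1 where
  norm f :=
    supNorm (Ioo (-1) 1) (fun x => logWeight x * f.fn x) +
    supNorm (Ioo (-1) 1) (fun x => (1 - x ^ 2) * logWeight x ^ 2 * deriv f.fn x) +
    supNorm (Ioo (-1 / 2) (1 / 2)) (iteratedDeriv 2 f.fn) +
    supNorm (Ioo (-1 / 2) (1 / 2)) (iteratedDeriv 3 f.fn)

/-- The norm of `M₂(ε)`. -/
instance (ε : ℝ) : Norm (M2 ε) where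
  norm f :=
    supNorm (Ioo (-1) 1) (fun x => (1 - x ^ 2) ^ ε * f.fn x) +
    supNorm (Ioo (-1) 1) (fun x => (1 - x ^ 2) ^ (1 + ε) * deriv f.fn x) +
    supNorm (Ioo (-1) 1) (fun x => (1 - x ^ 2) ^ (2 + ε) * iteratedDeriv 2 f.fn x)

theorem M1.norm_def (f : M1) : ‖f‖ =
    supNorm (Ioo (-1) 1) (fun x => logWeight x * f.fn x) +
    supNorm (Ioo (-1) 1) (fun x => (1 - x ^ 2) * logWeight x ^ 2 * deriv f.fn x) +
    supNorm (Ioo (-1 / 2) (1 / 2)) (iteratedDeriv 2 f.fn) +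
    supNorm (Ioo (-1 / 2) (1 / 2)) (iteratedDeriv 3 f.fn) := rfl

theorem M2.norm_def {ε : ℝ} (f : M2 ε) : ‖f‖ =
    supNorm (Ioo (-1) 1) (fun x => (1 - x ^ 2) ^ ε * f.fn x) +
    supNorm (Ioo (-1) 1) (fun x => (1 - x ^ 2) ^ (1 + ε) * deriv f.fn x) +
    supNorm (Ioo (-1) 1) (fun x => (1 - x ^ 2) ^ (2 + ε) * iteratedDeriv 2 f.fn x) := rfl

theorem M1.core : NormedSpace.Core ℝ M1 where
  norm_nonneg f := by
    rw [M1.norm_def]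
    have := supNorm_nonneg
    exact add_nonneg (add_nonneg (add_nonneg (this _ _) (this _ _)) (this _ _)) (this _ _)
  norm_smul r f := by
    have h := f.mem
    simp only [M1.norm_def, M1.fn_smul, Real.norm_eq_abs, mul_add]
    congr 1
    · congr 1
      · congr 1
        · exact supNorm_smul r fun x _ => by simp only [Pi.smul_apply, smul_eq_mul]; ring
        · exact supNorm_smul r fun x hx => by
            rw [deriv_smul_of_Ioo one_ne_zero r h.c1 hx]; ring
      · exact supNorm_smul r fun x hx =>
          iteratedDeriv_const_smul ((contDiffAt_of_Ioo h.c3 hx).of_le (by norm_num)) r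
    · exact supNorm_smul r fun x hx => iteratedDeriv_const_smul (contDiffAt_of_Ioo h.c3 hx) r
  norm_triangle f g := by
    have hf := f.mem
    have hg := g.mem
    simp only [M1.norm_def, M1.fn_add]
    have h0 := supNorm_add_le (k := fun x => logWeight x * (f.fn + g.fn) x) hf.bdd0 hg.bdd0
      fun x _ => by simp [mul_add]
    have h1 := supNorm_add_le
      (k := fun x => (1 - x ^ 2) * logWeight x ^ 2 * deriv (f.fn + g.fn) x) hf.bdd1 hg.bdd1
      fun x hx => by rw [deriv_add_of_Ioo one_ne_zero hf.c1 hg.c1 hx, mul_add]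
    have h2 := supNorm_add_le (k := iteratedDeriv 2 (f.fn + g.fn)) hf.bdd2 hg.bdd2 fun x hx =>
      iteratedDeriv_add ((contDiffAt_of_Ioo hf.c3 hx).of_le (by norm_num))
        ((contDiffAt_of_Ioo hg.c3 hx).of_le (by norm_num))
    have h3 := supNorm_add_le (k := iteratedDeriv 3 (f.fn + g.fn)) hf.bdd3 hg.bdd3 fun x hx =>
      iteratedDeriv_add (contDiffAt_of_Ioo hf.c3 hx) (contDiffAt_of_Ioo hg.c3 hx)
    linarith
  norm_eq_zero_iff f := by
    have hf := f.mem
    constructor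
    · intro h
      rw [M1.norm_def] at h
      have n0 := supNorm_nonneg (Ioo (-1) 1) (fun x => logWeight x * f.fn x)
      have n1 := supNorm_nonneg (Ioo (-1) 1)
        (fun x => (1 - x ^ 2) * logWeight x ^ 2 * deriv f.fn x)
      have n2 := supNorm_nonneg (Ioo (-1 / 2) (1 / 2)) (iteratedDeriv 2 f.fn)
      have n3 := supNorm_nonneg (Ioo (-1 / 2) (1 / 2)) (iteratedDeriv 3 f.fn)
      refine Subtype.ext (funext fun x => ?_)
      change f.fn x = 0
      by_cases hx : x ∈ Ioo (-1 : ℝ) 1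
      · have h4 := le_supNorm hf.bdd0 hx
        have h5 : logWeight x * f.fn x = 0 := abs_eq_zero.1 (le_antisymm (by linarith) (abs_nonneg _))
        exact (mul_eq_zero.1 h5).resolve_left (logWeight_ne_zero hx)
      · exact hf.zero_off x hx
    · rintro rfl
      have h0 : (0 : M1).fn = 0 := rfl
      simp [M1.norm_def, h0, supNorm]

theorem M2.core (ε : ℝ) : NormedSpace.Core ℝ (M2 ε) where
  norm_nonneg f := by
    rw [M2.norm_def]
    have := supNorm_nonneg
    exact add_nonneg (add_nonneg (this _ _) (this _ _)) (this _ _)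
  norm_smul r f := by
    have h := f.mem
    simp only [M2.norm_def, M2.fn_smul, Real.norm_eq_abs, mul_add]
    congr 1
    · congr 1
      · exact supNorm_smul r fun x _ => by simp only [Pi.smul_apply, smul_eq_mul]; ring
      · exact supNorm_smul r fun x hx => by
          rw [deriv_smul_of_Ioo two_ne_zero r h.c2 hx]; ring
    · exact supNorm_smul r fun x hx => by
        rw [iteratedDeriv_const_smul (contDiffAt_of_Ioo h.c2 hx) r, smul_eq_mul]; ring
  norm_triangle f g := by
    have hf := f.mem
    have hg := g.mem
    simp only [M2.norm_def, M2.fn_add]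
    have h0 := supNorm_add_le (k := fun x => (1 - x ^ 2) ^ ε * (f.fn + g.fn) x) hf.bdd0 hg.bdd0
      fun x _ => by simp [mul_add]
    have h1 := supNorm_add_le
      (k := fun x => (1 - x ^ 2) ^ (1 + ε) * deriv (f.fn + g.fn) x) hf.bdd1 hg.bdd1
      fun x hx => by rw [deriv_add_of_Ioo two_ne_zero hf.c2 hg.c2 hx, mul_add]
    have h2 := supNorm_add_le
      (k := fun x => (1 - x ^ 2) ^ (2 + ε) * iteratedDeriv 2 (f.fn + g.fn) x) hf.bdd2 hg.bdd2
      fun x hx => by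
        rw [iteratedDeriv_add (contDiffAt_of_Ioo hf.c2 hx) (contDiffAt_of_Ioo hg.c2 hx), mul_add]
    linarith
  norm_eq_zero_iff f := by
    have hf := f.mem
    constructor
    · intro h
      rw [M2.norm_def] at h
      have n0 := supNorm_nonneg (Ioo (-1) 1) (fun x => (1 - x ^ 2) ^ ε * f.fn x)
      have n1 := supNorm_nonneg (Ioo (-1) 1) (fun x => (1 - x ^ 2) ^ (1 + ε) * deriv f.fn x)
      have n2 := supNorm_nonneg (Ioo (-1) 1)
        (fun x => (1 - x ^ 2) ^ (2 + ε) * iteratedDeriv 2 f.fn x)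
      refine Subtype.ext (funext fun x => ?_)
      change f.fn x = 0
      by_cases hx : x ∈ Ioo (-1 : ℝ) 1
      · have h4 := le_supNorm hf.bdd0 hx
        have h5 : (1 - x ^ 2) ^ ε * f.fn x = 0 :=
          abs_eq_zero.1 (le_antisymm (by linarith) (abs_nonneg _))
        have h6 : 0 < (1 - x ^ 2) ^ ε :=
          Real.rpow_pos_of_pos (by nlinarith [mul_pos (sub_pos.2 hx.1) (sub_pos.2 hx.2)]) _
        exact (mul_eq_zero.1 h5).resolve_left h6.ne'
      · exact hf.zero_off x hx
    · rintro rfl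
      have h0 : (0 : M2 ε).fn = 0 := rfl
      simp [M2.norm_def, h0, supNorm]

instance : NormedAddCommGroup M1 := NormedAddCommGroup.ofCore M1.core
instance : NormedSpace ℝ M1 := NormedSpace.ofCore M1.core
instance (ε : ℝ) : NormedAddCommGroup (M2 ε) := NormedAddCommGroup.ofCore (M2.core ε)
instance (ε : ℝ) : NormedSpace ℝ (M2 ε) := NormedSpace.ofCore (M2.core ε)

/-- The space `X = M₁ × M₂(ε)` with norm `‖U‖ = ‖Uθ‖ + ‖Uφ‖`. -/
abbrev X (ε : ℝ) : Type := WithLp 1 (M1 × M2 ε)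

/-- The `θ`-component of an element of `X`, as a function. -/
def X.θ {ε : ℝ} (U : X ε) : ℝ → ℝ := U.fst.fn

/-- The `φ`-component of an element of `X`, as a function. -/
def X.φ {ε : ℝ} (U : X ε) : ℝ → ℝ := U.snd.fn

theorem X.norm_eq {ε : ℝ} (U : X ε) : ‖U‖ = ‖U.fst‖ + ‖U.snd‖ := by
  exact WithLp.prod_norm_eq_of_L1 U

/-- `l₁(V) = Vθ(0)`. -/
def l1 (ε : ℝ) : X ε →ₗ[ℝ] ℝ where
  toFun V := X.θ V 0
  map_add' _ _ := rfl
  map_smul' _ _ := rfl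

/-- `l₂(V) = Vθ'(0)`. -/
def l2 (ε : ℝ) : X ε →ₗ[ℝ] ℝ where
  toFun V := deriv (X.θ V) 0
  map_add' V W := deriv_add_of_Ioo one_ne_zero V.fst.mem.c1 W.fst.mem.c1 (by norm_num)
  map_smul' r V := deriv_smul_of_Ioo one_ne_zero r V.fst.mem.c1 (by norm_num)

/-- `l₃(V) = Vφ'(0)`. -/
def l3 (ε : ℝ) : X ε →ₗ[ℝ] ℝ where
  toFun V := deriv (X.φ V) 0
  map_add' V W := deriv_add_of_Ioo two_ne_zero V.snd.mem.c2 W.snd.mem.c2 (by norm_num)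
  map_smul' r V := deriv_smul_of_Ioo two_ne_zero r V.snd.mem.c2 (by norm_num)

/-- `l₄(V) = Vφ(0)`. -/
def l4 (ε : ℝ) : X ε →ₗ[ℝ] ℝ where
  toFun V := X.φ V 0
  map_add' _ _ := rfl
  map_smul' _ _ := rfl

/-- The space `X₁ = ker l₁ ∩ ker l₂ ∩ ker l₃ ∩ ker l₄`, with the norm of `X`. -/
def X1 (ε : ℝ) : Submodule ℝ (X ε) :=
  LinearMap.ker (l1 ε) ⊓ LinearMap.ker (l2 ε) ⊓ LinearMap.ker (l3 ε) ⊓ LinearMap.ker (l4 ε)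

/-- `f` is of class `C^∞` on an arbitrary subset `s`: it is so on an open neighbourhood of `s`
(`f` being total, its values off `s` only serve as a smooth extension). -/
def SmoothOn {E F : Type*} [NormedAddCommGroup E] [NormedSpace ℝ E]
    [NormedAddCommGroup F] [NormedSpace ℝ F] (f : E → F) (s : Set E) : Prop :=
  ∃ W : Set E, IsOpen W ∧ s ⊆ W ∧ ContDiffOn ℝ ∞ f W

/-- The `θ`-component of the perturbation `∑ βᵢ Vⁱ_{c,γ} + v`. -/
def pertθ {ε : ℝ} (p : Param) (β : EuclideanSpace ℝ (Fin 4)) (v : X ε) : ℝ → ℝ :=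
  fun x => ∑ i, β i * Vθ p i x + X.θ v x

/-- The `φ`-component of the perturbation `∑ βᵢ Vⁱ_{c,γ} + v`. -/
def pertφ {ε : ℝ} (p : Param) (β : EuclideanSpace ℝ (Fin 4)) (v : X ε) : ℝ → ℝ :=
  fun x => ∑ i, β i * Vφ p i x + X.φ v x

end LogSwirl

end

open LogSwirl

noncomputable section

namespace LogSwirl

/-! In the variable `t = artanh x`, with `Φ = 2x + U_θ` and `G = U_φ`, the reduced system reads `Φ'
+ Φ²/2 = R` and `G'' = -Φ G'`, where `R = P_ĉ + 2 - ψ`. The substitution `Φ = 2 Z'/Z` turns the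
Riccati equation into `Z'' = (R/2) Z`, and the swirl equation integrates to `G' = κ / Z²`. Without
swirl and with `c₁ = c₂ = -1` one has `R = c₃ sech² t`, and the strict inequalities `γ⁻ < γ < γ⁺`
mean that `Z` is positive and grows at least linearly at both ends (`exists_base_isLinSol`). Hence
`Φ = O(1/(1+|t|))`, and the logarithmic weights of `M₁` are controlled by powers of `1 + |t|`.

A perturbation in `M₁` vanishes at the poles, so `Φ → 0` and therefore `R → 0` at `±∞`. This fixes
`ĉ₁` and `ĉ₂`; one free constant `ρ = R(0)` remains, and `R` is `rhs ρ f`. The swirl enters `R` only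
through the density `f = G G'`, linearly, and conversely `f = μ Z⁻² + ν Z⁻² ∫ Z⁻²` with `μ = κ
G(0)`, `ν = κ²`. The whole system is thus a single equation `fixE = 0` for `f` in an exponentially
weighted space of continuous functions, depending smoothly on `(ρ, Z'(0), μ, ν)`. For `μ = ν = 0`
the equation says that the density is zero, so its derivative in the density is the identity there,
and the implicit function theorem along a compact set (`exists_implicit_of_compact`,
`exists_density`) yields a smooth family of solutions together with local uniqueness.

The coordinates `coord` are quadratic in `β`, in such a way that `Φ(0)`, `Φ'(0)`, `G(0)`, `G'(0)`
are affine in `β`. The correction `V` is the remainder of the first order Taylor expansion in `β` of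
a smooth family of data, carried into `X₁` by the bounded operator `dataOp`; so `V` and its first
derivatives vanish at `β = 0`. That the first order part is `∑ βᵢ Vⁱ` is variation of constants
(`deriv_phi_mul_sq`), the density being quadratic in the swirl. Conversely a nearby solution
determines `β` from its values and first derivatives at `0`, and a density of norm at most `‖Ũ‖²`
solving the same equation (`exists_coord_of_isReducedSolution`), so uniqueness applies. -/

/-! ### The implicit function theorem along a compact set. -/

/-- Implicit function theorem along a compact set of parameters: if `E (p, 0) = 0` for `p` in a
compact set `C` and the partial derivative of `E` there is the identity, then near `C × {0}` the
zero set of `E` is the graph of a smooth function on a neighbourhood of `C`. -/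
theorem exists_implicit_of_compact {P A : Type*} [NormedAddCommGroup P] [NormedSpace ℝ P]
    [CompleteSpace P] [NormedAddCommGroup A] [NormedSpace ℝ A] [CompleteSpace A]
    {E : P × A → A} {Ω : Set (P × A)} (hΩ : IsOpen Ω) (hE : ContDiffOn ℝ ∞ E Ω)
    {C : Set P} (hC : IsCompact C) (hCΩ : ∀ p ∈ C, (p, (0 : A)) ∈ Ω)
    (hE0 : ∀ p ∈ C, E (p, 0) = 0)
    (hE1 : ∀ p ∈ C, ∀ y, fderiv ℝ E (p, 0) (0, y) = y) :
    ∃ (O : Set P) (s : P → A) (N : Set (P × A)), IsOpen O ∧ C ⊆ O ∧ ContDiffOn ℝ ∞ s O ∧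
      IsOpen N ∧ (∀ p ∈ C, (p, (0 : A)) ∈ N) ∧ N ⊆ Ω ∧
      (∀ p ∈ O, (p, s p) ∈ N ∧ E (p, s p) = 0) ∧
      ∀ p y, (p, y) ∈ N → E (p, y) = 0 → p ∈ O ∧ y = s p := by
  -- The zeros of `E` are the points sent by `Ψ` into `P × {0}`, so local invertibility of `Ψ` gives
  -- existence, and its injectivity gives uniqueness.
  set Ψ : P × A → P × A := fun z => (z.1, E z) with hΨ
  have hΨs : ContDiffOn ℝ ∞ Ψ Ω := contDiffOn_fst.prodMk hE
  set G : Set (P × A) := C ×ˢ {0} with hG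
  have hGc : IsCompact G := hC.prod isCompact_singleton
  have hGΩ : G ⊆ Ω := by
    rintro ⟨p, y⟩ ⟨hp, hy⟩
    obtain rfl : y = 0 := hy
    exact hCΩ p hp
  -- Invertible operators form an open set, so invertibility of the derivative passes from `G` to a
  -- neighbourhood. It is needed at every zero of `E` in `N`, not only over `C`.
  set U : Set (P × A) := {z ∈ Ω | fderiv ℝ Ψ z ∈
    range ((↑) : ((P × A) ≃L[ℝ] (P × A)) → (P × A) →L[ℝ] (P × A))} with hU
  have hUo : IsOpen U := by
    have h1 : ContinuousOn (fderiv ℝ Ψ) Ω :=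
      (hΨs.continuousOn_fderiv_of_isOpen hΩ (by norm_num))
    exact h1.isOpen_inter_preimage hΩ ContinuousLinearEquiv.isOpen
  have hGU : G ⊆ U := by
    rintro ⟨p, y⟩ ⟨hp, hy⟩
    obtain rfl : y = 0 := hy
    refine ⟨hCΩ p hp, ?_⟩
    have hd : DifferentiableAt ℝ E (p, (0 : A)) :=
      (hE.contDiffAt (hΩ.mem_nhds (hCΩ p hp))).differentiableAt (by norm_num)
    have hf : fderiv ℝ Ψ (p, 0) =
        (ContinuousLinearMap.fst ℝ P A).prod (fderiv ℝ E (p, 0)) :=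
      ((ContinuousLinearMap.fst ℝ P A).hasFDerivAt.prodMk hd.hasFDerivAt).fderiv
    have key : ∀ v w, fderiv ℝ E (p, (0 : A)) (v, w) = fderiv ℝ E (p, (0 : A)) (v, 0) + w := by
      intro v w
      conv_rhs => rw [← hE1 p hp w]
      rw [← map_add]
      simp
    set L := fderiv ℝ E (p, (0 : A)) with hL
    -- Since `L (v, w) = L (v, 0) + w`, the derivative is triangular with identities on the
    -- diagonal, with inverse `(v, w) ↦ (v, w - L (v, 0))`.
    refine ⟨ContinuousLinearEquiv.equivOfInverse
      ((ContinuousLinearMap.fst ℝ P A).prod L)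
      ((ContinuousLinearMap.fst ℝ P A).prod (ContinuousLinearMap.snd ℝ P A -
        L.comp ((ContinuousLinearMap.fst ℝ P A).prod 0))) ?_ ?_, ?_⟩
    · rintro ⟨v, w⟩
      refine Prod.ext rfl ?_
      change L (v, w) - L (v, 0) = w
      rw [key, add_sub_cancel_left]
    · rintro ⟨v, w⟩
      refine Prod.ext rfl ?_
      change L (v, w - L (v, 0)) = w
      rw [key, add_sub_cancel]
    · rw [hf]; rfl
  have hat : ∀ z ∈ U, ContDiffAt ℝ ∞ Ψ z := fun z hz => hΨs.contDiffAt (hΩ.mem_nhds hz.1)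
  have hloc : ∀ z ∈ U, ∃ u ∈ 𝓝 z, InjOn Ψ u := by
    intro z hz
    obtain ⟨e, he⟩ := hz.2
    have hs : HasFDerivAt Ψ (e : (P × A) →L[ℝ] (P × A)) z := by
      rw [he]; exact ((hat z hz).differentiableAt (by norm_num)).hasFDerivAt
    set φ := (hat z hz).toOpenPartialHomeomorph Ψ hs (by norm_num)
    refine ⟨φ.source, φ.open_source.mem_nhds
      ((hat z hz).mem_toOpenPartialHomeomorph_source hs (by norm_num)), φ.injOn⟩
  have hinj : InjOn Ψ G := by
    rintro ⟨p, y⟩ ⟨_, hy⟩ ⟨p', y'⟩ ⟨_, hy'⟩ h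
    obtain rfl : y = 0 := hy
    obtain rfl : y' = 0 := hy'
    rw [show p = p' from congrArg Prod.fst h]
  -- Injectivity on a compact set together with local injectivity at its points gives injectivity on
  -- a neighbourhood. This merges the local inverses into one graph.
  obtain ⟨N₀, hN₀, hGN₀, hN₀inj⟩ := hinj.exists_isOpen_superset hGc
    (fun z hz => (hat z (hGU hz)).continuousAt) (fun z hz => hloc z (hGU hz))
  set N := N₀ ∩ U with hN
  have hNo : IsOpen N := hN₀.inter hUo
  set O : Set P := {p | ∃ y, (p, y) ∈ N ∧ E (p, y) = 0} with hO
  choose! s hs using (fun p (hp : p ∈ O) => hp)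
  have huniq : ∀ p y, (p, y) ∈ N → E (p, y) = 0 → p ∈ O ∧ y = s p := by
    intro p y h1 h2
    have hp : p ∈ O := ⟨y, h1, h2⟩
    refine ⟨hp, ?_⟩
    have := hN₀inj h1.1 (hs p hp).1.1 (by simp [Ψ, h2, (hs p hp).2])
    exact congrArg Prod.snd this
  -- Near `p` the local inverse at `(p', 0)` supplies a zero in `N` above `p'`. By uniqueness it is
  -- `s p'`, so `O` is open and `s` inherits the smoothness of the inverse.
  have hmain : ∀ p ∈ O, O ∈ 𝓝 p ∧ ContDiffAt ℝ ∞ s p := by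
    intro p hp
    obtain ⟨hz, hz0⟩ := hs p hp
    obtain ⟨e, he⟩ := hz.2.2
    have hzd := hat _ hz.2
    have hfd : HasFDerivAt Ψ (e : (P × A) →L[ℝ] (P × A)) (p, s p) := by
      rw [he]; exact (hzd.differentiableAt (by norm_num)).hasFDerivAt
    set φ := hzd.toOpenPartialHomeomorph Ψ hfd (by norm_num)
    set g := hzd.localInverse hfd (by norm_num) with hg
    have hgs : ContDiffAt ℝ ∞ g (Ψ (p, s p)) := hzd.to_localInverse hfd (by norm_num)
    have hgi : g (Ψ (p, s p)) = (p, s p) := hzd.localInverse_apply_image hfd (by norm_num)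
    have hΨp : Ψ (p, s p) = (p, 0) := by simp [Ψ, hz0]
    have hri : ∀ᶠ w in 𝓝 (Ψ (p, s p)), Ψ (g w) = w :=
      (hzd.hasStrictFDerivAt' hfd (by norm_num)).eventually_right_inverse
    have hgN : ∀ᶠ w in 𝓝 (Ψ (p, s p)), g w ∈ N := by
      refine hgs.continuousAt.eventually_mem ?_
      rw [hgi]; exact hNo.mem_nhds hz
    have hι : ContDiffAt ℝ ∞ (fun p' : P => (p', (0 : A))) p :=
      contDiffAt_id.prodMk contDiffAt_const
    rw [hΨp] at hri hgN hgs
    have hev : ∀ᶠ p' in 𝓝 p, Ψ (g (p', 0)) = (p', 0) ∧ g (p', 0) ∈ N :=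
      (hι.continuousAt.eventually (hri.and hgN))
    have hev' : ∀ᶠ p' in 𝓝 p, p' ∈ O ∧ s p' = (g (p', 0)).2 := by
      filter_upwards [hev] with p' hp'
      have h1 : (g (p', 0)).1 = p' := congrArg Prod.fst hp'.1
      have h2 : E (g (p', 0)) = 0 := congrArg Prod.snd hp'.1
      have h3 : g (p', 0) = (p', (g (p', 0)).2) := Prod.ext h1 rfl
      have h4 := huniq p' (g (p', 0)).2 (h3 ▸ hp'.2) (h3 ▸ h2)
      exact ⟨h4.1, h4.2.symm⟩
    refine ⟨hev'.mono fun _ h => h.1, ?_⟩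
    have hc : ContDiffAt ℝ ∞ (fun p' => (g (p', 0)).2) p :=
      contDiffAt_snd.comp p (ContDiffAt.comp p hgs hι)
    exact hc.congr_of_eventuallyEq (hev'.mono fun _ h => h.2)
  refine ⟨O, s, N, isOpen_iff_mem_nhds.2 fun p hp => (hmain p hp).1, fun p hp => ?_,
    fun p hp => (hmain p hp).2.contDiffWithinAt, hNo, fun p hp => ?_, fun z hz => hz.2.1, hs,
    huniq⟩
  · exact ⟨0, ⟨hGN₀ ⟨hp, rfl⟩, hGU ⟨hp, rfl⟩⟩, hE0 p hp⟩
  · exact ⟨hGN₀ ⟨hp, rfl⟩, hGU ⟨hp, rfl⟩⟩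

/-! ## Bounds for primitives -/

theorem abs_integral_le_of_deriv_of_nonneg {f g G : ℝ → ℝ}
    (hg : Continuous fun s => g |s|) (hG : ∀ s, 0 ≤ s → HasDerivAt G (g s) s)
    (h : ∀ s, |f s| ≤ g |s|) {t : ℝ} (ht : 0 ≤ t) : |∫ s in (0 : ℝ)..t, f s| ≤ G t - G 0 := by
  have h1 : ∫ s in (0 : ℝ)..t, g |s| = G t - G 0 := by
    refine intervalIntegral.integral_eq_sub_of_hasDerivAt (fun s hs => ?_)
      (hg.intervalIntegrable _ _)
    rw [uIcc_of_le ht] at hs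
    simpa [abs_of_nonneg hs.1] using hG s hs.1
  rw [← h1]
  have := intervalIntegral.norm_integral_le_of_norm_le (f := f) (g := fun s => g |s|) (μ := volume)
    ht (Filter.Eventually.of_forall fun s _ => h s) (hg.intervalIntegrable _ _)
  simpa using this

theorem abs_integral_le_of_deriv {f g G : ℝ → ℝ}
    (hg : Continuous fun s => g |s|) (hG : ∀ s, 0 ≤ s → HasDerivAt G (g s) s)
    (h : ∀ s, |f s| ≤ g |s|) (t : ℝ) : |∫ s in (0 : ℝ)..t, f s| ≤ G |t| - G 0 := by
  rcases le_total 0 t with ht | ht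
  · rw [abs_of_nonneg ht]
    exact abs_integral_le_of_deriv_of_nonneg hg hG h ht
  · have h1 : ∫ s in (0 : ℝ)..t, f s = -∫ s in (0 : ℝ)..(-t), f (-s) := by
      rw [intervalIntegral.integral_comp_neg, neg_neg, neg_zero, ← intervalIntegral.integral_symm]
    rw [h1, abs_neg, abs_of_nonpos ht]
    exact abs_integral_le_of_deriv_of_nonneg hg hG
      (fun s => by simpa using h (-s)) (neg_nonneg.2 ht)

theorem hasDerivAt_exp_mul_div {c : ℝ} (hc : c ≠ 0) (s : ℝ) :
    HasDerivAt (fun s => Real.exp (c * s) / c) (Real.exp (c * s)) s := by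
  have := (((hasDerivAt_id s).const_mul c).exp).div_const c
  simpa [hc] using this

theorem abs_integral_le_exp {f : ℝ → ℝ} {C c : ℝ} (hC : 0 ≤ C) (hc : 0 < c)
    (h : ∀ s, |f s| ≤ C * Real.exp (c * |s|)) (t : ℝ) :
    |∫ s in (0 : ℝ)..t, f s| ≤ C / c * Real.exp (c * |t|) := by
  have h1 := abs_integral_le_of_deriv (g := fun s => C * Real.exp (c * s))
    (G := fun s => C * (Real.exp (c * s) / c)) (by fun_prop)
    (fun s _ => (hasDerivAt_exp_mul_div hc.ne' s).const_mul C) h t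
  refine h1.trans ?_
  simp only [mul_zero, Real.exp_zero]
  have : 0 ≤ C * (1 / c) := by positivity
  have h2 : C / c * Real.exp (c * |t|) = C * (Real.exp (c * |t|) / c) := by ring
  linarith

theorem abs_integral_le_exp_neg {f : ℝ → ℝ} {C c : ℝ} (hC : 0 ≤ C) (hc : 0 < c)
    (h : ∀ s, |f s| ≤ C * Real.exp (-c * |s|)) (t : ℝ) :
    |∫ s in (0 : ℝ)..t, f s| ≤ C / c := by
  have h1 := abs_integral_le_of_deriv (g := fun s => C * Real.exp (-c * s))
    (G := fun s => C * (Real.exp (-c * s) / -c)) (by fun_prop)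
    (fun s _ => (hasDerivAt_exp_mul_div (neg_ne_zero.2 hc.ne') s).const_mul C) h t
  refine h1.trans ?_
  simp only [mul_zero, Real.exp_zero]
  have : 0 ≤ C * (Real.exp (-c * |t|) / c) := by positivity
  have h2 : C * (Real.exp (-c * |t|) / -c) = -(C * (Real.exp (-c * |t|) / c)) := by
    rw [div_neg, mul_neg]
  have h3 : C * (1 / -c) = -(C / c) := by rw [div_neg, mul_neg, mul_one_div]
  linarith

theorem hasDerivAt_primitive {f : ℝ → ℝ} (hf : Continuous f) (t : ℝ) :
    HasDerivAt (fun t => ∫ s in (0 : ℝ)..t, f s) (f t) t :=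
  intervalIntegral.integral_hasDerivAt_right (hf.intervalIntegrable _ _)
    hf.stronglyMeasurable.stronglyMeasurableAtFilter hf.continuousAt

theorem continuous_primitive_zero {f : ℝ → ℝ} (hf : Continuous f) :
    Continuous fun t => ∫ s in (0 : ℝ)..t, f s :=
  continuous_iff_continuousAt.2 fun t => (hasDerivAt_primitive hf t).continuousAt

theorem eq_add_primitive {F f : ℝ → ℝ} (hF : ∀ t, HasDerivAt F (f t) t) (hf : Continuous f)
    (t : ℝ) : F t = F 0 + ∫ s in (0 : ℝ)..t, f s := by
  rw [intervalIntegral.integral_eq_sub_of_hasDerivAt (fun s _ => hF s) (hf.intervalIntegrable _ _)]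
  ring

/-! ## The variable `t = artanh x` -/

/-- `sech² t = 1 - tanh² t`. -/
def sechSq (t : ℝ) : ℝ := (Real.cosh t ^ 2)⁻¹

theorem sechSq_pos (t : ℝ) : 0 < sechSq t := inv_pos.2 (pow_pos (Real.cosh_pos t) 2)

theorem sechSq_mul_cosh_sq (t : ℝ) : sechSq t * Real.cosh t ^ 2 = 1 :=
  inv_mul_cancel₀ (pow_pos (Real.cosh_pos t) 2).ne'

theorem continuous_tanh : Continuous Real.tanh := by
  simp_rw [funext Real.tanh_eq_sinh_div_cosh]
  exact Real.continuous_sinh.div Real.continuous_cosh fun t => (Real.cosh_pos t).ne'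

theorem continuous_sechSq : Continuous sechSq :=
  (Real.continuous_cosh.pow 2).inv₀ fun t => (pow_pos (Real.cosh_pos t) 2).ne'

theorem one_sub_tanh_sq (t : ℝ) : 1 - Real.tanh t ^ 2 = sechSq t := by
  have h := (Real.cosh_pos t).ne'
  rw [Real.tanh_eq_sinh_div_cosh, sechSq]
  have := Real.cosh_sq t
  field_simp
  linarith

theorem hasDerivAt_tanh (t : ℝ) : HasDerivAt Real.tanh (sechSq t) t := by
  have h := (Real.hasDerivAt_sinh t).div (Real.hasDerivAt_cosh t) (Real.cosh_pos t).ne'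
  have h2 : Real.tanh = Real.sinh / Real.cosh := funext Real.tanh_eq_sinh_div_cosh
  rw [h2]
  refine h.congr_deriv ?_
  have h3 : Real.cosh t * Real.cosh t - Real.sinh t * Real.sinh t = 1 := by
    have := Real.cosh_sq t
    linarith
  rw [h3, one_div, sechSq]

theorem hasDerivAt_sechSq (t : ℝ) : HasDerivAt sechSq (-2 * Real.tanh t * sechSq t) t := by
  have h : sechSq = fun t => 1 - Real.tanh t ^ 2 := funext fun t => (one_sub_tanh_sq t).symm
  rw [h]
  exact (((hasDerivAt_tanh t).pow 2).const_sub 1).congr_deriv (by simp [h])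

theorem tanh_mem_Ioo (t : ℝ) : Real.tanh t ∈ Ioo (-1 : ℝ) 1 :=
  Real.tanh_bijOn.mapsTo (mem_univ t)

theorem abs_tanh_le (t : ℝ) : |Real.tanh t| ≤ 1 :=
  abs_le.2 ⟨(tanh_mem_Ioo t).1.le, (tanh_mem_Ioo t).2.le⟩

theorem cosh_le_exp_abs (t : ℝ) : Real.cosh t ≤ Real.exp |t| := by
  rw [← Real.cosh_abs, Real.cosh_eq]
  have : Real.exp (-|t|) ≤ Real.exp |t| := Real.exp_le_exp.2 (by linarith [abs_nonneg t])
  linarith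

theorem exp_abs_le_two_mul_cosh (t : ℝ) : Real.exp |t| ≤ 2 * Real.cosh t := by
  rw [← Real.cosh_abs, Real.cosh_eq]
  have := Real.exp_pos (-|t|)
  linarith

theorem cosh_sq_le (t : ℝ) : Real.cosh t ^ 2 ≤ Real.exp (2 * |t|) := by
  rw [two_mul, Real.exp_add, ← sq]
  exact pow_le_pow_left₀ (Real.cosh_pos t).le (cosh_le_exp_abs t) 2

theorem sechSq_le (t : ℝ) : sechSq t ≤ 4 * Real.exp (-2 * |t|) := by
  have h : Real.exp (2 * |t|) ≤ 4 * Real.cosh t ^ 2 := by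
    rw [two_mul, Real.exp_add, ← sq]
    have := pow_le_pow_left₀ (Real.exp_pos _).le (exp_abs_le_two_mul_cosh t) 2
    linarith [this, mul_pow 2 (Real.cosh t) 2]
  rw [sechSq, neg_mul, Real.exp_neg, inv_le_comm₀ (pow_pos (Real.cosh_pos t) 2) (by positivity),
    mul_inv, inv_inv]
  linarith

theorem le_sechSq (t : ℝ) : Real.exp (-2 * |t|) ≤ sechSq t := by
  rw [sechSq, neg_mul, Real.exp_neg]
  exact inv_anti₀ (pow_pos (Real.cosh_pos t) 2) (cosh_sq_le t)

theorem sechSq_le_one (t : ℝ) : sechSq t ≤ 1 := by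
  rw [← one_sub_tanh_sq]
  linarith [sq_nonneg (Real.tanh t)]

theorem hasDerivAt_artanh {x : ℝ} (hx : x ∈ Ioo (-1 : ℝ) 1) :
    HasDerivAt Real.artanh (1 - x ^ 2)⁻¹ x := by
  have h := (hasDerivAt_tanh (Real.artanh x)).of_local_left_inverse (g := Real.artanh) (a := x)
  rw [← one_sub_tanh_sq, Real.tanh_artanh hx] at h
  refine h ?_ ?_ ?_
  · exact Real.strictMonoOn_artanh.continuousAt_of_image_mem_nhds
      (isOpen_Ioo.mem_nhds hx) (by rw [Real.artanh_bijOn.image_eq]; exact Filter.univ_mem)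
  · have := mul_pos (sub_pos.2 hx.1) (sub_pos.2 hx.2)
    nlinarith
  · filter_upwards [isOpen_Ioo.mem_nhds hx] with y hy using Real.tanh_artanh hy

/-! ## Exponentially decaying functions and their primitives -/

/-- `∫₀^∞ y`. -/
def limPlus (y : ℝ → ℝ) : ℝ := ∫ s in Ioi (0 : ℝ), y s

/-- `∫₀^{-∞} y`. -/
def limMinus (y : ℝ → ℝ) : ℝ := -∫ s in Iic (0 : ℝ), y s

theorem integrableOn_Ioi_of_exp_bound {y : ℝ → ℝ} (hy : Continuous y) {D b : ℝ} (hb : 0 < b)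
    (h : ∀ s, |y s| ≤ D * Real.exp (-b * |s|)) : IntegrableOn y (Ioi 0) := by
  have h1 : IntegrableOn (fun s => D * Real.exp (-b * s)) (Ioi 0) :=
    (exp_neg_integrableOn_Ioi 0 hb).const_mul D
  refine Integrable.mono' h1 hy.aestronglyMeasurable ?_
  refine (ae_restrict_mem measurableSet_Ioi).mono fun s hs => ?_
  simpa [abs_of_pos (mem_Ioi.1 hs)] using h s

theorem integrableOn_Iic_of_exp_bound {y : ℝ → ℝ} (hy : Continuous y) {D b : ℝ} (hb : 0 < b)
    (h : ∀ s, |y s| ≤ D * Real.exp (-b * |s|)) : IntegrableOn y (Iic 0) := by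
  have h1 := integrableOn_Ioi_of_exp_bound (hy.comp continuous_neg) hb
    (fun s => by simpa using h (-s))
  rw [← neg_zero] at h1
  have h2 := ((integrableOn_Ici_iff_integrableOn_Ioi (by simp)).2 h1).comp_neg_Iic
  simpa [Function.comp_def] using h2

theorem limMinus_eq_neg_limPlus (y : ℝ → ℝ) : limMinus y = -limPlus fun s => y (-s) := by
  rw [limMinus, limPlus, integral_comp_neg_Ioi, neg_zero]

theorem limPlus_add {y z : ℝ → ℝ} (hy : IntegrableOn y (Ioi 0)) (hz : IntegrableOn z (Ioi 0)) :
    limPlus (fun s => y s + z s) = limPlus y + limPlus z := integral_add hy hz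

theorem limPlus_smul (r : ℝ) (y : ℝ → ℝ) : limPlus (fun s => r * y s) = r * limPlus y :=
  integral_const_mul r y

theorem limMinus_add {y z : ℝ → ℝ} (hy : IntegrableOn y (Iic 0)) (hz : IntegrableOn z (Iic 0)) :
    limMinus (fun s => y s + z s) = limMinus y + limMinus z := by
  rw [limMinus, integral_add hy hz, limMinus, limMinus]; ring

theorem limMinus_smul (r : ℝ) (y : ℝ → ℝ) : limMinus (fun s => r * y s) = r * limMinus y := by
  rw [limMinus, integral_const_mul, limMinus]; ring

theorem tendsto_primitive_limPlus {y : ℝ → ℝ} (hy : IntegrableOn y (Ioi 0)) :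
    Filter.Tendsto (fun t => ∫ s in (0 : ℝ)..t, y s) Filter.atTop (𝓝 (limPlus y)) :=
  intervalIntegral_tendsto_integral_Ioi 0 hy Filter.tendsto_id

theorem tendsto_primitive_limMinus {y : ℝ → ℝ} (hy : IntegrableOn y (Iic 0)) :
    Filter.Tendsto (fun t => ∫ s in (0 : ℝ)..t, y s) Filter.atBot (𝓝 (limMinus y)) := by
  have := (intervalIntegral_tendsto_integral_Iic 0 hy Filter.tendsto_id).neg
  refine this.congr fun t => ?_
  rw [id, ← intervalIntegral.integral_symm]

theorem abs_limPlus_sub_primitive_le {y : ℝ → ℝ} (hy : Continuous y) {D b : ℝ} (hb : 0 < b)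
    (h : ∀ s, |y s| ≤ D * Real.exp (-b * |s|)) {t : ℝ} (ht : 0 ≤ t) :
    |limPlus y - ∫ s in (0 : ℝ)..t, y s| ≤ D / b * Real.exp (-b * t) := by
  have hi := integrableOn_Ioi_of_exp_bound hy hb h
  have h1 : limPlus y - ∫ s in (0 : ℝ)..t, y s = ∫ s in Ioi t, y s := by
    rw [limPlus, intervalIntegral.integral_Ioi_sub_Ioi hi ht |>.symm]
    ring
  have h2 : ∫ s in Ioi t, D * Real.exp (-b * s) = D / b * Real.exp (-b * t) := by
    rw [integral_const_mul, integral_exp_mul_Ioi (by linarith)]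
    field_simp
  rw [h1, ← h2, ← Real.norm_eq_abs]
  refine norm_integral_le_of_norm_le ((exp_neg_integrableOn_Ioi t hb).const_mul D) ?_
  refine (ae_restrict_mem measurableSet_Ioi).mono fun s hs => ?_
  have : 0 < s := ht.trans_lt hs
  simpa [abs_of_pos this] using h s

theorem abs_limPlus_le {y : ℝ → ℝ} (hy : Continuous y) {D b : ℝ} (hb : 0 < b)
    (h : ∀ s, |y s| ≤ D * Real.exp (-b * |s|)) : |limPlus y| ≤ D / b := by
  simpa using abs_limPlus_sub_primitive_le hy hb h le_rfl

theorem abs_limMinus_le {y : ℝ → ℝ} (hy : Continuous y) {D b : ℝ} (hb : 0 < b)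
    (h : ∀ s, |y s| ≤ D * Real.exp (-b * |s|)) : |limMinus y| ≤ D / b := by
  rw [limMinus_eq_neg_limPlus, abs_neg]
  exact abs_limPlus_le (hy.comp continuous_neg) hb fun s => by simpa using h (-s)

/-- The primitive of `-y`, corrected by a quadratic polynomial in `tanh t` so that it vanishes at
`±∞`. -/
def interp (y : ℝ → ℝ) (t : ℝ) : ℝ :=
  limPlus y * ((Real.tanh t ^ 2 + Real.tanh t) / 2) +
    limMinus y * ((Real.tanh t ^ 2 - Real.tanh t) / 2) - ∫ s in (0 : ℝ)..t, y s

theorem interp_neg (y : ℝ → ℝ) (t : ℝ) : interp y (-t) = -interp (fun s => y (-s)) t := by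
  have h1 : limPlus (fun s => y (-s)) = -limMinus y := by rw [limMinus_eq_neg_limPlus, neg_neg]
  have h2 : limMinus (fun s => y (-s)) = -limPlus y := by simp [limMinus_eq_neg_limPlus]
  have h3 : ∫ s in (0 : ℝ)..(-t), y s = -∫ s in (0 : ℝ)..t, y (-s) := by
    rw [intervalIntegral.integral_comp_neg, neg_zero, ← intervalIntegral.integral_symm]
  rw [interp, interp, h1, h2, h3, Real.tanh_neg]
  ring

/-- With `x = tanh t ≥ 0`, the function splits into the tail `T` of the integral and two terms
containing the factor `1 - x`. The tail decays like `exp (-b t)`, and `cosh² t (1 - x) ≤ 1` because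
`cosh² t (1 - x)(1 + x) = 1`. The condition `b ≤ 2` lets the exponential absorb the bounded terms.
-/
theorem cosh_sq_mul_abs_interp_le_of_nonneg {y : ℝ → ℝ} (hy : Continuous y) {D b : ℝ}
    (hD : 0 ≤ D) (hb : 0 < b) (hb2 : b ≤ 2) (h : ∀ s, |y s| ≤ D * Real.exp (-b * |s|)) {t : ℝ}
    (ht : 0 ≤ t) : Real.cosh t ^ 2 * |interp y t| ≤ 3 * (D / b) * Real.exp ((2 - b) * t) := by
  have hx0 : 0 ≤ Real.tanh t := by
    rw [Real.tanh_eq_sinh_div_cosh]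
    exact div_nonneg (Real.sinh_nonneg_iff.2 ht) (Real.cosh_pos t).le
  have hx1 := (tanh_mem_Ioo t).2
  have h1 := abs_limPlus_sub_primitive_le hy hb h ht
  have h2 := abs_limPlus_le hy hb h
  have h3 := abs_limMinus_le hy hb h
  have hc := sechSq_mul_cosh_sq t
  rw [← one_sub_tanh_sq] at hc
  have hc2 := cosh_sq_le t
  rw [abs_of_nonneg ht] at hc2
  set x := Real.tanh t
  set c := Real.cosh t ^ 2
  have hc0 : 0 ≤ c := sq_nonneg _
  have hDb : 0 ≤ D / b := by positivity
  set T := limPlus y - ∫ s in (0 : ℝ)..t, y s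
  have hdec : interp y t = T - limPlus y * ((2 + x) * (1 - x) / 2) +
      limMinus y * ((x ^ 2 - x) / 2) := by
    simp only [interp, T, x]; ring
  have hk1 : c * (1 - x) ≤ 1 := by nlinarith [mul_nonneg hc0 (mul_nonneg hx0 (sub_nonneg.2 hx1.le))]
  have hk0 : 0 ≤ c * (1 - x) := mul_nonneg hc0 (sub_nonneg.2 hx1.le)
  have hb1 : c * |T| ≤ D / b * Real.exp ((2 - b) * t) := by
    calc c * |T| ≤ Real.exp (2 * t) * (D / b * Real.exp (-b * t)) :=
          mul_le_mul hc2 h1 (abs_nonneg _) (Real.exp_pos _).le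
      _ = D / b * Real.exp ((2 - b) * t) := by
          rw [mul_left_comm, ← Real.exp_add]; ring_nf
  have hb2' : c * |limPlus y * ((2 + x) * (1 - x) / 2)| ≤ 3 / 2 * (D / b) := by
    rw [abs_mul, abs_of_nonneg (a := (2 + x) * (1 - x) / 2)
      (by have := sub_nonneg.2 hx1.le; positivity)]
    calc c * (|limPlus y| * ((2 + x) * (1 - x) / 2))
        = |limPlus y| * ((2 + x) / 2 * (c * (1 - x))) := by ring
      _ ≤ D / b * (3 / 2 * 1) := by gcongr; linarith
      _ = _ := by ring
  have hb3 : c * |limMinus y * ((x ^ 2 - x) / 2)| ≤ 1 / 2 * (D / b) := by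
    rw [abs_mul, show (x ^ 2 - x) / 2 = -(x * (1 - x) / 2) by ring, abs_neg,
      abs_of_nonneg (a := x * (1 - x) / 2) (by have := sub_nonneg.2 hx1.le; positivity)]
    calc c * (|limMinus y| * (x * (1 - x) / 2))
        = |limMinus y| * (x / 2 * (c * (1 - x))) := by ring
      _ ≤ D / b * (1 / 2 * 1) := by gcongr
      _ = _ := by ring
  have hexp : 1 ≤ Real.exp ((2 - b) * t) :=
    Real.one_le_exp (mul_nonneg (by linarith) ht)
  have htri : |interp y t| ≤ |T| + |limPlus y * ((2 + x) * (1 - x) / 2)| +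
      |limMinus y * ((x ^ 2 - x) / 2)| := by
    rw [hdec]
    exact (abs_add_le _ _).trans (by gcongr; exact abs_sub _ _)
  calc c * |interp y t| ≤ c * (|T| + |limPlus y * ((2 + x) * (1 - x) / 2)| +
        |limMinus y * ((x ^ 2 - x) / 2)|) := by gcongr
    _ ≤ D / b * Real.exp ((2 - b) * t) + 3 / 2 * (D / b) + 1 / 2 * (D / b) := by
        rw [mul_add, mul_add]; gcongr
    _ ≤ _ := by nlinarith

theorem cosh_sq_mul_abs_interp_le {y : ℝ → ℝ} (hy : Continuous y) {D b : ℝ}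
    (hD : 0 ≤ D) (hb : 0 < b) (hb2 : b ≤ 2) (h : ∀ s, |y s| ≤ D * Real.exp (-b * |s|)) (t : ℝ) :
    Real.cosh t ^ 2 * |interp y t| ≤ 3 * (D / b) * Real.exp ((2 - b) * |t|) := by
  rcases le_total 0 t with ht | ht
  · rw [abs_of_nonneg ht]
    exact cosh_sq_mul_abs_interp_le_of_nonneg hy hD hb hb2 h ht
  · have := cosh_sq_mul_abs_interp_le_of_nonneg (hy.comp continuous_neg) hD hb hb2
      (fun s => by simpa using h (-s)) (neg_nonneg.2 ht)
    have h4 := interp_neg y (-t)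
    rw [neg_neg] at h4
    rw [abs_of_nonpos ht, h4, abs_neg, ← Real.cosh_neg]
    exact this

theorem continuous_interp {y : ℝ → ℝ} (hy : Continuous y) : Continuous (interp y) := by
  unfold interp
  have := continuous_tanh
  have := continuous_primitive_zero hy
  fun_prop

/-! ## The triple primitive in the variable `t` -/

/-- The second derivative (in `x = tanh t`) of `ψ`, for `f = g g'` (derivative in `t`). -/
def psi2 (f : ℝ → ℝ) (t : ℝ) : ℝ := ∫ s in (0 : ℝ)..t, 2 * Real.cosh s ^ 2 * f s

/-- The first derivative (in `x = tanh t`) of `ψ`, for `f = g g'` (derivative in `t`). -/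
def psi1 (f : ℝ → ℝ) (t : ℝ) : ℝ := ∫ s in (0 : ℝ)..t, sechSq s * psi2 f s

/-- The integrand of `ψ` in the variable `t`. -/
def psiInt (f : ℝ → ℝ) (t : ℝ) : ℝ := sechSq t * psi1 f t

section

variable {f : ℝ → ℝ}

theorem continuous_psi2 (hf : Continuous f) : Continuous (psi2 f) :=
  continuous_primitive_zero (by have := Real.continuous_cosh; fun_prop)

theorem continuous_psi1 (hf : Continuous f) : Continuous (psi1 f) :=
  continuous_primitive_zero (continuous_sechSq.mul (continuous_psi2 hf))

theorem continuous_psiInt (hf : Continuous f) : Continuous (psiInt f) :=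
  continuous_sechSq.mul (continuous_psi1 hf)

theorem hasDerivAt_psi2 (hf : Continuous f) (t : ℝ) :
    HasDerivAt (psi2 f) (2 * Real.cosh t ^ 2 * f t) t :=
  hasDerivAt_primitive (f := fun s => 2 * Real.cosh s ^ 2 * f s)
    (by have := Real.continuous_cosh; fun_prop) t

theorem hasDerivAt_psi1 (hf : Continuous f) (t : ℝ) :
    HasDerivAt (psi1 f) (sechSq t * psi2 f t) t :=
  hasDerivAt_primitive (continuous_sechSq.mul (continuous_psi2 hf)) t

theorem psi2_add {g : ℝ → ℝ} (hf : Continuous f) (hg : Continuous g) (t : ℝ) :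
    psi2 (fun s => f s + g s) t = psi2 f t + psi2 g t := by
  have := Real.continuous_cosh
  simp only [psi2, mul_add]
  exact intervalIntegral.integral_add (Continuous.intervalIntegrable (by fun_prop) _ _)
    (Continuous.intervalIntegrable (by fun_prop) _ _)

theorem psi2_smul (r : ℝ) (f : ℝ → ℝ) (t : ℝ) : psi2 (fun s => r * f s) t = r * psi2 f t := by
  simp only [psi2, mul_left_comm _ r, intervalIntegral.integral_const_mul]

theorem psi1_add {g : ℝ → ℝ} (hf : Continuous f) (hg : Continuous g) (t : ℝ) :
    psi1 (fun s => f s + g s) t = psi1 f t + psi1 g t := by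
  simp only [psi1, psi2_add hf hg, mul_add]
  exact intervalIntegral.integral_add
    ((continuous_sechSq.mul (continuous_psi2 hf)).intervalIntegrable _ _)
    ((continuous_sechSq.mul (continuous_psi2 hg)).intervalIntegrable _ _)

theorem psi1_smul (r : ℝ) (f : ℝ → ℝ) (t : ℝ) : psi1 (fun s => r * f s) t = r * psi1 f t := by
  simp only [psi1, psi2_smul, mul_left_comm _ r, intervalIntegral.integral_const_mul]

theorem psiInt_add {g : ℝ → ℝ} (hf : Continuous f) (hg : Continuous g) (t : ℝ) :
    psiInt (fun s => f s + g s) t = psiInt f t + psiInt g t := by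
  rw [psiInt, psi1_add hf hg, mul_add]; rfl

theorem psiInt_smul (r : ℝ) (f : ℝ → ℝ) (t : ℝ) :
    psiInt (fun s => r * f s) t = r * psiInt f t := by
  rw [psiInt, psi1_smul, mul_left_comm]; rfl

/-- Integration preserves a positive exponential rate, while `cosh²` and `sech²` shift it by `2` and
`-2`. Starting from rate `α`, the three stages have rates `2 + α`, `α` and `α - 2`, so the integrand
of `ψ` decays exactly when `α < 2`. -/
theorem abs_psi2_le {C α : ℝ} (hC : 0 ≤ C) (hα : 0 < α)
    (h : ∀ s, |f s| ≤ C * Real.exp (α * |s|)) (t : ℝ) : |psi2 f t| ≤ C * Real.exp ((2 + α) * |t|) := by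
  have h1 := abs_integral_le_exp (f := fun s => 2 * Real.cosh s ^ 2 * f s) (C := 2 * C)
    (c := 2 + α) (by positivity) (by positivity) (fun s => ?_) t
  · refine h1.trans ?_
    gcongr
    rw [div_le_iff₀ (by positivity)]
    nlinarith
  · rw [abs_mul, abs_of_nonneg (by positivity), add_mul, Real.exp_add]
    calc 2 * Real.cosh s ^ 2 * |f s| ≤ 2 * Real.exp (2 * |s|) * (C * Real.exp (α * |s|)) := by
          gcongr
          · exact cosh_sq_le s
          · exact h s
      _ = _ := by ring

theorem abs_psi1_le {C α : ℝ} (hC : 0 ≤ C) (hα : 0 < α)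
    (h : ∀ s, |f s| ≤ C * Real.exp (α * |s|)) (t : ℝ) : |psi1 f t| ≤ 4 * C / α * Real.exp (α * |t|) := by
  refine abs_integral_le_exp (by positivity) hα (fun s => ?_) t
  rw [abs_mul, abs_of_pos (sechSq_pos s)]
  calc sechSq s * |psi2 f s|
      ≤ 4 * Real.exp (-2 * |s|) * (C * Real.exp ((2 + α) * |s|)) := by
        gcongr
        · exact sechSq_le s
        · exact abs_psi2_le hC hα h s
    _ = 4 * C * (Real.exp (-2 * |s|) * Real.exp ((2 + α) * |s|)) := by ring
    _ = _ := by rw [← Real.exp_add]; ring_nf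

theorem abs_psiInt_le {C α : ℝ} (hC : 0 ≤ C) (hα : 0 < α)
    (h : ∀ s, |f s| ≤ C * Real.exp (α * |s|)) (t : ℝ) :
    |psiInt f t| ≤ 16 * C / α * Real.exp (-(2 - α) * |t|) := by
  rw [psiInt, abs_mul, abs_of_pos (sechSq_pos t)]
  calc sechSq t * |psi1 f t|
      ≤ 4 * Real.exp (-2 * |t|) * (4 * C / α * Real.exp (α * |t|)) := by
        gcongr
        · exact sechSq_le t
        · exact abs_psi1_le hC hα h t
    _ = 16 * C / α * (Real.exp (-2 * |t|) * Real.exp (α * |t|)) := by ring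
    _ = _ := by rw [← Real.exp_add]; ring_nf

theorem sechSq_sq_mul_abs_psi2_le {C α : ℝ} (hC : 0 ≤ C) (hα : 0 < α)
    (h : ∀ s, |f s| ≤ C * Real.exp (α * |s|)) (hα2 : α < 2) (t : ℝ) : sechSq t ^ 2 * |psi2 f t| ≤ 16 * C := by
  calc sechSq t ^ 2 * |psi2 f t|
      ≤ (4 * Real.exp (-2 * |t|)) ^ 2 * (C * Real.exp ((2 + α) * |t|)) := by
        gcongr
        · exact (sechSq_pos t).le
        · exact sechSq_le t
        · exact abs_psi2_le hC hα h t
    _ = 16 * C * (Real.exp (-2 * |t|) * Real.exp (-2 * |t|) * Real.exp ((2 + α) * |t|)) := by ring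
    _ = 16 * C * Real.exp (-(2 - α) * |t|) := by rw [← Real.exp_add, ← Real.exp_add]; ring_nf
    _ ≤ 16 * C * 1 := by
        gcongr
        rw [Real.exp_le_one_iff]
        have := abs_nonneg t
        nlinarith
    _ = _ := mul_one _

end

/-! ## The Banach algebra of bounded continuous functions of `t` and operators on it -/

/-- Bounded continuous functions of `t = artanh x`. -/
def BC : Type := BoundedContinuousFunction ℝ ℝ

namespace BC

instance : NormedCommRing BC := inferInstanceAs (NormedCommRing (BoundedContinuousFunction ℝ ℝ))
instance : NormedAlgebra ℝ BC :=
  inferInstanceAs (NormedAlgebra ℝ (BoundedContinuousFunction ℝ ℝ))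
instance : CompleteSpace BC := inferInstanceAs (CompleteSpace (BoundedContinuousFunction ℝ ℝ))
instance : CoeFun BC fun _ => ℝ → ℝ := ⟨fun w => BoundedContinuousFunction.toContinuousMap w⟩

theorem continuous (w : BC) : Continuous w :=
  (BoundedContinuousFunction.toContinuousMap w).continuous

theorem abs_le (w : BC) (t : ℝ) : |w t| ≤ ‖w‖ := BoundedContinuousFunction.norm_coe_le_norm w t

theorem norm_le {w : BC} {C : ℝ} (hC : 0 ≤ C) (h : ∀ t, |w t| ≤ C) : ‖w‖ ≤ C :=
  (BoundedContinuousFunction.norm_le hC).2 h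

theorem ext {v w : BC} (h : ∀ t, v t = w t) : v = w := BoundedContinuousFunction.ext h

@[simp] theorem add_apply (v w : BC) (t : ℝ) : (v + w) t = v t + w t := rfl
@[simp] theorem sub_apply (v w : BC) (t : ℝ) : (v - w) t = v t - w t := rfl
@[simp] theorem neg_apply (w : BC) (t : ℝ) : (-w) t = -w t := rfl
@[simp] theorem mul_apply (v w : BC) (t : ℝ) : (v * w) t = v t * w t := rfl
@[simp] theorem smul_apply (r : ℝ) (w : BC) (t : ℝ) : (r • w) t = r * w t := rfl
@[simp] theorem one_apply (t : ℝ) : (1 : BC) t = 1 := rfl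
@[simp] theorem zero_apply (t : ℝ) : (0 : BC) t = 0 := rfl

@[simp] theorem pow_apply (w : BC) (n : ℕ) (t : ℝ) : (w ^ n) t = w t ^ n := by
  induction n with
  | zero => simp
  | succ n ih => rw [pow_succ, mul_apply, ih, pow_succ]

end BC

/-- A bounded continuous function as an element of `BC`. -/
def mkBC (f : ℝ → ℝ) (hf : Continuous f) (C : ℝ) (h : ∀ t, |f t| ≤ C) : BC :=
  BoundedContinuousFunction.ofNormedAddCommGroup f hf C h

@[simp] theorem mkBC_apply (f : ℝ → ℝ) (hf : Continuous f) (C : ℝ) (h : ∀ t, |f t| ≤ C) (t : ℝ) :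
    mkBC f hf C h t = f t := rfl

/-- The evaluation at a point. -/
def evalBC (t : ℝ) : BC →L[ℝ] ℝ :=
  LinearMap.mkContinuous
    { toFun := fun w => w t
      map_add' := fun _ _ => rfl
      map_smul' := fun _ _ => rfl } 1 fun w => (w.abs_le t).trans (one_mul _).ge

@[simp] theorem evalBC_apply (t : ℝ) (w : BC) : evalBC t w = w t := rfl

/-- The multiplication of `BC`. -/
def mulOp : BC →L[ℝ] BC →L[ℝ] BC := ContinuousLinearMap.mul ℝ BC

@[simp] theorem mulOp_apply (v w : BC) : mulOp v w = v * w := rfl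

/-- A bounded operator on `BC` from its values. -/
def mkOp (F : BC → ℝ → ℝ) (hadd : ∀ v w t, F (v + w) t = F v t + F w t)
    (hsmul : ∀ (r : ℝ) w t, F (r • w) t = r * F w t) (hc : ∀ w, Continuous (F w)) (C : ℝ)
    (hb : ∀ w t, |F w t| ≤ C * ‖w‖) : BC →L[ℝ] BC :=
  LinearMap.mkContinuous
    { toFun := fun w => mkBC (F w) (hc w) (C * ‖w‖) (hb w)
      map_add' := fun v w => BC.ext fun t => hadd v w t
      map_smul' := fun r w => BC.ext fun t => hsmul r w t } (max C 0) fun w => by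
    refine BC.norm_le (by positivity) fun t => (hb w t).trans ?_
    gcongr
    exact le_max_left _ _

@[simp] theorem mkOp_apply (F : BC → ℝ → ℝ) (hadd hsmul hc) (C : ℝ) (hb) (w : BC) (t : ℝ) :
    mkOp F hadd hsmul hc C hb w t = F w t := rfl

theorem abs_div_one_add_abs_le (t : ℝ) : |t| * (1 + |t|)⁻¹ ≤ 1 := by
  have := abs_nonneg t
  rw [← div_eq_mul_inv, div_le_one (by positivity)]
  linarith

theorem inv_one_add_abs_le_one (t : ℝ) : (1 + |t|)⁻¹ ≤ 1 :=
  inv_le_one_of_one_le₀ (by linarith [abs_nonneg t])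

theorem one_add_abs_pos (t : ℝ) : 0 < 1 + |t| := by linarith [abs_nonneg t]

theorem continuous_inv_one_add_abs : Continuous fun t : ℝ => (1 + |t|)⁻¹ :=
  Continuous.inv₀ (by fun_prop) fun t => (one_add_abs_pos t).ne'

/-- The function `1 / (1 + |t|)`. -/
def invW : BC := mkBC (fun t => (1 + |t|)⁻¹) continuous_inv_one_add_abs 1 fun t => by
  rw [abs_of_pos (inv_pos.2 (one_add_abs_pos t))]; exact inv_one_add_abs_le_one t

/-- The function `t / (1 + |t|)`. -/
def linW : BC := mkBC (fun t => t * (1 + |t|)⁻¹) (continuous_id.mul continuous_inv_one_add_abs) 1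
  fun t => by
    rw [abs_mul, abs_of_pos (inv_pos.2 (one_add_abs_pos t))]; exact abs_div_one_add_abs_le t

@[simp] theorem invW_apply (t : ℝ) : invW t = (1 + |t|)⁻¹ := rfl
@[simp] theorem linW_apply (t : ℝ) : linW t = t * (1 + |t|)⁻¹ := rfl

/-- `w ↦ (1 + |t|)⁻¹ ∫₀ᵗ w`. -/
def avgOp : BC →L[ℝ] BC :=
  mkOp (fun w t => (1 + |t|)⁻¹ * ∫ s in (0 : ℝ)..t, w s)
    (fun v w t => by
      simp only [BC.add_apply]
      rw [intervalIntegral.integral_add (v.continuous.intervalIntegrable _ _)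
        (w.continuous.intervalIntegrable _ _), mul_add])
    (fun r w t => by
      simp only [BC.smul_apply,
        intervalIntegral.integral_const_mul]
      ring)
    (fun w => continuous_inv_one_add_abs.mul (continuous_primitive_zero w.continuous)) 1
    (fun w t => by
      have h := intervalIntegral.norm_integral_le_of_norm_le_const (a := 0) (b := t) (f := w)
        (C := ‖w‖) fun s _ => w.abs_le s
      rw [sub_zero, Real.norm_eq_abs] at h
      rw [abs_mul, abs_of_pos (inv_pos.2 (one_add_abs_pos t))]
      calc (1 + |t|)⁻¹ * |∫ s in (0 : ℝ)..t, w s| ≤ (1 + |t|)⁻¹ * (‖w‖ * |t|) := by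
            gcongr
        _ = |t| * (1 + |t|)⁻¹ * ‖w‖ := by ring
        _ ≤ 1 * ‖w‖ := by gcongr; exact abs_div_one_add_abs_le t)

@[simp] theorem avgOp_apply (w : BC) (t : ℝ) :
    avgOp w t = (1 + |t|)⁻¹ * ∫ s in (0 : ℝ)..t, w s := rfl

/-! ### Exponentially weighted operators on `BC`. -/

/-- The admissible exponents. -/
abbrev Expo : Type := Ioo (0 : ℝ) 2

/-- Half the rate of decay `2 - α`. -/
def Expo.rate (α : Expo) : ℝ := (2 - α) / 2

theorem Expo.pos (α : Expo) : 0 < (α : ℝ) := α.2.1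
theorem Expo.lt_two (α : Expo) : (α : ℝ) < 2 := α.2.2
theorem Expo.rate_pos (α : Expo) : 0 < α.rate := by
  have := α.lt_two
  unfold Expo.rate
  linarith

/-- `w ↦ ∫₀ᵗ exp (-β |s|) w(s) ds`. -/
def decayOp (α : Expo) : BC →L[ℝ] BC :=
  mkOp (fun w t => ∫ s in (0 : ℝ)..t, Real.exp (-α.rate * |s|) * w s)
    (fun v w t => by
      simp only [BC.add_apply, mul_add]
      exact intervalIntegral.integral_add (Continuous.intervalIntegrable (by fun_prop) _ _)
        (Continuous.intervalIntegrable (by fun_prop) _ _))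
    (fun r w t => by
      simp only [BC.smul_apply, mul_left_comm _ r,
        intervalIntegral.integral_const_mul])
    (fun w => continuous_primitive_zero (by fun_prop)) (1 / α.rate)
    (fun w t => by
      rw [one_div, inv_mul_eq_div]
      refine abs_integral_le_exp_neg (norm_nonneg w) α.rate_pos (fun s => ?_) t
      rw [abs_mul, Real.abs_exp, mul_comm]
      gcongr
      exact w.abs_le s)

theorem decayOp_apply (α : Expo) (w : BC) (t : ℝ) :
    decayOp α w t = ∫ s in (0 : ℝ)..t, Real.exp (-α.rate * |s|) * w s := rfl

theorem one_add_abs_mul_exp_le (α : Expo) (t : ℝ) :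
    (1 + |t|) * Real.exp (-α.rate * |t|) ≤ 1 + 1 / α.rate := by
  have hr := α.rate_pos
  have h1 : α.rate * |t| + 1 ≤ Real.exp (α.rate * |t|) := Real.add_one_le_exp _
  have h2 : 1 ≤ Real.exp (α.rate * |t|) := Real.one_le_exp (by positivity)
  have h3 : |t| ≤ 1 / α.rate * Real.exp (α.rate * |t|) := by
    rw [one_div, inv_mul_eq_div, le_div_iff₀ hr]
    linarith
  rw [neg_mul, Real.exp_neg, ← div_eq_mul_inv, div_le_iff₀ (Real.exp_pos _)]
  linarith

/-- The decay `exp (-(2 - α) |t|)` is shared out as a square: in `potW` one factor absorbs `1 +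
|t|`, and the other is kept as the integrable kernel of `decayOp`. -/
theorem sechSq_mul_exp_le (α : Expo) (t : ℝ) :
    sechSq t * Real.exp (α * |t|) ≤ 4 * Real.exp (-α.rate * |t|) ^ 2 := by
  calc sechSq t * Real.exp (α * |t|) ≤ 4 * Real.exp (-2 * |t|) * Real.exp (α * |t|) := by
        gcongr; exact sechSq_le t
    _ = _ := by
        rw [mul_assoc, ← Real.exp_add, sq, ← Real.exp_add, Expo.rate]; ring_nf

/-- `exp (-α |t|)`. -/
def expW (α : Expo) : BC := mkBC (fun t => Real.exp (-α * |t|)) (by fun_prop) 1 fun t => by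
  rw [Real.abs_exp, Real.exp_le_one_iff]
  have := mul_nonneg α.pos.le (abs_nonneg t)
  linarith

@[simp] theorem expW_apply (α : Expo) (t : ℝ) : expW α t = Real.exp (-α * |t|) := rfl

/-- `sech² t exp (α |t|) (1 + |t|) exp (β |t|)`. -/
def potW (α : Expo) : BC :=
  mkBC (fun t => sechSq t * Real.exp (α * |t|) * (1 + |t|) * Real.exp (α.rate * |t|))
    (by have := continuous_sechSq; fun_prop) (4 * (1 + 1 / α.rate)) fun t => by
    have h0 := one_add_abs_pos t
    have h1 := sechSq_pos t
    rw [abs_of_pos (by positivity)]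
    calc sechSq t * Real.exp (α * |t|) * (1 + |t|) * Real.exp (α.rate * |t|)
        ≤ 4 * Real.exp (-α.rate * |t|) ^ 2 * (1 + |t|) * Real.exp (α.rate * |t|) := by
          gcongr ?_ * _ * _; exact sechSq_mul_exp_le α t
      _ = 4 * ((1 + |t|) * Real.exp (-α.rate * |t|)) *
          (Real.exp (-α.rate * |t|) * Real.exp (α.rate * |t|)) := by ring
      _ = 4 * ((1 + |t|) * Real.exp (-α.rate * |t|)) := by
          rw [← Real.exp_add, neg_mul, neg_add_cancel, Real.exp_zero, mul_one]
      _ ≤ _ := by gcongr; exact one_add_abs_mul_exp_le α t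

@[simp] theorem potW_apply (α : Expo) (t : ℝ) : potW α t =
    sechSq t * Real.exp (α * |t|) * (1 + |t|) * Real.exp (α.rate * |t|) := rfl

/-- `sech² t exp (α |t|) (1 + |t|)²`. -/
def potSqW (α : Expo) : BC :=
  mkBC (fun t => sechSq t * Real.exp (α * |t|) * (1 + |t|) ^ 2)
    (by have := continuous_sechSq; fun_prop) (4 * (1 + 1 / α.rate) ^ 2) fun t => by
    have h0 := one_add_abs_pos t
    have h1 := sechSq_pos t
    rw [abs_of_pos (by positivity)]
    calc sechSq t * Real.exp (α * |t|) * (1 + |t|) ^ 2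
        ≤ 4 * Real.exp (-α.rate * |t|) ^ 2 * (1 + |t|) ^ 2 := by
          gcongr ?_ * _; exact sechSq_mul_exp_le α t
      _ = 4 * ((1 + |t|) * Real.exp (-α.rate * |t|)) ^ 2 := by ring
      _ ≤ _ := by gcongr; exact one_add_abs_mul_exp_le α t

@[simp] theorem potSqW_apply (α : Expo) (t : ℝ) : potSqW α t =
    sechSq t * Real.exp (α * |t|) * (1 + |t|) ^ 2 := rfl

/-! ### The linear second order equation -/

/-- `u ↦ (1 + |t|)⁻¹ ∫₀ᵗ ∫₀ˢ sech² q z`, for `z = (1 + |t|) u`; here `q` is `exp (α |t|)` times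
the argument. -/
def linOp (α : Expo) (q : BC) : BC →L[ℝ] BC :=
  (avgOp.comp (decayOp α)).comp (mulOp (potW α * q))

theorem linOp_apply (α : Expo) (q u : BC) : linOp α q u = avgOp (decayOp α (potW α * q * u)) := rfl

theorem contDiff_linOp (α : Expo) : ContDiff ℝ ∞ (linOp α) := by
  unfold linOp
  have h : ContDiff ℝ ∞ fun q : BC => mulOp (potW α * q) :=
    (mulOp.comp (mulOp (potW α))).contDiff
  exact contDiff_const.clm_comp h

/-- The Bielecki weight. -/
def bieleckiW (α : Expo) (l : ℝ) (t : ℝ) : ℝ := Real.exp (-(l / α.rate * Real.exp (-α.rate * |t|)))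

theorem continuous_bieleckiW (α : Expo) (l : ℝ) : Continuous (bieleckiW α l) := by
  unfold bieleckiW; fun_prop

theorem bieleckiW_pos (α : Expo) (l : ℝ) (t : ℝ) : 0 < bieleckiW α l t := Real.exp_pos _

theorem bieleckiW_mono (α : Expo) {l : ℝ} (hl : 0 < l) {s t : ℝ} (h : |s| ≤ |t|) :
    bieleckiW α l s ≤ bieleckiW α l t := by
  have := α.rate_pos
  refine Real.exp_le_exp.2 (neg_le_neg (mul_le_mul_of_nonneg_left (Real.exp_le_exp.2 ?_)
    (by positivity)))
  nlinarith

/-- The Bielecki estimate for the iterated integral. -/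
theorem abs_linOp_bielecki_le (α : Expo) {l : ℝ} (hl : 0 < l) (v u : BC) (C : ℝ)
    (hv : ∀ t, |v t| ≤ C * bieleckiW α l t * ‖u‖) (hC : 0 ≤ C) (t : ℝ) :
    |avgOp (decayOp α v) t| ≤ C / l * bieleckiW α l t * ‖u‖ := by
  have hr := α.rate_pos
  -- The weight is made so that for `s ≥ 0` its derivative is `l exp (-β s)` times itself, with `β`
  -- the rate. Integrating the kernel against the weight therefore returns the weight divided by
  -- `l`.
  have hder : ∀ s, 0 ≤ s → HasDerivAt
      (fun s => C * ‖u‖ / l * Real.exp (-(l / α.rate * Real.exp (-α.rate * s))))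
      (C * ‖u‖ * (Real.exp (-α.rate * s) * Real.exp (-(l / α.rate * Real.exp (-α.rate * s))))) s := by
    intro s _
    have h1 : HasDerivAt (fun s => -(l / α.rate * Real.exp (-α.rate * s)))
        (l * Real.exp (-α.rate * s)) s := by
      have := (((hasDerivAt_id s).const_mul (-α.rate)).exp.const_mul (l / α.rate)).neg
      refine this.congr_deriv ?_
      simp only [id]
      field_simp
    refine (h1.exp.const_mul (C * ‖u‖ / l)).congr_deriv ?_
    field_simp
  have h1 : ∀ s, |decayOp α v s| ≤ C / l * bieleckiW α l s * ‖u‖ := by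
    intro s
    rw [decayOp_apply]
    refine (abs_integral_le_of_deriv (g := fun s => C * ‖u‖ * (Real.exp (-α.rate * s) *
      Real.exp (-(l / α.rate * Real.exp (-α.rate * s))))) (by fun_prop) hder (fun s => ?_) s).trans ?_
    · rw [abs_mul, Real.abs_exp]
      calc Real.exp (-α.rate * |s|) * |v s|
          ≤ Real.exp (-α.rate * |s|) * (C * bieleckiW α l s * ‖u‖) := by gcongr; exact hv s
        _ = _ := by rw [bieleckiW]; ring
    · have : 0 ≤ C * ‖u‖ / l * Real.exp (-(l / α.rate * Real.exp (-α.rate * 0))) := by positivity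
      refine (sub_le_self _ this).trans (le_of_eq ?_)
      rw [bieleckiW]; ring
  -- The outer integration gains nothing: the weight increases with `|s|`, so the integral is at
  -- most `|t|` times the value at `t`, and `avgOp` divides by `1 + |t|`.
  have h2 := intervalIntegral.norm_integral_le_of_norm_le_const (a := 0) (b := t)
    (f := decayOp α v) (C := C / l * bieleckiW α l t * ‖u‖) fun s hs => by
      refine (h1 s).trans ?_
      have : |s| ≤ |t| := by
        rcases le_total 0 t with ht | ht
        · rw [uIoc_of_le ht] at hs
          rw [abs_of_pos hs.1, abs_of_nonneg ht]; exact hs.2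
        · rw [uIoc_of_ge ht] at hs
          rw [abs_of_nonpos hs.2, abs_of_nonpos ht]; linarith [hs.1]
      have := bieleckiW_mono α hl this
      gcongr
  rw [sub_zero, Real.norm_eq_abs] at h2
  have hB := (bieleckiW_pos α l t).le
  rw [avgOp_apply, abs_mul, abs_of_pos (inv_pos.2 (one_add_abs_pos t))]
  calc (1 + |t|)⁻¹ * |∫ s in (0 : ℝ)..t, decayOp α v s|
      ≤ (1 + |t|)⁻¹ * (C / l * bieleckiW α l t * ‖u‖ * |t|) := by
        have := one_add_abs_pos t
        gcongr
    _ = |t| * (1 + |t|)⁻¹ * (C / l * bieleckiW α l t * ‖u‖) := by ring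
    _ ≤ 1 * (C / l * bieleckiW α l t * ‖u‖) := by gcongr; exact abs_div_one_add_abs_le t
    _ = _ := one_mul _

/-- A Volterra argument: conjugation by the Bielecki weight, which is bounded above and below,
reduces the norm of `linOp α q` to `C / l < 1`, and the Neumann series applies. No smallness of `q`
is needed, so solutions exist globally and smoothly in `q`. -/
theorem isUnit_one_sub_linOp (α : Expo) (q : BC) : IsUnit (1 - linOp α q) := by
  have hr := α.rate_pos
  set C := ‖potW α * q‖ with hC
  have hC0 : 0 ≤ C := norm_nonneg _
  set l := 2 * C + 1 with hl
  have hl0 : 0 < l := by positivity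
  have hle : ∀ t, |bieleckiW α l t| ≤ 1 := fun t => by
    rw [abs_of_pos (bieleckiW_pos α l t), bieleckiW, Real.exp_le_one_iff, neg_nonpos]
    positivity
  set D : BC := mkBC (bieleckiW α l) (continuous_bieleckiW α l) 1 hle
  set D' : BC := mkBC (fun t => (bieleckiW α l t)⁻¹)
    ((continuous_bieleckiW α l).inv₀ fun t => (bieleckiW_pos α l t).ne') (Real.exp (l / α.rate))
    fun t => by
      rw [abs_of_pos (inv_pos.2 (bieleckiW_pos α l t)), bieleckiW, ← Real.exp_neg, neg_neg,
        Real.exp_le_exp]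
      have h1 : Real.exp (-α.rate * |t|) ≤ 1 :=
        Real.exp_le_one_iff.2 (by have := mul_nonneg hr.le (abs_nonneg t); linarith)
      exact mul_le_of_le_one_right (by positivity) h1
  have hDD' : D * D' = 1 := by
    refine BC.ext fun t => ?_
    exact mul_inv_cancel₀ (bieleckiW_pos α l t).ne'
  have hD'D : D' * D = 1 := by rw [mul_comm, hDD']
  set mD : (BC →L[ℝ] BC) := mulOp D
  set mD' : (BC →L[ℝ] BC) := mulOp D'
  have hm : mD * mD' = 1 := by
    ext1 u
    change D * (D' * u) = u
    rw [← mul_assoc, hDD', one_mul]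
  have hm' : mD' * mD = 1 := by
    ext1 u
    change D' * (D * u) = u
    rw [← mul_assoc, hD'D, one_mul]
  set uD : (BC →L[ℝ] BC)ˣ := ⟨mD, mD', hm, hm'⟩
  have hsmall : ‖mD' * linOp α q * mD‖ < 1 := by
    have : ‖mD' * linOp α q * mD‖ ≤ C / l := by
      refine ContinuousLinearMap.opNorm_le_bound _ (by positivity) fun u => ?_
      refine BC.norm_le (by positivity) fun t => ?_
      change |(bieleckiW α l t)⁻¹ * avgOp (decayOp α (potW α * q * (D * u))) t| ≤ _
      have h1 := abs_linOp_bielecki_le α hl0 (potW α * q * (D * u)) u C (fun s => by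
        change |(potW α * q) s * (bieleckiW α l s * u s)| ≤ _
        rw [abs_mul, abs_mul, abs_of_pos (bieleckiW_pos α l s), mul_assoc]
        have := (bieleckiW_pos α l s).le
        gcongr
        · exact (potW α * q).abs_le s
        · exact u.abs_le s) hC0 t
      have hB := bieleckiW_pos α l t
      rw [abs_mul, abs_of_pos (inv_pos.2 hB)]
      calc (bieleckiW α l t)⁻¹ * |avgOp (decayOp α (potW α * q * (D * u))) t|
          ≤ (bieleckiW α l t)⁻¹ * (C / l * bieleckiW α l t * ‖u‖) := by gcongr
        _ = C / l * ‖u‖ := by field_simp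
    refine this.trans_lt ?_
    rw [div_lt_one hl0]
    linarith
  have h1 := isUnit_one_sub_of_norm_lt_one (R := BC →L[ℝ] BC) hsmall
  have h2 : 1 - linOp α q = uD * (1 - mD' * linOp α q * mD) * ↑uD⁻¹ := by
    ext1 u
    change u - linOp α q u = D * (D' * u - D' * linOp α q (D * (D' * u)))
    rw [mul_sub]
    simp only [← mul_assoc, hDD', one_mul]
  rw [h2]
  exact (uD.isUnit.mul h1).mul uD⁻¹.isUnit

/-- The solution `u` of `u = (1 + t z₁) / (1 + |t|) + L_q u`. -/
def linSol (α : Expo) (x : BC × ℝ) : BC :=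
  Ring.inverse (1 - linOp α x.1) (invW + x.2 • linW)

theorem contDiff_linSol (α : Expo) : ContDiff ℝ ∞ (linSol α) := by
  have h1 : ContDiff ℝ ∞ fun x : BC × ℝ => Ring.inverse (1 - linOp α x.1) := by
    refine contDiff_iff_contDiffAt.2 fun x => ?_
    obtain ⟨v, hv⟩ := isUnit_one_sub_linOp α x.1
    have h2 : ContDiffAt ℝ ∞ Ring.inverse (1 - linOp α x.1) := by
      rw [← hv]
      exact contDiffAt_ringInverse (R := BC →L[ℝ] BC) ℝ v
    have h3 : ContDiff ℝ ∞ fun x : BC × ℝ => 1 - linOp α x.1 :=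
      contDiff_const.sub ((contDiff_linOp α).comp contDiff_fst)
    exact h2.comp x h3.contDiffAt
  exact h1.clm_apply (contDiff_const.add (contDiff_snd.smul contDiff_const))

theorem linSol_eq (α : Expo) (q : BC) (z : ℝ) :
    linSol α (q, z) = invW + z • linW + avgOp (decayOp α (potW α * q * linSol α (q, z))) := by
  have h : (1 - linOp α q) (linSol α (q, z)) = invW + z • linW := by
    change ((1 - linOp α q) * Ring.inverse (1 - linOp α q)) (invW + z • linW) = _
    rw [Ring.mul_inverse_cancel _ (isUnit_one_sub_linOp α q)]
    rfl
  rw [← h, ← linOp_apply]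
  simp

/-! ### The potential as a function of the swirl density -/

/-- `exp (α |t|) h(t)`. -/
def raw (α : Expo) (h : BC) (t : ℝ) : ℝ := Real.exp (α * |t|) * h t

theorem continuous_raw (α : Expo) (h : BC) : Continuous (raw α h) := by
  have := h.continuous
  unfold raw
  fun_prop

theorem abs_raw_le (α : Expo) (h : BC) (t : ℝ) : |raw α h t| ≤ ‖h‖ * Real.exp (α * |t|) := by
  rw [raw, abs_mul, Real.abs_exp, mul_comm]
  gcongr
  exact h.abs_le t

theorem raw_add (α : Expo) (g h : BC) : raw α (g + h) = fun t => raw α g t + raw α h t := by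
  ext t; simp [raw, mul_add]

theorem raw_smul (α : Expo) (r : ℝ) (h : BC) : raw α (r • h) = fun t => r * raw α h t := by
  ext t; simp only [raw, BC.smul_apply]; ring

theorem psiInt_raw_add (α : Expo) (g h : BC) : psiInt (raw α (g + h)) =
    fun t => psiInt (raw α g) t + psiInt (raw α h) t := by
  rw [raw_add]; exact funext (psiInt_add (continuous_raw α g) (continuous_raw α h))

theorem psiInt_raw_smul (α : Expo) (r : ℝ) (h : BC) : psiInt (raw α (r • h)) =
    fun t => r * psiInt (raw α h) t := by
  rw [raw_smul]; exact funext (psiInt_smul r _)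

theorem continuous_psiInt_raw (α : Expo) (h : BC) : Continuous (psiInt (raw α h)) :=
  continuous_psiInt (continuous_raw α h)

theorem abs_psiInt_raw_le (α : Expo) (h : BC) (t : ℝ) :
    |psiInt (raw α h) t| ≤ 16 * ‖h‖ / α * Real.exp (-(2 - α) * |t|) :=
  abs_psiInt_le (norm_nonneg h) α.pos (abs_raw_le α h) t

theorem Expo.two_sub_pos (α : Expo) : 0 < 2 - (α : ℝ) := sub_pos.2 α.lt_two

theorem integrableOn_Ioi_psiInt_raw (α : Expo) (h : BC) :
    IntegrableOn (psiInt (raw α h)) (Ioi 0) :=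
  integrableOn_Ioi_of_exp_bound (continuous_psiInt_raw α h) α.two_sub_pos (abs_psiInt_raw_le α h)

theorem integrableOn_Iic_psiInt_raw (α : Expo) (h : BC) :
    IntegrableOn (psiInt (raw α h)) (Iic 0) :=
  integrableOn_Iic_of_exp_bound (continuous_psiInt_raw α h) α.two_sub_pos (abs_psiInt_raw_le α h)

/-- The limit of `ψ` at `1`, as a functional. -/
def limPlusOp (α : Expo) : BC →L[ℝ] ℝ :=
  LinearMap.mkContinuous
    { toFun := fun h => limPlus (psiInt (raw α h))
      map_add' := fun g h => by
        rw [psiInt_raw_add, limPlus_add (integrableOn_Ioi_psiInt_raw α g)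
          (integrableOn_Ioi_psiInt_raw α h)]
      map_smul' := fun r h => by
        rw [psiInt_raw_smul, limPlus_smul]; rfl } (16 / α / (2 - α)) fun h => by
    refine (abs_limPlus_le (continuous_psiInt_raw α h) α.two_sub_pos
      (abs_psiInt_raw_le α h)).trans (le_of_eq ?_)
    ring

/-- The limit of `ψ` at `-1`, as a functional. -/
def limMinusOp (α : Expo) : BC →L[ℝ] ℝ :=
  LinearMap.mkContinuous
    { toFun := fun h => limMinus (psiInt (raw α h))
      map_add' := fun g h => by
        rw [psiInt_raw_add, limMinus_add (integrableOn_Iic_psiInt_raw α g)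
          (integrableOn_Iic_psiInt_raw α h)]
      map_smul' := fun r h => by
        rw [psiInt_raw_smul, limMinus_smul]; rfl } (16 / α / (2 - α)) fun h => by
    refine (abs_limMinus_le (continuous_psiInt_raw α h) α.two_sub_pos
      (abs_psiInt_raw_le α h)).trans (le_of_eq ?_)
    ring

theorem limPlusOp_apply (α : Expo) (h : BC) : limPlusOp α h = limPlus (psiInt (raw α h)) := rfl
theorem limMinusOp_apply (α : Expo) (h : BC) : limMinusOp α h = limMinus (psiInt (raw α h)) := rfl

/-- `h ↦ sech² ψ₁`. -/
def psiIntOp (α : Expo) : BC →L[ℝ] BC :=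
  mkOp (fun h => psiInt (raw α h)) (fun g h t => by rw [psiInt_raw_add])
    (fun r h t => by rw [psiInt_raw_smul]) (continuous_psiInt_raw α) (16 / α) fun h t => by
    refine (abs_psiInt_raw_le α h t).trans ?_
    have h1 : Real.exp (-(2 - α) * |t|) ≤ 1 := by
      rw [Real.exp_le_one_iff]
      have := mul_nonneg α.two_sub_pos.le (abs_nonneg t)
      linarith
    have h2 : 0 ≤ 16 * ‖h‖ / α := div_nonneg (by positivity) α.pos.le
    calc 16 * ‖h‖ / α * Real.exp (-(2 - α) * |t|) ≤ 16 * ‖h‖ / α * 1 := by gcongr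
      _ = _ := by ring

/-- `h ↦ sech⁴ ψ₂`. -/
def psi2Op (α : Expo) : BC →L[ℝ] BC :=
  mkOp (fun h t => sechSq t ^ 2 * psi2 (raw α h) t)
    (fun g h t => by rw [raw_add, psi2_add (continuous_raw α g) (continuous_raw α h), mul_add])
    (fun r h t => by rw [raw_smul, psi2_smul]; ring)
    (fun h => (continuous_sechSq.pow 2).mul (continuous_psi2 (continuous_raw α h))) 16 fun h t => by
    rw [abs_mul, abs_of_nonneg (sq_nonneg _)]
    exact sechSq_sq_mul_abs_psi2_le (norm_nonneg h) α.pos (abs_raw_le α h) α.lt_two t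

@[simp] theorem psiIntOp_apply (α : Expo) (h : BC) (t : ℝ) :
    psiIntOp α h t = psiInt (raw α h) t := rfl

@[simp] theorem psi2Op_apply (α : Expo) (h : BC) (t : ℝ) :
    psi2Op α h t = sechSq t ^ 2 * psi2 (raw α h) t := rfl

theorem interp_add {y z : ℝ → ℝ} (hy : Continuous y) (hz : Continuous z)
    (hyp : IntegrableOn y (Ioi 0)) (hzp : IntegrableOn z (Ioi 0))
    (hym : IntegrableOn y (Iic 0)) (hzm : IntegrableOn z (Iic 0)) (t : ℝ) :
    interp (fun s => y s + z s) t = interp y t + interp z t := by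
  rw [interp, limPlus_add hyp hzp, limMinus_add hym hzm, intervalIntegral.integral_add
    (hy.intervalIntegrable _ _) (hz.intervalIntegrable _ _), interp, interp]
  ring

theorem interp_smul (r : ℝ) (y : ℝ → ℝ) (t : ℝ) :
    interp (fun s => r * y s) t = r * interp y t := by
  rw [interp, limPlus_smul, limMinus_smul, intervalIntegral.integral_const_mul, interp]
  ring

/-- `h ↦ exp (-α |t|) cosh² (…)`, where `…` is the interpolation error of `ψ`. -/
def interpOp (α : Expo) : BC →L[ℝ] BC :=
  mkOp (fun h t => Real.exp (-α * |t|) * (Real.cosh t ^ 2 * interp (psiInt (raw α h)) t))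
    (fun g h t => by
      rw [psiInt_raw_add, interp_add (continuous_psiInt_raw α g) (continuous_psiInt_raw α h)
        (integrableOn_Ioi_psiInt_raw α g) (integrableOn_Ioi_psiInt_raw α h)
        (integrableOn_Iic_psiInt_raw α g) (integrableOn_Iic_psiInt_raw α h)]
      ring)
    (fun r h t => by rw [psiInt_raw_smul, interp_smul]; ring)
    (fun h => by
      have := continuous_interp (continuous_psiInt_raw α h)
      have := Real.continuous_cosh
      fun_prop) (3 * (16 / α / (2 - α))) fun h t => by
    have h1 := cosh_sq_mul_abs_interp_le (continuous_psiInt_raw α h)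
      (D := 16 * ‖h‖ / α) (div_nonneg (by positivity) α.pos.le) α.two_sub_pos
      (by linarith [α.pos]) (abs_psiInt_raw_le α h) t
    rw [abs_mul, Real.abs_exp, abs_mul, abs_of_nonneg (sq_nonneg (Real.cosh t))]
    calc Real.exp (-α * |t|) * (Real.cosh t ^ 2 * |interp (psiInt (raw α h)) t|)
        ≤ Real.exp (-α * |t|) *
          (3 * (16 * ‖h‖ / α / (2 - α)) * Real.exp ((2 - (2 - α)) * |t|)) := by gcongr
      _ = 3 * (16 * ‖h‖ / α / (2 - α)) *
          (Real.exp (-α * |t|) * Real.exp ((2 - (2 - α)) * |t|)) := by ring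
      _ = 3 * (16 * ‖h‖ / α / (2 - α)) := by
          rw [← Real.exp_add, sub_sub_cancel, neg_mul, neg_add_cancel, Real.exp_zero, mul_one]
      _ = _ := by ring

@[simp] theorem interpOp_apply (α : Expo) (h : BC) (t : ℝ) : interpOp α h t =
    Real.exp (-α * |t|) * (Real.cosh t ^ 2 * interp (psiInt (raw α h)) t) := rfl

/-- The rescaled potential `exp (-α |t|) R / (2 sech²)` for the right hand side
`R = ρ sech² + interp ψ`. -/
def pot (α : Expo) (x : ℝ × BC) : BC := (1 / 2 : ℝ) • (x.1 • expW α + interpOp α x.2)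

theorem contDiff_pot (α : Expo) : ContDiff ℝ ∞ (pot α) := by
  unfold pot; fun_prop

/-- The right hand side `R` of the Riccati equation. -/
def rhs (ρ : ℝ) (f : ℝ → ℝ) (t : ℝ) : ℝ := ρ * sechSq t + interp (psiInt f) t

/-- The coefficient `R/2` is `sech² t exp (α |t|)` times an element of `BC` that is linear in `(ρ,
h)`. This is the form in which `linOp` takes its potential. -/
theorem two_mul_sechSq_mul_pot (α : Expo) (ρ : ℝ) (h : BC) (t : ℝ) :
    2 * (sechSq t * Real.exp (α * |t|) * pot α (ρ, h) t) = rhs ρ (raw α h) t := by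
  have h1 : Real.exp (α * |t|) * Real.exp (-α * |t|) = 1 := by
    rw [← Real.exp_add, neg_mul, add_neg_cancel, Real.exp_zero]
  have h2 := sechSq_mul_cosh_sq t
  simp only [pot, rhs, BC.smul_apply, BC.add_apply, expW_apply, interpOp_apply]
  calc _ = (Real.exp (α * |t|) * Real.exp (-α * |t|)) * (ρ * sechSq t +
        (sechSq t * Real.cosh t ^ 2) * interp (psiInt (raw α h)) t) := by ring
    _ = _ := by rw [h1, h2, one_mul, one_mul]

/-! ### Linear second order equations -/

/-- `Z'' = m Z` with `Z(0) = 1`, where `Z₁ = Z'`. -/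
structure IsLinSol (m Z Z₁ : ℝ → ℝ) : Prop where
  deriv : ∀ t, HasDerivAt Z (Z₁ t) t
  deriv2 : ∀ t, HasDerivAt Z₁ (m t * Z t) t
  zero : Z 0 = 1

theorem IsLinSol.continuous {m Z Z₁ : ℝ → ℝ} (h : IsLinSol m Z Z₁) : Continuous Z :=
  continuous_iff_continuousAt.2 fun t => (h.deriv t).continuousAt

theorem eq_of_hasDerivAt_zero {F : ℝ → ℝ} (h : ∀ t, HasDerivAt F 0 t) (t : ℝ) : F t = F 0 :=
  is_const_of_deriv_eq_zero (fun t => (h t).differentiableAt) (fun t => (h t).deriv) t 0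

/-- The Wronskian is constant. -/
theorem IsLinSol.wronskian {m Z Z₁ Y Y₁ : ℝ → ℝ} (hZ : IsLinSol m Z Z₁) (hY : IsLinSol m Y Y₁)
    (t : ℝ) : Y₁ t * Z t - Y t * Z₁ t = Y₁ 0 - Z₁ 0 := by
  have := eq_of_hasDerivAt_zero (F := fun t => Y₁ t * Z t - Y t * Z₁ t) (fun t => by
    refine (((hY.deriv2 t).mul (hZ.deriv t)).sub ((hY.deriv t).mul (hZ.deriv2 t))).congr_deriv ?_
    ring) t
  simpa [hZ.zero, hY.zero] using this

/-- Uniqueness for the initial value problem, in the presence of a solution without zeros. -/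
theorem IsLinSol.unique {m Z Z₁ Y Y₁ : ℝ → ℝ} (hZ : IsLinSol m Z Z₁) (hY : IsLinSol m Y Y₁)
    (hpos : ∀ t, 0 < Z t) (h0 : Y₁ 0 = Z₁ 0) (t : ℝ) : Y t = Z t := by
  have := eq_of_hasDerivAt_zero (F := fun t => Y t / Z t) (fun t => by
    refine ((hY.deriv t).div (hZ.deriv t) (hpos t).ne').congr_deriv ?_
    rw [hZ.wronskian hY t, h0, sub_self, zero_div]) t
  rw [hZ.zero, hY.zero, div_one, div_eq_one_iff_eq (hpos t).ne'] at this
  exact this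

/-! ### The fixed point equation -/

/-- The parameters `(ρ, z₁, μ, ν)`. -/
abbrev Coord : Type := ℝ × ℝ × ℝ × ℝ

/-- The solution `u = Z / (1 + |t|)` as a function of the parameters and the swirl density. -/
def solU (α : Expo) (y : Coord × BC) : BC := linSol α (pot α (y.1.1, y.2), y.1.2.1)

theorem contDiff_solU (α : Expo) : ContDiff ℝ ∞ (solU α) := by
  have h1 := contDiff_linSol α
  have h2 := contDiff_pot α
  unfold solU
  exact h1.comp (ContDiff.prodMk (h2.comp (by fun_prop)) (by fun_prop))

/-- The solution `Z`. -/
def solZ (α : Expo) (y : Coord × BC) (t : ℝ) : ℝ := (1 + |t|) * solU α y t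

/-- The derivative of `Z`, as a bounded function. -/
def solZ₁ (α : Expo) (y : Coord × BC) : BC :=
  y.1.2.1 • (1 : BC) + decayOp α (potW α * pot α (y.1.1, y.2) * solU α y)

theorem contDiff_solZ₁ (α : Expo) : ContDiff ℝ ∞ (solZ₁ α) := by
  have h1 := contDiff_solU α
  have h2 : ContDiff ℝ ∞ fun y : Coord × BC => pot α (y.1.1, y.2) :=
    (contDiff_pot α).comp (by fun_prop)
  unfold solZ₁
  fun_prop

theorem solZ₁_zero (α : Expo) (y : Coord × BC) : solZ₁ α y 0 = y.1.2.1 := by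
  simp [solZ₁, decayOp_apply]

/-- Multiplying the fixed point equation of `solU` by `1 + |t|` removes the nonsmooth weight and
leaves `Z = 1 + z₁ t + ∫∫ (R/2) Z`, which can be differentiated twice. -/
theorem isLinSol_solZ (α : Expo) (y : Coord × BC) :
    IsLinSol (fun t => rhs y.1.1 (raw α y.2) t / 2) (solZ α y) (solZ₁ α y) := by
  set D := decayOp α (potW α * pot α (y.1.1, y.2) * solU α y) with hD
  have hZ : solZ α y = fun t => 1 + y.1.2.1 * t + ∫ s in (0 : ℝ)..t, D s := by
    ext t
    have h1 : solU α y t = (invW + y.1.2.1 • linW + avgOp D) t := by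
      conv_lhs => rw [solU, linSol_eq]
      rfl
    have h2 : (1 + |t|) * (1 + |t|)⁻¹ = 1 := mul_inv_cancel₀ (one_add_abs_pos t).ne'
    rw [solZ, h1]
    simp only [BC.add_apply, BC.smul_apply, invW_apply, linW_apply, avgOp_apply]
    calc _ = ((1 + |t|) * (1 + |t|)⁻¹) * (1 + y.1.2.1 * t + ∫ s in (0 : ℝ)..t, D s) := by ring
      _ = _ := by rw [h2, one_mul]
  refine ⟨fun t => ?_, fun t => ?_, ?_⟩
  · rw [hZ]
    have h1 := hasDerivAt_primitive D.continuous t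
    have h2 := (((hasDerivAt_id t).const_mul y.1.2.1).const_add 1).add h1
    refine h2.congr_deriv ?_
    simp [solZ₁, hD]
  · have h1 : HasDerivAt D (Real.exp (-α.rate * |t|) *
        (potW α * pot α (y.1.1, y.2) * solU α y) t) t :=
      hasDerivAt_primitive (f := fun s => Real.exp (-α.rate * |s|) *
        (potW α * pot α (y.1.1, y.2) * solU α y) s)
        (by have := (potW α * pot α (y.1.1, y.2) * solU α y).continuous; fun_prop) t
    have h2 : HasDerivAt (solZ₁ α y) _ t := h1.const_add (y.1.2.1 * 1)
    refine h2.congr_deriv ?_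
    have h3 : Real.exp (-α.rate * |t|) * Real.exp (α.rate * |t|) = 1 := by
      rw [← Real.exp_add, neg_mul, neg_add_cancel, Real.exp_zero]
    rw [← two_mul_sechSq_mul_pot, solZ]
    simp only [BC.mul_apply, potW_apply]
    calc _ = (Real.exp (-α.rate * |t|) * Real.exp (α.rate * |t|)) *
          (sechSq t * Real.exp (α * |t|) * pot α (y.1.1, y.2) t * ((1 + |t|) * solU α y t)) := by
          ring
      _ = _ := by rw [h3]; ring
  · rw [hZ]; simp

/-- The set where `Z` is bounded below by a multiple of `1 + |t|`. -/
def unitSet (α : Expo) : Set (Coord × BC) := {y | IsUnit (solU α y)}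

theorem isOpen_unitSet (α : Expo) : IsOpen (unitSet α) :=
  Units.isOpen.preimage (contDiff_solU α).continuous

theorem BC.inverse_apply {u : BC} (hu : IsUnit u) (t : ℝ) : Ring.inverse u t = (u t)⁻¹ := by
  have h : u t * Ring.inverse u t = 1 := by
    rw [← BC.mul_apply, Ring.mul_inverse_cancel u hu, BC.one_apply]
  exact eq_inv_of_mul_eq_one_right h

theorem BC.ne_zero_of_isUnit {u : BC} (hu : IsUnit u) (t : ℝ) : u t ≠ 0 := by
  intro h0
  have h : u t * Ring.inverse u t = 1 := by
    rw [← BC.mul_apply, Ring.mul_inverse_cancel u hu, BC.one_apply]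
  rw [h0, zero_mul] at h
  exact zero_ne_one h

/-- A unit of `BC` has no zeros, and `Z(0) = 1`, so the intermediate value theorem excludes a change
of sign. -/
theorem solZ_pos {α : Expo} {y : Coord × BC} (hy : y ∈ unitSet α) (t : ℝ) : 0 < solZ α y t := by
  have hne : ∀ t, solZ α y t ≠ 0 := fun t =>
    mul_ne_zero (one_add_abs_pos t).ne' (BC.ne_zero_of_isUnit hy t)
  have hc := (isLinSol_solZ α y).continuous
  by_contra hcon
  have h1 : solZ α y t < 0 := lt_of_le_of_ne (not_lt.1 hcon) (hne t)
  have h0 : (0 : ℝ) < solZ α y 0 := by rw [(isLinSol_solZ α y).zero]; exact one_pos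
  obtain ⟨s, hs⟩ := mem_range_of_exists_le_of_exists_ge hc ⟨t, h1.le⟩ ⟨0, h0.le⟩
  exact hne s hs

/-- `1 / u`. -/
def solI (α : Expo) (y : Coord × BC) : BC := Ring.inverse (solU α y)

theorem invW_mul_solI {α : Expo} {y : Coord × BC} (hy : y ∈ unitSet α) (t : ℝ) :
    invW t * solI α y t = (solZ α y t)⁻¹ := by
  rw [solI, BC.inverse_apply hy, invW_apply, solZ, mul_inv]

theorem contDiffOn_solI (α : Expo) : ContDiffOn ℝ ∞ (solI α) (unitSet α) := by
  intro y hy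
  obtain ⟨v, hv⟩ := hy
  have h2 : ContDiffAt ℝ ∞ Ring.inverse (solU α y) := by
    rw [← hv]
    exact contDiffAt_ringInverse ℝ v
  exact (h2.comp y (contDiff_solU α).contDiffAt).contDiffWithinAt

/-- `1 / Z²`. -/
def solG (α : Expo) (y : Coord × BC) : BC := (invW * solI α y) ^ 2

theorem contDiffOn_solG (α : Expo) : ContDiffOn ℝ ∞ (solG α) (unitSet α) :=
  (contDiffOn_const.mul (contDiffOn_solI α)).pow 2

theorem solG_apply {α : Expo} {y : Coord × BC} (hy : y ∈ unitSet α) (t : ℝ) :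
    solG α y t = (solZ α y t ^ 2)⁻¹ := by
  rw [solG, BC.pow_apply, BC.mul_apply, invW_mul_solI hy, inv_pow]

/-- The map whose zeros are the swirl densities. -/
def fixE (α : Expo) (y : Coord × BC) : BC :=
  y.2 - expW α * (y.1.2.2.1 • solG α y +
    y.1.2.2.2 • (avgOp (solG α y) * (invW * solI α y ^ 2)))

theorem contDiffOn_fixE (α : Expo) : ContDiffOn ℝ ∞ (fixE α) (unitSet α) := by
  have h1 := contDiffOn_solG α
  have h2 := contDiffOn_solI α
  have h3 : ContDiffOn ℝ ∞ (fun y => avgOp (solG α y)) (unitSet α) :=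
    avgOp.contDiff.comp_contDiffOn h1
  unfold fixE
  fun_prop

theorem raw_expW_mul (α : Expo) (w : BC) (t : ℝ) : raw α (expW α * w) t = w t := by
  rw [raw, BC.mul_apply, expW_apply, ← mul_assoc, ← Real.exp_add, neg_mul, add_neg_cancel,
    Real.exp_zero, one_mul]

theorem raw_injective (α : Expo) {g h : BC} (H : ∀ t, raw α g t = raw α h t) : g = h :=
  BC.ext fun t => mul_left_cancel₀ (Real.exp_pos _).ne' (H t)

/-- The zeros of `fixE` are the densities `f = g g'` with `g' = κ / Z²`, `g(0) = g₀`,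
`κ g₀ = μ` and `κ² = ν`. -/
theorem fixE_eq_zero_iff {α : Expo} {y : Coord × BC} (hy : y ∈ unitSet α) :
    fixE α y = 0 ↔ ∀ t, raw α y.2 t = y.1.2.2.1 * (solZ α y t ^ 2)⁻¹ +
      y.1.2.2.2 * ((∫ s in (0 : ℝ)..t, (solZ α y s ^ 2)⁻¹) * (solZ α y t ^ 2)⁻¹) := by
  -- The factor `solI ^ 2` is `(1 + |t|)² Z⁻²`; one power of `1 + |t|` is cancelled by `invW`, the
  -- other by `avgOp`. Thus every factor is bounded, although the primitive of `Z⁻²` is formed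
  -- without a weight.
  have key : ∀ t, (y.1.2.2.1 • solG α y +
      y.1.2.2.2 • (avgOp (solG α y) * (invW * solI α y ^ 2))) t =
      y.1.2.2.1 * (solZ α y t ^ 2)⁻¹ +
      y.1.2.2.2 * ((∫ s in (0 : ℝ)..t, (solZ α y s ^ 2)⁻¹) * (solZ α y t ^ 2)⁻¹) := by
    intro t
    rw [← inv_pow, ← invW_mul_solI hy]
    simp only [BC.add_apply, BC.smul_apply, BC.mul_apply, BC.pow_apply, avgOp_apply,
      solG_apply hy]
    rw [← inv_pow, ← invW_mul_solI hy, invW_apply]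
    ring
  rw [fixE, sub_eq_zero]
  constructor
  · intro h t
    rw [h, raw_expW_mul, key]
  · intro h
    refine raw_injective α fun t => ?_
    rw [raw_expW_mul, key, h t]

/-- At parameters without swirl the nonlinear terms carry the coefficients `μ = ν = 0`. Hence the
only zero is `h = 0`, and the partial derivative in `h` is the identity, as the implicit function
theorem requires. -/
theorem fixE_of_no_swirl (α : Expo) (ρ z : ℝ) (h : BC) : fixE α ((ρ, z, 0, 0), h) = h := by
  simp [fixE]

/-- The smooth family of densities near a compact set of no-swirl parameters. -/
theorem exists_density (α : Expo) {C : Set Coord} (hC : IsCompact C)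
    (h0 : ∀ p ∈ C, p.2.2 = (0, 0)) (hu : ∀ p ∈ C, (p, (0 : BC)) ∈ unitSet α) :
    ∃ (O : Set Coord) (s : Coord → BC) (N : Set (Coord × BC)), IsOpen O ∧ C ⊆ O ∧
      ContDiffOn ℝ ∞ s O ∧ IsOpen N ∧ (∀ p ∈ C, (p, (0 : BC)) ∈ N) ∧ N ⊆ unitSet α ∧
      (∀ p ∈ O, (p, s p) ∈ N ∧ fixE α (p, s p) = 0) ∧
      ∀ p h, (p, h) ∈ N → fixE α (p, h) = 0 → p ∈ O ∧ h = s p := by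
  have hform : ∀ p ∈ C, ∀ h, fixE α (p, h) = h := by
    rintro ⟨ρ, z, m⟩ hp h
    obtain rfl : m = (0, 0) := h0 _ hp
    exact fixE_of_no_swirl α ρ z h
  refine exists_implicit_of_compact (isOpen_unitSet α) (contDiffOn_fixE α) hC hu
    (fun p hp => hform p hp 0) fun p hp y => ?_
  have hd : HasFDerivAt (fixE α) (fderiv ℝ (fixE α) (p, 0)) (p, 0) :=
    (((contDiffOn_fixE α).contDiffAt ((isOpen_unitSet α).mem_nhds (hu p hp))).differentiableAt
      (by norm_num)).hasFDerivAt
  have h1 : HasFDerivAt (fun h : BC => (p, h)) (ContinuousLinearMap.inr ℝ Coord BC) 0 :=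
    hasFDerivAt_prodMk_right p 0
  have h2 := HasFDerivAt.comp (0 : BC) hd h1
  have h3 : fixE α ∘ (fun h : BC => (p, h)) = id := funext (hform p hp)
  rw [h3] at h2
  have h4 := h2.unique (hasFDerivAt_id (0 : BC))
  simpa using DFunLike.congr_fun h4 y

/-! ### The derivatives of the Riccati solution `Φ = 2 Z' / Z` -/

/-- `tanh`. -/
def tanhW : BC := mkBC Real.tanh continuous_tanh 1 abs_tanh_le

/-- `sech²`. -/
def sechW : BC := mkBC sechSq continuous_sechSq 1 fun t => by
  rw [abs_of_pos (sechSq_pos t)]; exact sechSq_le_one t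

@[simp] theorem tanhW_apply (t : ℝ) : tanhW t = Real.tanh t := rfl
@[simp] theorem sechW_apply (t : ℝ) : sechW t = sechSq t := rfl

/-- The first derivative of the right hand side. -/
def rhs₁ (α : Expo) (x : ℝ × BC) : BC :=
  x.1 • ((-2 : ℝ) • (tanhW * sechW)) + limPlusOp α x.2 • (sechW * (tanhW + (1 / 2 : ℝ) • 1)) +
    limMinusOp α x.2 • (sechW * (tanhW - (1 / 2 : ℝ) • 1)) - psiIntOp α x.2

/-- The second derivative of the right hand side. -/
def rhs₂ (α : Expo) (x : ℝ × BC) : BC :=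
  x.1 • ((4 : ℝ) • (tanhW ^ 2 * sechW) - (2 : ℝ) • sechW ^ 2) +
    limPlusOp α x.2 • ((-2 : ℝ) • (tanhW * sechW * (tanhW + (1 / 2 : ℝ) • 1)) + sechW ^ 2) +
    limMinusOp α x.2 • ((-2 : ℝ) • (tanhW * sechW * (tanhW - (1 / 2 : ℝ) • 1)) + sechW ^ 2) +
    (2 : ℝ) • (tanhW * psiIntOp α x.2) - psi2Op α x.2

theorem contDiff_rhs₁ (α : Expo) : ContDiff ℝ ∞ (rhs₁ α) := by
  unfold rhs₁; fun_prop

theorem contDiff_rhs₂ (α : Expo) : ContDiff ℝ ∞ (rhs₂ α) := by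
  unfold rhs₂; fun_prop

theorem hasDerivAt_interp {y : ℝ → ℝ} (hy : Continuous y) (t : ℝ) :
    HasDerivAt (interp y) (limPlus y * (sechSq t * (Real.tanh t + 1 / 2)) +
      limMinus y * (sechSq t * (Real.tanh t - 1 / 2)) - y t) t := by
  have h := hasDerivAt_tanh t
  have h1 := (((h.pow 2).add h).div_const 2).const_mul (limPlus y)
  have h2 := (((h.pow 2).sub h).div_const 2).const_mul (limMinus y)
  have h3 := (h1.add h2).sub (hasDerivAt_primitive hy t)
  refine HasDerivAt.congr_deriv h3 ?_
  simp only [Nat.cast_ofNat, Nat.add_one_sub_one, pow_one]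
  ring

theorem hasDerivAt_rhs (α : Expo) (x : ℝ × BC) (t : ℝ) :
    HasDerivAt (rhs x.1 (raw α x.2)) (rhs₁ α x t) t := by
  have h1 := ((hasDerivAt_sechSq t).const_mul x.1).add
    (hasDerivAt_interp (continuous_psiInt_raw α x.2) t)
  refine h1.congr_deriv ?_
  simp only [rhs₁, BC.add_apply, BC.sub_apply, BC.smul_apply, BC.mul_apply, tanhW_apply, sechW_apply, psiIntOp_apply, limPlusOp_apply, limMinusOp_apply,
    BC.one_apply]
  ring

theorem hasDerivAt_psiInt {f : ℝ → ℝ} (hf : Continuous f) (t : ℝ) : HasDerivAt (psiInt f)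
    (-2 * Real.tanh t * psiInt f t + sechSq t ^ 2 * psi2 f t) t := by
  refine ((hasDerivAt_sechSq t).mul (hasDerivAt_psi1 hf t)).congr_deriv ?_
  rw [psiInt]; ring

theorem hasDerivAt_rhs₁ (α : Expo) (x : ℝ × BC) (t : ℝ) :
    HasDerivAt (rhs₁ α x) (rhs₂ α x t) t := by
  have hf : (rhs₁ α x : ℝ → ℝ) = fun t => x.1 * (-2 * (Real.tanh t * sechSq t)) +
      limPlusOp α x.2 * (sechSq t * (Real.tanh t + 1 / 2)) +
      limMinusOp α x.2 * (sechSq t * (Real.tanh t - 1 / 2)) - psiInt (raw α x.2) t := by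
    ext t
    simp [rhs₁]
  have hT := hasDerivAt_tanh t
  have hS := hasDerivAt_sechSq t
  rw [hf]
  have h := (((((hT.mul hS).const_mul (-2)).const_mul x.1).add
    ((hS.mul (hT.add_const (1 / 2))).const_mul (limPlusOp α x.2))).add
    ((hS.mul (hT.sub_const (1 / 2))).const_mul (limMinusOp α x.2))).sub
    (hasDerivAt_psiInt (continuous_raw α x.2) t)
  refine h.congr_deriv ?_
  simp only [rhs₂, BC.add_apply, BC.sub_apply, BC.smul_apply, BC.mul_apply, tanhW_apply, sechW_apply, psiIntOp_apply, psi2Op_apply, BC.one_apply,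
    BC.pow_apply]
  ring

/-- `(1 + |t|) Φ`. -/
def phiW (α : Expo) (y : Coord × BC) : BC := (2 : ℝ) • (solZ₁ α y * solI α y)

/-- `Φ`. -/
def phi (α : Expo) (y : Coord × BC) : BC := invW * phiW α y

/-- `(1 + |t|)² Φ'`. -/
def phi₁W (α : Expo) (y : Coord × BC) : BC :=
  (2 : ℝ) • (potSqW α * pot α (y.1.1, y.2)) - (1 / 2 : ℝ) • phiW α y ^ 2

/-- `Φ'`. -/
def phi₁ (α : Expo) (y : Coord × BC) : BC := invW ^ 2 * phi₁W α y

/-- `Φ''`. -/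
def phi₂ (α : Expo) (y : Coord × BC) : BC := rhs₁ α (y.1.1, y.2) - phi α y * phi₁ α y

/-- `Φ'''`. -/
def phi₃ (α : Expo) (y : Coord × BC) : BC :=
  rhs₂ α (y.1.1, y.2) - (phi₁ α y ^ 2 + phi α y * phi₂ α y)

theorem contDiffOn_phiW (α : Expo) : ContDiffOn ℝ ∞ (phiW α) (unitSet α) := by
  have h1 := (contDiff_solZ₁ α).contDiffOn (s := unitSet α)
  have h2 := contDiffOn_solI α
  unfold phiW; fun_prop

theorem contDiffOn_phi (α : Expo) : ContDiffOn ℝ ∞ (phi α) (unitSet α) := by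
  have h1 := contDiffOn_phiW α
  unfold phi; fun_prop

theorem contDiffOn_phi₁W (α : Expo) : ContDiffOn ℝ ∞ (phi₁W α) (unitSet α) := by
  have h1 := contDiffOn_phiW α
  have h2 : ContDiff ℝ ∞ fun y : Coord × BC => pot α (y.1.1, y.2) :=
    (contDiff_pot α).comp (by fun_prop)
  have h3 := h2.contDiffOn (s := unitSet α)
  unfold phi₁W; fun_prop

theorem contDiffOn_phi₁ (α : Expo) : ContDiffOn ℝ ∞ (phi₁ α) (unitSet α) := by
  have h1 := contDiffOn_phi₁W α
  unfold phi₁; fun_prop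

theorem contDiffOn_phi₂ (α : Expo) : ContDiffOn ℝ ∞ (phi₂ α) (unitSet α) := by
  have h1 := contDiffOn_phi α
  have h2 := contDiffOn_phi₁ α
  have h3 : ContDiff ℝ ∞ fun y : Coord × BC => rhs₁ α (y.1.1, y.2) :=
    (contDiff_rhs₁ α).comp (by fun_prop)
  have h4 := h3.contDiffOn (s := unitSet α)
  unfold phi₂; fun_prop

theorem contDiffOn_phi₃ (α : Expo) : ContDiffOn ℝ ∞ (phi₃ α) (unitSet α) := by
  have h1 := contDiffOn_phi α
  have h2 := contDiffOn_phi₁ α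
  have h2' := contDiffOn_phi₂ α
  have h3 : ContDiff ℝ ∞ fun y : Coord × BC => rhs₂ α (y.1.1, y.2) :=
    (contDiff_rhs₂ α).comp (by fun_prop)
  have h4 := h3.contDiffOn (s := unitSet α)
  unfold phi₃; fun_prop

theorem phi_apply {α : Expo} {y : Coord × BC} (hy : y ∈ unitSet α) (t : ℝ) :
    phi α y t = 2 * solZ₁ α y t / solZ α y t := by
  rw [div_eq_mul_inv, ← invW_mul_solI hy, phi, phiW]
  simp only [BC.mul_apply, BC.smul_apply]
  ring

/-- `phi₁W` is the Riccati equation multiplied by `(1 + |t|)²`. The term in `R` stays bounded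
because of its exponential decay, which gives `Φ' = O((1 + |t|)⁻²)`, the decay demanded by `M₁`. -/
theorem phi₁_apply {α : Expo} (y : Coord × BC) (t : ℝ) :
    phi₁ α y t = rhs y.1.1 (raw α y.2) t - phi α y t ^ 2 / 2 := by
  have h2 : (1 + |t|) * (1 + |t|)⁻¹ = 1 := mul_inv_cancel₀ (one_add_abs_pos t).ne'
  rw [← two_mul_sechSq_mul_pot, phi₁, phi₁W, phi]
  simp only [BC.mul_apply, BC.smul_apply, BC.sub_apply, BC.pow_apply, potSqW_apply, invW_apply]
  calc _ = 2 * (sechSq t * Real.exp (α * |t|) * pot α (y.1.1, y.2) t) *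
        ((1 + |t|) * (1 + |t|)⁻¹) ^ 2 - ((1 + |t|)⁻¹ * phiW α y t) ^ 2 / 2 := by ring
    _ = _ := by rw [h2, one_pow, mul_one]

theorem hasDerivAt_phi {α : Expo} {y : Coord × BC} (hy : y ∈ unitSet α) (t : ℝ) :
    HasDerivAt (phi α y) (phi₁ α y t) t := by
  have hZ := isLinSol_solZ α y
  have hf : (phi α y : ℝ → ℝ) = fun t => 2 * solZ₁ α y t / solZ α y t :=
    funext (phi_apply hy)
  have hne := (solZ_pos hy t).ne'
  have h := ((hZ.deriv2 t).const_mul 2).div (hZ.deriv t) hne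
  rw [phi₁_apply, phi_apply hy, hf]
  refine h.congr_deriv ?_
  field_simp

theorem hasDerivAt_phi₁ {α : Expo} {y : Coord × BC} (hy : y ∈ unitSet α) (t : ℝ) :
    HasDerivAt (phi₁ α y) (phi₂ α y t) t := by
  have hf : (phi₁ α y : ℝ → ℝ) = fun t => rhs y.1.1 (raw α y.2) t - phi α y t ^ 2 / 2 :=
    funext (phi₁_apply y)
  rw [hf]
  refine ((hasDerivAt_rhs α (y.1.1, y.2) t).sub
    (((hasDerivAt_phi hy t).pow 2).div_const 2)).congr_deriv ?_
  simp only [phi₂, BC.sub_apply, BC.mul_apply, Nat.cast_ofNat, Nat.add_one_sub_one, pow_one]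
  ring

theorem hasDerivAt_phi₂ {α : Expo} {y : Coord × BC} (hy : y ∈ unitSet α) (t : ℝ) :
    HasDerivAt (phi₂ α y) (phi₃ α y t) t := by
  refine ((hasDerivAt_rhs₁ α (y.1.1, y.2) t).sub
    ((hasDerivAt_phi hy t).mul (hasDerivAt_phi₁ hy t))).congr_deriv ?_
  simp only [phi₃, BC.sub_apply, BC.mul_apply, BC.add_apply, BC.pow_apply]
  ring

theorem interp_zero (y : ℝ → ℝ) : interp y 0 = 0 := by simp [interp]

/-- The interpolating quadratic was chosen to vanish at `x = 0`, so the density does not affect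
`R(0)`. Consequently `Φ(0)` and `Φ'(0)` are explicit in the coordinates. -/
theorem rhs_zero (ρ : ℝ) (f : ℝ → ℝ) : rhs ρ f 0 = ρ := by simp [rhs, interp_zero, sechSq]

theorem phi_zero {α : Expo} {y : Coord × BC} (hy : y ∈ unitSet α) :
    phi α y 0 = 2 * y.1.2.1 := by
  rw [phi_apply hy, solZ₁_zero, (isLinSol_solZ α y).zero, div_one]

theorem phi₁_zero {α : Expo} {y : Coord × BC} (hy : y ∈ unitSet α) :
    phi₁ α y 0 = y.1.1 - 2 * y.1.2.1 ^ 2 := by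
  rw [phi₁_apply, rhs_zero, phi_zero hy]; ring

/-- `(1 / Z²)'`. -/
def solG₁ (α : Expo) (y : Coord × BC) : BC := (-2 : ℝ) • (solZ₁ α y * (invW * solI α y) ^ 3)

theorem contDiffOn_solG₁ (α : Expo) : ContDiffOn ℝ ∞ (solG₁ α) (unitSet α) := by
  have h1 := (contDiff_solZ₁ α).contDiffOn (s := unitSet α)
  have h2 := contDiffOn_solI α
  unfold solG₁; fun_prop

theorem solG₁_apply (α : Expo) (y : Coord × BC) (t : ℝ) :
    solG₁ α y t = -(phi α y t * solG α y t) := by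
  rw [solG₁, phi, phiW, solG]
  simp only [BC.smul_apply, BC.mul_apply, BC.pow_apply]
  ring

theorem hasDerivAt_solG {α : Expo} {y : Coord × BC} (hy : y ∈ unitSet α) (t : ℝ) :
    HasDerivAt (solG α y) (solG₁ α y t) t := by
  have hf : (solG α y : ℝ → ℝ) = fun t => (solZ α y t ^ 2)⁻¹ := funext (solG_apply hy)
  have hne := (solZ_pos hy t).ne'
  rw [solG₁_apply, phi_apply hy, solG_apply hy, hf]
  refine ((((isLinSol_solZ α y).deriv t).pow 2).inv (pow_ne_zero 2 hne)).congr_deriv ?_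
  simp only [Pi.pow_apply]
  field_simp
  push_cast
  ring

theorem solG_zero {α : Expo} {y : Coord × BC} (hy : y ∈ unitSet α) : solG α y 0 = 1 := by
  rw [solG_apply hy, (isLinSol_solZ α y).zero]; norm_num

/-! ## From functions of `t` to functions of `x` -/

/-- The function `x ↦ F (artanh x)` on `(-1,1)`, extended by zero. -/
def pull (F : ℝ → ℝ) (x : ℝ) : ℝ :=
  open Classical in if x ∈ Ioo (-1 : ℝ) 1 then F (Real.artanh x) else 0

theorem pull_of_mem (F : ℝ → ℝ) {x : ℝ} (hx : x ∈ Ioo (-1 : ℝ) 1) :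
    pull F x = F (Real.artanh x) := if_pos hx

theorem pull_of_notMem (F : ℝ → ℝ) {x : ℝ} (hx : x ∉ Ioo (-1 : ℝ) 1) : pull F x = 0 := if_neg hx

theorem pull_eventuallyEq (F : ℝ → ℝ) {x : ℝ} (hx : x ∈ Ioo (-1 : ℝ) 1) :
    pull F =ᶠ[𝓝 x] fun x => F (Real.artanh x) := by
  filter_upwards [isOpen_Ioo.mem_nhds hx] with y hy using pull_of_mem F hy

theorem one_sub_sq_pos {x : ℝ} (hx : x ∈ Ioo (-1 : ℝ) 1) : 0 < 1 - x ^ 2 := by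
  nlinarith [mul_pos (sub_pos.2 hx.1) (sub_pos.2 hx.2)]

theorem sechSq_artanh {x : ℝ} (hx : x ∈ Ioo (-1 : ℝ) 1) : sechSq (Real.artanh x) = 1 - x ^ 2 := by
  rw [← one_sub_tanh_sq, Real.tanh_artanh hx]

theorem hasDerivAt_comp_artanh {F : ℝ → ℝ} {F' x : ℝ} (hx : x ∈ Ioo (-1 : ℝ) 1)
    (h : HasDerivAt F F' (Real.artanh x)) :
    HasDerivAt (fun x => F (Real.artanh x)) (F' * (1 - x ^ 2)⁻¹) x :=
  h.comp x (hasDerivAt_artanh hx)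

theorem hasDerivAt_pull {F : ℝ → ℝ} {F' x : ℝ} (hx : x ∈ Ioo (-1 : ℝ) 1)
    (h : HasDerivAt F F' (Real.artanh x)) : HasDerivAt (pull F) (F' * (1 - x ^ 2)⁻¹) x :=
  (hasDerivAt_comp_artanh hx h).congr_of_eventuallyEq (pull_eventuallyEq F hx)

theorem contDiffOn_artanh {n : ℕ∞ω} : ContDiffOn ℝ n Real.artanh (Ioo (-1) 1) := by
  have h : ContDiffOn ℝ n (fun x : ℝ => 1 / 2 * Real.log ((1 + x) / (1 - x))) (Ioo (-1) 1) := by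
    have h1 : ∀ x ∈ Ioo (-1 : ℝ) 1, 1 - x ≠ 0 := fun x hx => (sub_pos.2 hx.2).ne'
    refine contDiffOn_const.mul (ContDiffOn.log (ContDiffOn.div (by fun_prop) (by fun_prop) h1) ?_)
    intro x hx
    exact (div_pos (by linarith [hx.1]) (sub_pos.2 hx.2)).ne'
  exact h.congr fun x hx => Real.artanh_eq_half_log (Ioo_subset_Icc_self hx)

theorem contDiffOn_pull {n : ℕ∞ω} {F : ℝ → ℝ} {s : Set ℝ} {u v : ℝ} (hu : -1 ≤ u) (hv : v ≤ 1)
    (hF : ContDiffOn ℝ n F s) (hs : MapsTo Real.artanh (Ioo u v) s) :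
    ContDiffOn ℝ n (pull F) (Ioo u v) :=
  (hF.comp (contDiffOn_artanh.mono (Ioo_subset_Ioo hu hv)) hs).congr fun _ hx =>
    pull_of_mem F (Ioo_subset_Ioo hu hv hx)

theorem contDiffOn_succ_of_hasDerivAt {n : ℕ} {F F' : ℝ → ℝ} {s : Set ℝ} (hs : IsOpen s)
    (h : ∀ t ∈ s, HasDerivAt F (F' t) t) (hF' : ContDiffOn ℝ n F' s) :
    ContDiffOn ℝ ((n + 1 : ℕ) : ℕ∞ω) F s := by
  push_cast
  rw [contDiffOn_succ_iff_deriv_of_isOpen hs]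
  refine ⟨fun t ht => (h t ht).differentiableAt.differentiableWithinAt, by simp, ?_⟩
  exact hF'.congr fun t ht => (h t ht).deriv

/-- Because `tanh 1 > 1/2`, the interval where `M₁` controls three derivatives lies inside `|t| <
1`, the region untouched by the cutoffs used later. -/
theorem abs_artanh_lt_one {x : ℝ} (hx : x ∈ Ioo (-1 / 2 : ℝ) (1 / 2)) : |Real.artanh x| < 1 := by
  have h1 : (1 / 2 : ℝ) < Real.tanh 1 := by
    rw [Real.tanh_eq_sinh_div_cosh, lt_div_iff₀ (Real.cosh_pos _), Real.sinh_eq, Real.cosh_eq,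
      Real.exp_neg]
    have h2 : (2 : ℝ) < Real.exp 1 := by linarith [Real.exp_one_gt_d9]
    have h3 : (Real.exp 1)⁻¹ < 2⁻¹ := inv_strictAnti₀ (by norm_num) h2
    linarith
  have hx' : x ∈ Ioo (-1 : ℝ) 1 := ⟨by linarith [hx.1], by linarith [hx.2]⟩
  rw [abs_lt]
  constructor
  · have := Real.artanh_lt_artanh (x := Real.tanh (-1)) (y := x) (tanh_mem_Ioo _).1 hx'.2
      (by rw [Real.tanh_neg]; linarith [hx.1])
    rwa [Real.artanh_tanh] at this
  · have := Real.artanh_lt_artanh (x := x) (y := Real.tanh 1) hx'.1 (tanh_mem_Ioo _).2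
      (by linarith [hx.2])
    rwa [Real.artanh_tanh] at this

/-! ### The logarithmic weight in the variable `t`, and membership criteria for `M₁` and `M₂`. -/

theorem logWeight_neg (x : ℝ) : logWeight (-x) = logWeight x := by
  rw [logWeight, logWeight, sub_neg_eq_add, ← sub_eq_add_neg, mul_comm]

theorem tanh_nonneg {t : ℝ} (ht : 0 ≤ t) : 0 ≤ Real.tanh t := by
  rw [Real.tanh_eq_sinh_div_cosh]
  exact div_nonneg (Real.sinh_nonneg_iff.2 ht) (Real.cosh_pos t).le

theorem log_six_le : Real.log 6 ≤ 2 := by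
  rw [Real.log_le_iff_le_exp (by norm_num)]
  have h : (2.7 : ℝ) ≤ Real.exp 1 := by linarith [Real.exp_one_gt_d9]
  have : Real.exp 2 = Real.exp 1 * Real.exp 1 := by rw [← Real.exp_add]; norm_num
  nlinarith

/-- For `x = tanh t ≥ 0` one has `exp (-2 t) ≤ 1 - x² ≤ 2 (1 - x)`, so the logarithm at the near
pole is at most `2 t + log 6` in absolute value. The other logarithm is bounded by `log 6 ≤ 2`. -/
theorem abs_logWeight_tanh_le_of_nonneg {t : ℝ} (ht : 0 ≤ t) :
    |logWeight (Real.tanh t)| ≤ 4 * (1 + t) := by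
  have hx0 := tanh_nonneg ht
  have hx1 := (tanh_mem_Ioo t).2
  have hs := le_sechSq t
  rw [← one_sub_tanh_sq, abs_of_nonneg ht] at hs
  have h6 := log_six_le
  set x := Real.tanh t
  have h1 : |Real.log ((1 + x) / 3)| ≤ 2 := by
    have ha : Real.log ((1 + x) / 3) ≤ 0 := Real.log_nonpos (by linarith) (by linarith)
    have hb : -Real.log 6 ≤ Real.log ((1 + x) / 3) := by
      rw [← Real.log_inv]
      exact Real.log_le_log (by norm_num) (by norm_num; linarith)
    rw [abs_of_nonpos ha]; linarith
  have h2 : |Real.log ((1 - x) / 3)| ≤ 2 * (1 + t) := by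
    have hp : 0 < (1 - x) / 3 := by linarith
    have ha : Real.log ((1 - x) / 3) ≤ 0 := Real.log_nonpos hp.le (by linarith)
    have hb : -2 * t - Real.log 6 ≤ Real.log ((1 - x) / 3) := by
      rw [Real.le_log_iff_exp_le hp, Real.exp_sub, Real.exp_log (by norm_num)]
      nlinarith
    rw [abs_of_nonpos ha]; linarith
  rw [logWeight, abs_mul]
  calc _ ≤ 2 * (2 * (1 + t)) := by gcongr
    _ = _ := by ring

theorem abs_logWeight_tanh_le (t : ℝ) : |logWeight (Real.tanh t)| ≤ 4 * (1 + |t|) := by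
  rcases le_total 0 t with ht | ht
  · rw [abs_of_nonneg ht]; exact abs_logWeight_tanh_le_of_nonneg ht
  · have := abs_logWeight_tanh_le_of_nonneg (neg_nonneg.2 ht)
    rwa [Real.tanh_neg, logWeight_neg, ← abs_of_nonpos ht] at this

theorem abs_logWeight_mul_le {x y C : ℝ} (hx : x ∈ Ioo (-1 : ℝ) 1)
    (h : |y| ≤ C * (1 + |Real.artanh x|)⁻¹) : |logWeight x * y| ≤ 4 * C := by
  have h1 := abs_logWeight_tanh_le (Real.artanh x)
  rw [Real.tanh_artanh hx] at h1
  have h2 := one_add_abs_pos (Real.artanh x)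
  rw [abs_mul]
  calc |logWeight x| * |y| ≤ 4 * (1 + |Real.artanh x|) * (C * (1 + |Real.artanh x|)⁻¹) := by gcongr
    _ = 4 * C := by field_simp

theorem supNorm_le {s : Set ℝ} {g : ℝ → ℝ} {C : ℝ} (hC : 0 ≤ C) (h : ∀ x ∈ s, |g x| ≤ C) :
    supNorm s g ≤ C := Real.iSup_le (fun x => h x x.2) hC

/-- The element of `M₁` with a given underlying function. -/
def M1.of (f : ℝ → ℝ) (h : MemM1 f) : M1 := (⟨f, h⟩ : M1Submodule)

/-- The element of `M₂` with a given underlying function. -/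
def M2.of {ε : ℝ} (f : ℝ → ℝ) (h : MemM2 ε f) : M2 ε := (⟨f, h⟩ : M2Submodule ε)

theorem M1.fn_of (f : ℝ → ℝ) (h : MemM1 f) : (M1.of f h).fn = f := rfl
theorem M2.fn_of {ε : ℝ} (f : ℝ → ℝ) (h : MemM2 ε f) : (M2.of f h).fn = f := rfl
theorem M1.ext {f g : M1} (h : f.fn = g.fn) : f = g := Subtype.ext h
theorem M2.ext {ε : ℝ} {f g : M2 ε} (h : f.fn = g.fn) : f = g := Subtype.ext h

theorem pull_add (F G : ℝ → ℝ) : pull (fun t => F t + G t) = pull F + pull G := by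
  ext x
  by_cases hx : x ∈ Ioo (-1 : ℝ) 1
  · simp [pull_of_mem _ hx]
  · simp [pull_of_notMem _ hx]

theorem pull_smul (r : ℝ) (F : ℝ → ℝ) : pull (fun t => r * F t) = r • pull F := by
  ext x
  by_cases hx : x ∈ Ioo (-1 : ℝ) 1
  · simp [pull_of_mem _ hx]
  · simp [pull_of_notMem _ hx]

theorem hasDerivAt_inv_one_sub_sq {x : ℝ} (hx : x ∈ Ioo (-1 : ℝ) 1) :
    HasDerivAt (fun x : ℝ => (1 - x ^ 2)⁻¹) (2 * x * (1 - x ^ 2)⁻¹ ^ 2) x := by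
  have h := (((hasDerivAt_id x).pow 2).const_sub 1).inv (one_sub_sq_pos hx).ne'
  refine h.congr_deriv ?_
  simp only [id, Pi.pow_apply]
  have := (one_sub_sq_pos hx).ne'
  field_simp
  push_cast
  ring

/-- The second derivative of `F (artanh x)`. -/
theorem hasDerivAt_deriv_pull {F F₁ F₂ : ℝ → ℝ} {s : Set ℝ} (hs : IsOpen s)
    (hsub : s ⊆ Ioo (-1 : ℝ) 1)
    (h1 : ∀ x ∈ s, HasDerivAt F (F₁ (Real.artanh x)) (Real.artanh x))
    (h2 : ∀ x ∈ s, HasDerivAt F₁ (F₂ (Real.artanh x)) (Real.artanh x)) {x : ℝ} (hx : x ∈ s) :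
    HasDerivAt (deriv (pull F))
      ((1 - x ^ 2)⁻¹ ^ 2 * (F₂ (Real.artanh x) + 2 * x * F₁ (Real.artanh x))) x := by
  have h3 : HasDerivAt (fun x => F₁ (Real.artanh x) * (1 - x ^ 2)⁻¹) _ x :=
    (hasDerivAt_comp_artanh (hsub hx) (h2 x hx)).mul (hasDerivAt_inv_one_sub_sq (hsub hx))
  refine (h3.congr_of_eventuallyEq ?_).congr_deriv ?_
  · filter_upwards [hs.mem_nhds hx] with y hy using (hasDerivAt_pull (hsub hy) (h1 y hy)).deriv
  · ring

theorem iteratedDeriv_two_pull {F F₁ F₂ : ℝ → ℝ} {s : Set ℝ} (hs : IsOpen s)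
    (hsub : s ⊆ Ioo (-1 : ℝ) 1)
    (h1 : ∀ x ∈ s, HasDerivAt F (F₁ (Real.artanh x)) (Real.artanh x))
    (h2 : ∀ x ∈ s, HasDerivAt F₁ (F₂ (Real.artanh x)) (Real.artanh x)) {x : ℝ} (hx : x ∈ s) :
    iteratedDeriv 2 (pull F) x =
      (1 - x ^ 2)⁻¹ ^ 2 * (F₂ (Real.artanh x) + 2 * x * F₁ (Real.artanh x)) := by
  rw [iteratedDeriv_succ, iteratedDeriv_one]
  exact (hasDerivAt_deriv_pull hs hsub h1 h2 hx).deriv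

theorem iteratedDeriv_three_pull {F F₁ F₂ F₃ : ℝ → ℝ} {s : Set ℝ} (hs : IsOpen s)
    (hsub : s ⊆ Ioo (-1 : ℝ) 1)
    (h1 : ∀ x ∈ s, HasDerivAt F (F₁ (Real.artanh x)) (Real.artanh x))
    (h2 : ∀ x ∈ s, HasDerivAt F₁ (F₂ (Real.artanh x)) (Real.artanh x))
    (h3 : ∀ x ∈ s, HasDerivAt F₂ (F₃ (Real.artanh x)) (Real.artanh x)) {x : ℝ} (hx : x ∈ s) :
    iteratedDeriv 3 (pull F) x = (1 - x ^ 2)⁻¹ ^ 3 * (F₃ (Real.artanh x) +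
      6 * x * F₂ (Real.artanh x) + (2 + 6 * x ^ 2) * F₁ (Real.artanh x)) := by
  have hne := (one_sub_sq_pos (hsub hx)).ne'
  have h4 : HasDerivAt (fun x => (1 - x ^ 2)⁻¹ ^ 2 *
      (F₂ (Real.artanh x) + 2 * x * F₁ (Real.artanh x))) _ x :=
    ((hasDerivAt_inv_one_sub_sq (hsub hx)).pow 2).mul
      ((hasDerivAt_comp_artanh (hsub hx) (h3 x hx)).add
        (((hasDerivAt_id x).const_mul 2).mul (hasDerivAt_comp_artanh (hsub hx) (h2 x hx))))
  rw [iteratedDeriv_succ]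
  refine ((h4.congr_of_eventuallyEq ?_).congr_deriv ?_).deriv
  · filter_upwards [hs.mem_nhds hx] with y hy using iteratedDeriv_two_pull hs hsub h1 h2 hy
  · simp only [Nat.cast_ofNat, Nat.add_one_sub_one, pow_one, id, Pi.pow_apply]
    -- Only the `F₁` terms fail to match formally: the product rule produces `(1 - x²)⁻²`, and the
    -- claimed form has `(1 - x²)⁻³`.
    have e : F₁ (Real.artanh x) * (1 - x ^ 2)⁻¹ ^ 3 * 2 =
        F₁ (Real.artanh x) * (1 - x ^ 2)⁻¹ ^ 2 * 2 + 2 * x ^ 2 * F₁ (Real.artanh x) *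
          (1 - x ^ 2)⁻¹ ^ 3 := by
      field_simp
      ring
    linear_combination -e

/-- The limits at the poles may be two-sided because `pull` vanishes outside `(-1,1)`; inside, `x`
near a pole means `|artanh x|` large. -/
theorem tendsto_pull_one {F : ℝ → ℝ} {C : ℝ} (h0 : ∀ t, |F t| ≤ C * (1 + |t|)⁻¹) :
    Filter.Tendsto (pull F) (𝓝 1) (𝓝 0) ∧ Filter.Tendsto (pull F) (𝓝 (-1)) (𝓝 0) := by
  have key : ∀ e : ℝ, 0 < e → ∃ T : ℝ, ∀ x, (Real.tanh T < x ∨ x < Real.tanh (-T)) →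
      |pull F x| < e := by
    intro e he
    refine ⟨|C| / e, fun x hx => ?_⟩
    by_cases hm : x ∈ Ioo (-1 : ℝ) 1
    · rw [pull_of_mem F hm]
      have hT : |C| / e < |Real.artanh x| := by
        rcases hx with hx | hx
        · have := Real.artanh_lt_artanh (tanh_mem_Ioo _).1 hm.2 hx
          rw [Real.artanh_tanh] at this
          exact this.trans_le (le_abs_self _)
        · have := Real.artanh_lt_artanh hm.1 (tanh_mem_Ioo _).2 hx
          rw [Real.artanh_tanh] at this
          exact (lt_neg.1 this).trans_le (neg_le_abs _)
      have hp := one_add_abs_pos (Real.artanh x)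
      refine (h0 _).trans_lt ?_
      rw [← div_eq_mul_inv, div_lt_iff₀ hp]
      rw [div_lt_iff₀ he] at hT
      nlinarith [le_abs_self C]
    · rw [pull_of_notMem F hm, abs_zero]; exact he
  constructor
  · refine Metric.tendsto_nhds.2 fun e he => ?_
    obtain ⟨T, hT⟩ := key e he
    filter_upwards [lt_mem_nhds (tanh_mem_Ioo T).2] with x hx
    simpa using hT x (Or.inl hx)
  · refine Metric.tendsto_nhds.2 fun e he => ?_
    obtain ⟨T, hT⟩ := key e he
    filter_upwards [gt_mem_nhds (tanh_mem_Ioo (-T)).1] with x hx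
    simpa using hT x (Or.inr hx)

/-- A criterion for membership in `M₁` in the variable `t`. -/
theorem exists_M1_pull {F F₁ F₂ F₃ : ℝ → ℝ} {C : ℝ} (h1 : ∀ t, HasDerivAt F (F₁ t) t)
    (hc1 : Continuous F₁) (h2 : ∀ t ∈ Ioo (-1 : ℝ) 1, HasDerivAt F₁ (F₂ t) t)
    (h3 : ∀ t ∈ Ioo (-1 : ℝ) 1, HasDerivAt F₂ (F₃ t) t) (hc3 : ContinuousOn F₃ (Ioo (-1) 1))
    (b0 : ∀ t, |F t| ≤ C * (1 + |t|)⁻¹) (b1 : ∀ t, |F₁ t| ≤ C * (1 + |t|)⁻¹ ^ 2)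
    (b2 : ∀ t ∈ Ioo (-1 : ℝ) 1, |F₂ t| ≤ C) (b3 : ∀ t ∈ Ioo (-1 : ℝ) 1, |F₃ t| ≤ C) :
    ∃ h : MemM1 (pull F), ‖M1.of (pull F) h‖ ≤ 50 * C := by
  have hC : 0 ≤ C := (abs_nonneg _).trans (b2 0 (by norm_num))
  set s := Ioo (-1 / 2 : ℝ) (1 / 2)
  have hsub : s ⊆ Ioo (-1 : ℝ) 1 := Ioo_subset_Ioo (by norm_num) (by norm_num)
  have hat : ∀ x ∈ s, Real.artanh x ∈ Ioo (-1 : ℝ) 1 := fun x hx =>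
    abs_lt.1 (abs_artanh_lt_one hx)
  have hcF : ContDiff ℝ 1 F := by
    rw [← contDiffOn_univ]
    exact contDiffOn_succ_of_hasDerivAt (n := 0) isOpen_univ (fun t _ => h1 t)
      (by simpa using hc1)
  have hc3F : ContDiffOn ℝ 3 F (Ioo (-1) 1) := by
    have e3 : ContDiffOn ℝ (0 : ℕ) F₃ (Ioo (-1) 1) := by simpa using hc3
    exact contDiffOn_succ_of_hasDerivAt (n := 2) isOpen_Ioo (fun t _ => h1 t)
      (contDiffOn_succ_of_hasDerivAt (n := 1) isOpen_Ioo h2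
        (contDiffOn_succ_of_hasDerivAt (n := 0) isOpen_Ioo h3 e3))
  have d1 : ∀ x ∈ Ioo (-1 : ℝ) 1, deriv (pull F) x = F₁ (Real.artanh x) * (1 - x ^ 2)⁻¹ :=
    fun x hx => (hasDerivAt_pull hx (h1 _)).deriv
  have d2 : ∀ x ∈ s, _ := fun x hx => iteratedDeriv_two_pull (s := s) isOpen_Ioo hsub
    (fun x _ => h1 _) (fun x hx => h2 _ (hat x hx)) hx
  have d3 : ∀ x ∈ s, _ := fun x hx => iteratedDeriv_three_pull (s := s) isOpen_Ioo hsub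
    (fun x _ => h1 _) (fun x hx => h2 _ (hat x hx)) (fun x hx => h3 _ (hat x hx)) hx
  have hy : ∀ x ∈ s, 0 ≤ (1 - x ^ 2)⁻¹ ∧ (1 - x ^ 2)⁻¹ ≤ 4 / 3 ∧ |x| ≤ 1 / 2 := by
    intro x hx
    have habs : |x| ≤ 1 / 2 := abs_le.2 ⟨by linarith [hx.1], hx.2.le⟩
    have hsq : x ^ 2 ≤ 1 / 4 := by
      rw [← sq_abs]; nlinarith [abs_nonneg x]
    refine ⟨inv_nonneg.2 (by linarith), ?_, habs⟩
    rw [show (4 / 3 : ℝ) = (3 / 4)⁻¹ by norm_num]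
    exact inv_anti₀ (by norm_num) (by linarith)
  have hF1C : ∀ t, |F₁ t| ≤ C := fun t => by
    refine (b1 t).trans ?_
    have h0 := inv_nonneg.2 (one_add_abs_pos t).le
    have := pow_le_one₀ (n := 2) h0 (inv_one_add_abs_le_one t)
    nlinarith
  have e0 : ∀ x ∈ Ioo (-1 : ℝ) 1, |logWeight x * pull F x| ≤ 4 * C := fun x hx => by
    rw [pull_of_mem F hx]
    exact abs_logWeight_mul_le hx (b0 _)
  have e1 : ∀ x ∈ Ioo (-1 : ℝ) 1,
      |(1 - x ^ 2) * logWeight x ^ 2 * deriv (pull F) x| ≤ 16 * C := fun x hx => by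
    have hne := (one_sub_sq_pos hx).ne'
    have h4 := abs_logWeight_mul_le (x := x) (y := (1 + |Real.artanh x|)⁻¹) (C := 1) hx (by
      rw [one_mul, abs_of_pos (inv_pos.2 (one_add_abs_pos _))])
    have hp := inv_pos.2 (one_add_abs_pos (Real.artanh x))
    rw [abs_mul, abs_of_pos hp, mul_one] at h4
    rw [d1 x hx, show (1 - x ^ 2) * logWeight x ^ 2 * (F₁ (Real.artanh x) * (1 - x ^ 2)⁻¹) =
      logWeight x ^ 2 * F₁ (Real.artanh x) * ((1 - x ^ 2) * (1 - x ^ 2)⁻¹) by ring,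
      mul_inv_cancel₀ hne, mul_one, abs_mul, abs_pow]
    calc |logWeight x| ^ 2 * |F₁ (Real.artanh x)|
        ≤ |logWeight x| ^ 2 * (C * (1 + |Real.artanh x|)⁻¹ ^ 2) := by gcongr; exact b1 _
      _ = C * (|logWeight x| * (1 + |Real.artanh x|)⁻¹) ^ 2 := by ring
      _ ≤ C * 4 ^ 2 := by gcongr
      _ = _ := by ring
  have e2 : ∀ x ∈ s, |iteratedDeriv 2 (pull F) x| ≤ 4 * C := fun x hx => by
    obtain ⟨y0, y1, y2⟩ := hy x hx
    rw [d2 x hx, abs_mul, abs_of_nonneg (pow_nonneg y0 2)]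
    have ha : |F₂ (Real.artanh x) + 2 * x * F₁ (Real.artanh x)| ≤ C + 2 * (1 / 2) * C := by
      refine (abs_add_le _ _).trans ?_
      rw [abs_mul, abs_mul, abs_two]
      gcongr
      · exact b2 _ (hat x hx)
      · exact hF1C _
    calc _ ≤ (4 / 3) ^ 2 * (C + 2 * (1 / 2) * C) := by gcongr
      _ ≤ 4 * C := by linarith
  have e3 : ∀ x ∈ s, |iteratedDeriv 3 (pull F) x| ≤ 18 * C := fun x hx => by
    obtain ⟨y0, y1, y2⟩ := hy x hx
    rw [d3 x hx, abs_mul, abs_of_nonneg (pow_nonneg y0 3)]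
    have ha : |F₃ (Real.artanh x) + 6 * x * F₂ (Real.artanh x) +
        (2 + 6 * x ^ 2) * F₁ (Real.artanh x)| ≤
        C + 6 * (1 / 2) * C + (2 + 6 * (1 / 2) ^ 2) * C := by
      refine (abs_add_le _ _).trans (add_le_add ((abs_add_le _ _).trans (add_le_add ?_ ?_)) ?_)
      · exact b3 _ (hat x hx)
      · rw [abs_mul, abs_mul, abs_of_nonneg (by norm_num : (0 : ℝ) ≤ 6)]
        gcongr
        exact b2 _ (hat x hx)
      · rw [abs_mul, abs_of_nonneg (by positivity), ← sq_abs x]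
        gcongr
        exact hF1C _
    calc _ ≤ (4 / 3) ^ 3 * (C + 6 * (1 / 2) * C + (2 + 6 * (1 / 2) ^ 2) * C) := by gcongr
      _ ≤ 18 * C := by linarith
  have hcont1 : ContDiffOn ℝ 1 (pull F) (Ioo (-1) 1) :=
    contDiffOn_pull le_rfl le_rfl hcF.contDiffOn (mapsTo_univ _ _)
  have hmem : MemM1 (pull F) :=
    { zero_off := fun x hx => pull_of_notMem F hx
      c3 := contDiffOn_pull (by norm_num) (by norm_num) hc3F hat
      c1 := hcont1
      cont := by
        intro x hx
        by_cases hm : x ∈ Ioo (-1 : ℝ) 1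
        · exact ((hcont1.continuousOn x hm).continuousAt
            (isOpen_Ioo.mem_nhds hm)).continuousWithinAt
        · have hv : pull F x = 0 := pull_of_notMem F hm
          refine ContinuousAt.continuousWithinAt ?_
          rw [ContinuousAt, hv]
          obtain ⟨ha, hb⟩ := tendsto_pull_one b0
          rcases eq_or_lt_of_le hx.1 with h | h
          · rwa [← h]
          · rcases eq_or_lt_of_le hx.2 with h' | h'
            · rwa [h']
            · exact absurd ⟨h, h'⟩ hm
      bdd0 := ⟨_, e0⟩
      bdd1 := ⟨_, e1⟩
      bdd2 := ⟨_, e2⟩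
      bdd3 := ⟨_, e3⟩ }
  refine ⟨hmem, ?_⟩
  rw [M1.norm_def, M1.fn_of]
  have n0 := supNorm_le (by positivity) e0
  have n1 := supNorm_le (by positivity) e1
  have n2 := supNorm_le (by positivity) e2
  have n3 := supNorm_le (by positivity) e3
  -- The four contributions add up to `4 + 16 + 4 + 18 = 42 ≤ 50`.
  exact (add_le_add (add_le_add (add_le_add n0 n1) n2) n3).trans (by linarith)

/-- The weight of `M₂` is at most `4 exp (-2 ε |t|)`, and each factor `exp (-ε |t|)` absorbs one
factor `1 + |t|`. Quadratic growth in `t` is therefore admissible in `M₂`. -/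
theorem rpow_mul_one_add_abs_sq_le {ε : ℝ} (hε : 0 < ε) (hε1 : ε < 1) (t : ℝ) :
    sechSq t ^ ε * (1 + |t|) ^ 2 ≤ 4 * (1 + 1 / ε) ^ 2 := by
  have h1 : sechSq t ^ ε ≤ 4 * Real.exp (-ε * |t|) ^ 2 := by
    calc sechSq t ^ ε ≤ (4 * Real.exp (-2 * |t|)) ^ ε :=
          Real.rpow_le_rpow (sechSq_pos t).le (sechSq_le t) hε.le
      _ = 4 ^ ε * Real.exp (-2 * |t|) ^ ε :=
          Real.mul_rpow (by norm_num) (Real.exp_pos _).le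
      _ ≤ 4 ^ (1 : ℝ) * Real.exp (-2 * |t|) ^ ε := by
          gcongr
          norm_num
      _ = _ := by
          rw [Real.rpow_one, ← Real.exp_mul, sq, ← Real.exp_add]; ring_nf
  have h2 : (1 + |t|) * Real.exp (-ε * |t|) ≤ 1 + 1 / ε := by
    have h3 : ε * |t| + 1 ≤ Real.exp (ε * |t|) := Real.add_one_le_exp _
    have h4 : 1 ≤ Real.exp (ε * |t|) := Real.one_le_exp (by positivity)
    have h5 : |t| ≤ 1 / ε * Real.exp (ε * |t|) := by
      rw [one_div, inv_mul_eq_div, le_div_iff₀ hε]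
      linarith
    rw [neg_mul, Real.exp_neg, ← div_eq_mul_inv, div_le_iff₀ (Real.exp_pos _)]
    linarith
  have hp := one_add_abs_pos t
  calc sechSq t ^ ε * (1 + |t|) ^ 2 ≤ 4 * Real.exp (-ε * |t|) ^ 2 * (1 + |t|) ^ 2 := by gcongr
    _ = 4 * ((1 + |t|) * Real.exp (-ε * |t|)) ^ 2 := by ring
    _ ≤ _ := by gcongr

/-- A criterion for membership in `M₂` in the variable `t`. -/
theorem exists_M2_pull {ε : ℝ} (hε : 0 < ε) (hε1 : ε < 1) {F F₁ F₂ : ℝ → ℝ} {C : ℝ}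
    (h1 : ∀ t, HasDerivAt F (F₁ t) t) (h2 : ∀ t, HasDerivAt F₁ (F₂ t) t) (hc2 : Continuous F₂)
    (b0 : ∀ t, |F t| ≤ C * (1 + |t|) ^ 2) (b1 : ∀ t, |F₁ t| ≤ C * (1 + |t|) ^ 2)
    (b2 : ∀ t, |F₂ t| ≤ C) :
    ∃ h : MemM2 ε (pull F), ‖M2.of (pull F) h‖ ≤ 5 * (4 * (1 + 1 / ε) ^ 2) * C := by
  have hC : 0 ≤ C := (abs_nonneg _).trans (b2 0)
  set B := 4 * (1 + 1 / ε) ^ 2 with hB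
  have hB0 : 0 ≤ B := by positivity
  have hcF : ContDiff ℝ 2 F := by
    rw [← contDiffOn_univ]
    exact contDiffOn_succ_of_hasDerivAt (n := 1) isOpen_univ (fun t _ => h1 t)
      (contDiffOn_succ_of_hasDerivAt (n := 0) isOpen_univ (fun t _ => h2 t)
      (by simpa using hc2))
  have key : ∀ x ∈ Ioo (-1 : ℝ) 1, ∀ y D, 0 ≤ D → |y| ≤ D * (1 + |Real.artanh x|) ^ 2 →
      |(1 - x ^ 2) ^ ε * y| ≤ B * D := by
    intro x hx y D hD hy
    have h3 := rpow_mul_one_add_abs_sq_le hε hε1 (Real.artanh x)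
    rw [sechSq_artanh hx] at h3
    have h4 := Real.rpow_nonneg (one_sub_sq_pos hx).le ε
    rw [abs_mul, abs_of_nonneg h4]
    calc (1 - x ^ 2) ^ ε * |y| ≤ (1 - x ^ 2) ^ ε * (D * (1 + |Real.artanh x|) ^ 2) := by gcongr
      _ = (1 - x ^ 2) ^ ε * (1 + |Real.artanh x|) ^ 2 * D := by ring
      _ ≤ B * D := by gcongr
  have one_le : ∀ t : ℝ, 1 ≤ (1 + |t|) ^ 2 := fun t =>
    one_le_pow₀ (by linarith [abs_nonneg t])
  have e0 : ∀ x ∈ Ioo (-1 : ℝ) 1, |(1 - x ^ 2) ^ ε * pull F x| ≤ B * C := fun x hx => by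
    rw [pull_of_mem F hx]; exact key x hx _ C hC (b0 _)
  have e1 : ∀ x ∈ Ioo (-1 : ℝ) 1, |(1 - x ^ 2) ^ (1 + ε) * deriv (pull F) x| ≤ B * C := by
    intro x hx
    have hp := one_sub_sq_pos hx
    rw [(hasDerivAt_pull hx (h1 _)).deriv, Real.rpow_add hp, Real.rpow_one,
      show (1 - x ^ 2) * (1 - x ^ 2) ^ ε * (F₁ (Real.artanh x) * (1 - x ^ 2)⁻¹) =
      (1 - x ^ 2) ^ ε * F₁ (Real.artanh x) * ((1 - x ^ 2) * (1 - x ^ 2)⁻¹) by ring,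
      mul_inv_cancel₀ hp.ne', mul_one]
    exact key x hx _ C hC (b1 _)
  have e2 : ∀ x ∈ Ioo (-1 : ℝ) 1,
      |(1 - x ^ 2) ^ (2 + ε) * iteratedDeriv 2 (pull F) x| ≤ B * (3 * C) := by
    intro x hx
    have hp := one_sub_sq_pos hx
    rw [iteratedDeriv_two_pull isOpen_Ioo subset_rfl (fun x _ => h1 _) (fun x _ => h2 _) hx,
      Real.rpow_add hp, Real.rpow_two,
      show ∀ z : ℝ, (1 - x ^ 2) ^ 2 * (1 - x ^ 2) ^ ε * ((1 - x ^ 2)⁻¹ ^ 2 * z) =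
      (1 - x ^ 2) ^ ε * z * ((1 - x ^ 2) * (1 - x ^ 2)⁻¹) ^ 2 from fun z => by ring,
      mul_inv_cancel₀ hp.ne', one_pow, mul_one]
    refine key x hx _ (3 * C) (by positivity) ?_
    have hx1 : |x| ≤ 1 := abs_le.2 ⟨hx.1.le, hx.2.le⟩
    calc |F₂ (Real.artanh x) + 2 * x * F₁ (Real.artanh x)|
        ≤ |F₂ (Real.artanh x)| + 2 * |x| * |F₁ (Real.artanh x)| := by
          refine (abs_add_le _ _).trans ?_
          rw [abs_mul, abs_mul, abs_two]
      _ ≤ C * (1 + |Real.artanh x|) ^ 2 + 2 * 1 * (C * (1 + |Real.artanh x|) ^ 2) := by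
          gcongr
          · exact (b2 _).trans (le_mul_of_one_le_right hC (one_le _))
          · exact b1 _
      _ = _ := by ring
  have hmem : MemM2 ε (pull F) :=
    { zero_off := fun x hx => pull_of_notMem F hx
      c2 := contDiffOn_pull le_rfl le_rfl hcF.contDiffOn (mapsTo_univ _ _)
      bdd0 := ⟨_, e0⟩
      bdd1 := ⟨_, e1⟩
      bdd2 := ⟨_, e2⟩ }
  refine ⟨hmem, ?_⟩
  rw [M2.norm_def, M2.fn_of]
  have n0 := supNorm_le (by positivity) e0
  have n1 := supNorm_le (by positivity) e1
  have n2 := supNorm_le (by positivity) e2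
  linarith

/-! ## Elements of `X₁` from their derivatives -/

/-! ### Functions with integrable tails of order `(1 + |t|)⁻²` -/

theorem integrableOn_inv_sq_Ioi {t : ℝ} (ht : 0 ≤ t) :
    IntegrableOn (fun s : ℝ => ((1 + s) ^ 2)⁻¹) (Ioi t) ∧
      ∫ s in Ioi t, ((1 + s) ^ 2)⁻¹ = (1 + t)⁻¹ := by
  have hd : ∀ s ∈ Ici t, HasDerivAt (fun s : ℝ => -(1 + s)⁻¹) (((1 + s) ^ 2)⁻¹) s := by
    intro s hs
    have hne : 1 + s ≠ 0 := by have : t ≤ s := hs; exact (by linarith : 0 < 1 + s).ne'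
    refine (((hasDerivAt_id s).const_add 1).inv hne).neg.congr_deriv ?_
    simp only [id]
    field_simp
  have hl : Filter.Tendsto (fun s : ℝ => -(1 + s)⁻¹) Filter.atTop (𝓝 0) := by
    have : Filter.Tendsto (fun s : ℝ => 1 + s) Filter.atTop Filter.atTop :=
      Filter.tendsto_atTop_add_const_left _ _ Filter.tendsto_id
    simpa using this.inv_tendsto_atTop.neg
  have hn : ∀ s ∈ Ioi t, 0 ≤ ((1 + s) ^ 2)⁻¹ := fun s _ => by positivity
  refine ⟨integrableOn_Ioi_deriv_of_nonneg' hd hn hl, ?_⟩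
  rw [integral_Ioi_of_hasDerivAt_of_nonneg' hd hn hl]
  ring

theorem integrableOn_Ioi_of_sq_bound {y : ℝ → ℝ} (hy : Continuous y) {C : ℝ}
    (h : ∀ s, |y s| ≤ C * (1 + |s|)⁻¹ ^ 2) : IntegrableOn y (Ioi 0) := by
  refine Integrable.mono' ((integrableOn_inv_sq_Ioi le_rfl).1.const_mul C)
    hy.aestronglyMeasurable ?_
  refine (ae_restrict_mem measurableSet_Ioi).mono fun s hs => ?_
  simpa [abs_of_pos (mem_Ioi.1 hs)] using h s

theorem integrableOn_Iic_of_sq_bound {y : ℝ → ℝ} (hy : Continuous y) {C : ℝ}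
    (h : ∀ s, |y s| ≤ C * (1 + |s|)⁻¹ ^ 2) : IntegrableOn y (Iic 0) := by
  have h1 := integrableOn_Ioi_of_sq_bound (hy.comp continuous_neg)
    (fun s => by simpa using h (-s))
  rw [← neg_zero] at h1
  have h2 := ((integrableOn_Ici_iff_integrableOn_Ioi (by simp)).2 h1).comp_neg_Iic
  simpa [Function.comp_def] using h2

theorem abs_primitive_sub_limPlus_le {y : ℝ → ℝ} (hy : Continuous y) {C : ℝ}
    (h : ∀ s, |y s| ≤ C * (1 + |s|)⁻¹ ^ 2) {t : ℝ} (ht : 0 ≤ t) :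
    |(∫ s in (0 : ℝ)..t, y s) - limPlus y| ≤ C * (1 + |t|)⁻¹ := by
  have hi := integrableOn_Ioi_of_sq_bound hy h
  have h1 : limPlus y - ∫ s in (0 : ℝ)..t, y s = ∫ s in Ioi t, y s := by
    rw [limPlus, intervalIntegral.integral_Ioi_sub_Ioi hi ht |>.symm]
    ring
  obtain ⟨h2, h3⟩ := integrableOn_inv_sq_Ioi ht
  rw [abs_sub_comm, h1, abs_of_nonneg ht, ← h3, ← integral_const_mul, ← Real.norm_eq_abs]
  refine norm_integral_le_of_norm_le (h2.const_mul C) ?_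
  refine (ae_restrict_mem measurableSet_Ioi).mono fun s hs => ?_
  have : 0 < s := ht.trans_lt hs
  simpa [abs_of_pos this] using h s

theorem abs_primitive_sub_limMinus_le {y : ℝ → ℝ} (hy : Continuous y) {C : ℝ}
    (h : ∀ s, |y s| ≤ C * (1 + |s|)⁻¹ ^ 2) {t : ℝ} (ht : t ≤ 0) :
    |(∫ s in (0 : ℝ)..t, y s) - limMinus y| ≤ C * (1 + |t|)⁻¹ := by
  have h1 := abs_primitive_sub_limPlus_le (hy.comp continuous_neg)
    (fun s => by simpa using h (-s)) (neg_nonneg.2 ht)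
  rw [abs_neg] at h1
  have h3 : ∫ s in (0 : ℝ)..(-t), (y ∘ Neg.neg) s = -∫ s in (0 : ℝ)..t, y s := by
    simp only [Function.comp_def]
    rw [intervalIntegral.integral_comp_neg, neg_neg, neg_zero,
      ← intervalIntegral.integral_symm]
  rw [h3] at h1
  rw [limMinus_eq_neg_limPlus, ← abs_neg]
  refine le_trans (le_of_eq (congrArg _ ?_)) h1
  simp only [Function.comp_def]
  ring

/-! ### Cutoff functions -/

theorem hasDerivAt_smoothTransition (t : ℝ) :
    HasDerivAt Real.smoothTransition (deriv Real.smoothTransition t) t :=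
  ((Real.smoothTransition.contDiff (n := 1)).differentiable one_ne_zero t).hasDerivAt

theorem deriv_smoothTransition_eq_zero {t : ℝ} (ht : t ∉ Icc (0 : ℝ) 1) :
    deriv Real.smoothTransition t = 0 := by
  have key : ∀ c : ℝ, (∀ᶠ s in 𝓝 t, Real.smoothTransition s = c) →
      deriv Real.smoothTransition t = 0 := by
    intro c hc
    rw [Filter.EventuallyEq.deriv_eq hc, deriv_const]
  rcases lt_or_ge t 0 with h | h
  · exact key 0 ((gt_mem_nhds h).mono fun s hs =>
      Real.smoothTransition.zero_of_nonpos (le_of_lt hs))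
  · have h1 : 1 < t := not_le.1 fun h' => ht ⟨h, h'⟩
    exact key 1 ((lt_mem_nhds h1).mono fun s hs =>
      Real.smoothTransition.one_of_one_le (le_of_lt hs))

theorem continuous_deriv_smoothTransition : Continuous (deriv Real.smoothTransition) :=
  (Real.smoothTransition.contDiff (n := 1)).continuous_deriv_one

theorem exists_deriv_smoothTransition_bound :
    ∃ B : ℝ, 0 ≤ B ∧ ∀ t, |deriv Real.smoothTransition t| ≤ B := by
  obtain ⟨B, hB⟩ := (isCompact_Icc (a := (0 : ℝ)) (b := 1)).exists_bound_of_continuousOn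
    continuous_deriv_smoothTransition.continuousOn
  have hB0 : 0 ≤ B := (norm_nonneg _).trans (hB 0 (by norm_num))
  refine ⟨B, hB0, fun t => ?_⟩
  by_cases ht : t ∈ Icc (0 : ℝ) 1
  · exact hB t ht
  · rw [deriv_smoothTransition_eq_zero ht, abs_zero]; exact hB0

/-- The cutoff to `t ≥ 1`. -/
def cutP (t : ℝ) : ℝ := Real.smoothTransition (t - 1)

/-- The cutoff to `t ≤ -1`. -/
def cutM (t : ℝ) : ℝ := Real.smoothTransition (-t - 1)

/-- The derivative of `cutP`. -/
def cutP₁ (t : ℝ) : ℝ := deriv Real.smoothTransition (t - 1)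

/-- The derivative of `cutM`. -/
def cutM₁ (t : ℝ) : ℝ := -deriv Real.smoothTransition (-t - 1)

theorem hasDerivAt_cutP (t : ℝ) : HasDerivAt cutP (cutP₁ t) t := by
  have := (hasDerivAt_smoothTransition (t - 1)).comp t ((hasDerivAt_id t).sub_const 1)
  exact HasDerivAt.congr_deriv (f := cutP) this (by simp [cutP₁])

theorem hasDerivAt_cutM (t : ℝ) : HasDerivAt cutM (cutM₁ t) t := by
  have := (hasDerivAt_smoothTransition (-t - 1)).comp t ((hasDerivAt_id t).neg.sub_const 1)
  exact HasDerivAt.congr_deriv (f := cutM) this (by simp [cutM₁])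

theorem continuous_cutP : Continuous cutP :=
  continuous_iff_continuousAt.2 fun t => (hasDerivAt_cutP t).continuousAt

theorem continuous_cutM : Continuous cutM :=
  continuous_iff_continuousAt.2 fun t => (hasDerivAt_cutM t).continuousAt

theorem continuous_cutP₁ : Continuous cutP₁ :=
  continuous_deriv_smoothTransition.comp (by fun_prop)

theorem continuous_cutM₁ : Continuous cutM₁ :=
  (continuous_deriv_smoothTransition.comp (by fun_prop)).neg

theorem cutP_eq_zero {t : ℝ} (ht : t ≤ 1) : cutP t = 0 :=
  Real.smoothTransition.zero_of_nonpos (by linarith)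

theorem cutM_eq_zero {t : ℝ} (ht : -1 ≤ t) : cutM t = 0 :=
  Real.smoothTransition.zero_of_nonpos (by linarith)

theorem cutP_nonneg (t : ℝ) : 0 ≤ cutP t := Real.smoothTransition.nonneg _
theorem cutM_nonneg (t : ℝ) : 0 ≤ cutM t := Real.smoothTransition.nonneg _
theorem cutP_le_one (t : ℝ) : cutP t ≤ 1 := Real.smoothTransition.le_one _
theorem cutM_le_one (t : ℝ) : cutM t ≤ 1 := Real.smoothTransition.le_one _

/-- The cutoff to a neighbourhood of `0`. -/
def cut (t : ℝ) : ℝ := 1 - cutP t - cutM t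

theorem abs_cut_le_one (t : ℝ) : |cut t| ≤ 1 := by
  have h1 := cutP_nonneg t
  have h2 := cutM_nonneg t
  have h3 := cutP_le_one t
  have h4 := cutM_le_one t
  unfold cut
  rcases le_total t 1 with h | h
  · rw [cutP_eq_zero h]; exact abs_le.2 ⟨by linarith, by linarith⟩
  · rw [cutM_eq_zero (by linarith : -1 ≤ t)]; exact abs_le.2 ⟨by linarith, by linarith⟩

theorem cut_eq_zero {t : ℝ} (ht : 2 < |t|) : cut t = 0 := by
  rcases lt_abs.1 ht with h | h
  · rw [cut, cutM_eq_zero (by linarith), cutP, Real.smoothTransition.one_of_one_le (by linarith)]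
    norm_num
  · rw [cut, cutP_eq_zero (by linarith), cutM, Real.smoothTransition.one_of_one_le (by linarith)]
    norm_num

theorem cut_eq_one {t : ℝ} (ht : t ∈ Icc (-1 : ℝ) 1) : cut t = 1 := by
  rw [cut, cutM_eq_zero ht.1, cutP_eq_zero ht.2]; norm_num

theorem abs_primitive_le_of_abs_le_two {f : ℝ → ℝ} {C : ℝ} (h : ∀ s, |s| ≤ 2 → |f s| ≤ C) {t : ℝ}
    (ht : |t| ≤ 2) : |∫ s in (0 : ℝ)..t, f s| ≤ 2 * C := by
  have hC : 0 ≤ C := (abs_nonneg _).trans (h 0 (by simp))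
  have := intervalIntegral.norm_integral_le_of_norm_le_const (a := 0) (b := t) (f := f) (C := C)
    fun s hs => h s (by
      obtain ⟨h1, h2⟩ := abs_le.1 ht
      rcases le_total 0 t with h' | h'
      · rw [uIoc_of_le h'] at hs; exact abs_le.2 ⟨by linarith [hs.1], by linarith [hs.2]⟩
      · rw [uIoc_of_ge h'] at hs; exact abs_le.2 ⟨by linarith [hs.1], by linarith [hs.2]⟩)
  rw [sub_zero, Real.norm_eq_abs] at this
  nlinarith

/-! ### The `θ`-component -/

/-- The data `F''(0)`, `F'''`, `(1 + |t|)² F'` of the `θ`-component. -/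
abbrev DataT : Type := ℝ × BC × BC

/-- `F''` near `0`. -/
def loc₂ (d : DataT) (t : ℝ) : ℝ := d.1 + ∫ s in (0 : ℝ)..t, d.2.1 s

/-- `F'` near `0`. -/
def loc₁ (d : DataT) (t : ℝ) : ℝ := ∫ s in (0 : ℝ)..t, loc₂ d s

/-- `F` near `0`. -/
def loc (d : DataT) (t : ℝ) : ℝ := ∫ s in (0 : ℝ)..t, loc₁ d s

/-- `F'` away from `0`. -/
def far₁ (d : DataT) : BC := invW ^ 2 * d.2.2

/-- `F - F(0)` away from `0`. -/
def far (d : DataT) (t : ℝ) : ℝ := ∫ s in (0 : ℝ)..t, far₁ d s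

/-- The function with given data. -/
def glue (d : DataT) (t : ℝ) : ℝ :=
  cut t * loc d t + cutP t * (far d t - limPlus (far₁ d)) + cutM t * (far d t - limMinus (far₁ d))

/-- The derivative of `glue`. -/
def glue₁ (d : DataT) (t : ℝ) : ℝ :=
  cut t * loc₁ d t + (cutP t + cutM t) * far₁ d t +
    (cutP₁ t * (far d t - limPlus (far₁ d) - loc d t) +
      cutM₁ t * (far d t - limMinus (far₁ d) - loc d t))

theorem hasDerivAt_loc₂ (d : DataT) (t : ℝ) : HasDerivAt (loc₂ d) (d.2.1 t) t :=
  (hasDerivAt_primitive d.2.1.continuous t).const_add _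

theorem continuous_loc₂ (d : DataT) : Continuous (loc₂ d) :=
  continuous_iff_continuousAt.2 fun t => (hasDerivAt_loc₂ d t).continuousAt

theorem hasDerivAt_loc₁ (d : DataT) (t : ℝ) : HasDerivAt (loc₁ d) (loc₂ d t) t :=
  hasDerivAt_primitive (continuous_loc₂ d) t

theorem continuous_loc₁ (d : DataT) : Continuous (loc₁ d) :=
  continuous_iff_continuousAt.2 fun t => (hasDerivAt_loc₁ d t).continuousAt

theorem hasDerivAt_loc (d : DataT) (t : ℝ) : HasDerivAt (loc d) (loc₁ d t) t :=
  hasDerivAt_primitive (continuous_loc₁ d) t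

theorem continuous_loc (d : DataT) : Continuous (loc d) :=
  continuous_iff_continuousAt.2 fun t => (hasDerivAt_loc d t).continuousAt

theorem hasDerivAt_far (d : DataT) (t : ℝ) : HasDerivAt (far d) (far₁ d t) t :=
  hasDerivAt_primitive (far₁ d).continuous t

theorem continuous_far (d : DataT) : Continuous (far d) :=
  continuous_iff_continuousAt.2 fun t => (hasDerivAt_far d t).continuousAt

theorem abs_far₁_le (d : DataT) (t : ℝ) : |far₁ d t| ≤ ‖d‖ * (1 + |t|)⁻¹ ^ 2 := by
  rw [far₁, BC.mul_apply, BC.pow_apply, invW_apply, abs_mul, abs_of_nonneg (sq_nonneg _), mul_comm]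
  gcongr
  exact (d.2.2.abs_le t).trans ((norm_snd_le d.2).trans (norm_snd_le d))

theorem hasDerivAt_glue (d : DataT) (t : ℝ) : HasDerivAt (glue d) (glue₁ d t) t := by
  have hP := hasDerivAt_cutP t
  have hM := hasDerivAt_cutM t
  have h1 := (((hP.const_sub 1).sub hM).mul (hasDerivAt_loc d t)).add
    (hP.mul ((hasDerivAt_far d t).sub_const (limPlus (far₁ d)))) |>.add
    (hM.mul ((hasDerivAt_far d t).sub_const (limMinus (far₁ d))))
  refine HasDerivAt.congr_deriv h1 ?_
  simp only [glue₁, cut, Pi.sub_apply]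
  ring

theorem continuous_glue₁ (d : DataT) : Continuous (glue₁ d) := by
  have := continuous_cutP
  have := continuous_cutM
  have := continuous_cutP₁
  have := continuous_cutM₁
  have := continuous_loc d
  have := continuous_loc₁ d
  have := continuous_far d
  have := (far₁ d).continuous
  unfold glue₁ cut
  fun_prop

theorem abs_loc_le (d : DataT) {t : ℝ} (ht : |t| ≤ 2) :
    |loc₂ d t| ≤ 3 * ‖d‖ ∧ |loc₁ d t| ≤ 6 * ‖d‖ ∧ |loc d t| ≤ 12 * ‖d‖ := by
  have h2 : ∀ t, |t| ≤ 2 → |loc₂ d t| ≤ 3 * ‖d‖ := fun t ht => by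
    have h1 := abs_primitive_le_of_abs_le_two (f := d.2.1) (C := ‖d‖) (fun s _ =>
      (d.2.1.abs_le s).trans ((norm_fst_le d.2).trans (norm_snd_le d))) ht
    have h0 : |d.1| ≤ ‖d‖ := norm_fst_le d
    calc |loc₂ d t| ≤ |d.1| + |∫ s in (0 : ℝ)..t, d.2.1 s| := abs_add_le _ _
      _ ≤ _ := by linarith
  have h1 : ∀ t, |t| ≤ 2 → |loc₁ d t| ≤ 6 * ‖d‖ := fun t ht =>
    (abs_primitive_le_of_abs_le_two h2 ht).trans (by linarith)
  exact ⟨h2 t ht, h1 t ht, (abs_primitive_le_of_abs_le_two h1 ht).trans (by linarith)⟩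

theorem one_le_three_mul_inv {t : ℝ} (ht : |t| ≤ 2) : 1 ≤ 3 * (1 + |t|)⁻¹ := by
  rw [← div_eq_mul_inv, le_div_iff₀ (one_add_abs_pos t)]
  linarith

theorem one_le_nine_mul_inv_sq {t : ℝ} (ht : |t| ≤ 2) : 1 ≤ 9 * (1 + |t|)⁻¹ ^ 2 := by
  nlinarith [one_le_three_mul_inv ht]

theorem abs_far_sub_limPlus_le (d : DataT) {t : ℝ} (ht : 0 ≤ t) :
    |far d t - limPlus (far₁ d)| ≤ ‖d‖ * (1 + |t|)⁻¹ :=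
  abs_primitive_sub_limPlus_le (far₁ d).continuous (abs_far₁_le d) ht

theorem abs_far_sub_limMinus_le (d : DataT) {t : ℝ} (ht : t ≤ 0) :
    |far d t - limMinus (far₁ d)| ≤ ‖d‖ * (1 + |t|)⁻¹ :=
  abs_primitive_sub_limMinus_le (far₁ d).continuous (abs_far₁_le d) ht

/-- The local part is at most `12 ‖d‖` and lives on `|t| ≤ 2`, where `1 ≤ 3 (1 + |t|)⁻¹`; this gives
`36`. Each of the two tails contributes `1`, since integrating `(1 + s)⁻²` from infinity yields `(1
+ |t|)⁻¹`. -/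
theorem abs_glue_le (d : DataT) (t : ℝ) : |glue d t| ≤ 38 * ‖d‖ * (1 + |t|)⁻¹ := by
  have hD := norm_nonneg d
  have he := inv_pos.2 (one_add_abs_pos t)
  have h1 : |cut t * loc d t| ≤ 36 * ‖d‖ * (1 + |t|)⁻¹ := by
    by_cases ht : |t| ≤ 2
    · rw [abs_mul]
      calc |cut t| * |loc d t| ≤ 1 * (12 * ‖d‖) :=
            mul_le_mul (abs_cut_le_one t) (abs_loc_le d ht).2.2 (abs_nonneg _) zero_le_one
        _ ≤ 12 * ‖d‖ * (3 * (1 + |t|)⁻¹) := by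
            rw [one_mul]; exact le_mul_of_one_le_right (by positivity) (one_le_three_mul_inv ht)
        _ = _ := by ring
    · rw [cut_eq_zero (not_le.1 ht), zero_mul, abs_zero]; positivity
  have h2 : |cutP t * (far d t - limPlus (far₁ d))| ≤ ‖d‖ * (1 + |t|)⁻¹ := by
    rcases le_total t 1 with ht | ht
    · rw [cutP_eq_zero ht, zero_mul, abs_zero]; positivity
    · rw [abs_mul, abs_of_nonneg (cutP_nonneg t)]
      exact (mul_le_of_le_one_left (abs_nonneg _) (cutP_le_one t)).trans
        (abs_far_sub_limPlus_le d (by linarith))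
  have h3 : |cutM t * (far d t - limMinus (far₁ d))| ≤ ‖d‖ * (1 + |t|)⁻¹ := by
    rcases le_total (-1) t with ht | ht
    · rw [cutM_eq_zero ht, zero_mul, abs_zero]; positivity
    · rw [abs_mul, abs_of_nonneg (cutM_nonneg t)]
      exact (mul_le_of_le_one_left (abs_nonneg _) (cutM_le_one t)).trans
        (abs_far_sub_limMinus_le d (by linarith))
  calc |glue d t| ≤ _ := (abs_add_le _ _).trans (add_le_add_left (abs_add_le _ _) _)
    _ ≤ _ := by linarith

/-- With `B` a bound for the derivative of the cutoff, `K = 54 + 2 + 2 · 117 B`: the local part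
gives `6 · 9`, the far part `2`, and each cutoff derivative `13 · 9 B`, its support lying in `1 ≤
|t| ≤ 2`. The condition `38 ≤ K` lets one constant serve for `glue` as well. -/
theorem exists_abs_glue₁_le : ∃ K : ℝ, 38 ≤ K ∧ ∀ (d : DataT) (t : ℝ),
    |glue₁ d t| ≤ K * ‖d‖ * (1 + |t|)⁻¹ ^ 2 := by
  obtain ⟨B, hB0, hB⟩ := exists_deriv_smoothTransition_bound
  refine ⟨56 + 234 * B, by linarith, fun d t => ?_⟩
  have hD := norm_nonneg d
  have he := inv_pos.2 (one_add_abs_pos t)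
  have h1 : |cut t * loc₁ d t| ≤ 54 * ‖d‖ * (1 + |t|)⁻¹ ^ 2 := by
    by_cases ht : |t| ≤ 2
    · rw [abs_mul]
      calc |cut t| * |loc₁ d t| ≤ 1 * (6 * ‖d‖) :=
            mul_le_mul (abs_cut_le_one t) (abs_loc_le d ht).2.1 (abs_nonneg _) zero_le_one
        _ ≤ 6 * ‖d‖ * (9 * (1 + |t|)⁻¹ ^ 2) := by
            rw [one_mul]; exact le_mul_of_one_le_right (by positivity) (one_le_nine_mul_inv_sq ht)
        _ = _ := by ring
    · rw [cut_eq_zero (not_le.1 ht), zero_mul, abs_zero]; positivity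
  have h2 : |(cutP t + cutM t) * far₁ d t| ≤ 2 * ‖d‖ * (1 + |t|)⁻¹ ^ 2 := by
    have ha := cutP_nonneg t
    have hb := cutM_nonneg t
    rw [abs_mul, abs_of_nonneg (by positivity)]
    calc (cutP t + cutM t) * |far₁ d t| ≤ (1 + 1) * (‖d‖ * (1 + |t|)⁻¹ ^ 2) := by
          gcongr
          · exact cutP_le_one t
          · exact cutM_le_one t
          · exact abs_far₁_le d t
      _ = _ := by ring
  have aux : ∀ L : ℝ, |t| ≤ 2 → |far d t - L| ≤ ‖d‖ * (1 + |t|)⁻¹ → ∀ c : ℝ, |c| ≤ B →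
      |c * (far d t - L - loc d t)| ≤ 117 * B * ‖d‖ * (1 + |t|)⁻¹ ^ 2 := by
    intro L ht hL c hc
    have hL' : |far d t - L| ≤ ‖d‖ :=
      hL.trans (mul_le_of_le_one_right hD (inv_one_add_abs_le_one t))
    rw [abs_mul]
    calc |c| * |far d t - L - loc d t| ≤ B * (‖d‖ + 12 * ‖d‖) := by
          gcongr
          exact (abs_sub _ _).trans (add_le_add hL' (abs_loc_le d ht).2.2)
      _ = 13 * B * ‖d‖ := by ring
      _ ≤ 13 * B * ‖d‖ * (9 * (1 + |t|)⁻¹ ^ 2) :=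
          le_mul_of_one_le_right (by positivity) (one_le_nine_mul_inv_sq ht)
      _ = _ := by ring
  have h3 : |cutP₁ t * (far d t - limPlus (far₁ d) - loc d t)| ≤
      117 * B * ‖d‖ * (1 + |t|)⁻¹ ^ 2 := by
    by_cases ht : t - 1 ∈ Icc (0 : ℝ) 1
    · have h0 : 0 ≤ t := by linarith [ht.1]
      exact aux _ (by rw [abs_of_nonneg h0]; linarith [ht.2]) (abs_far_sub_limPlus_le d h0) _ (hB _)
    · rw [cutP₁, deriv_smoothTransition_eq_zero ht, zero_mul, abs_zero]; positivity
  have h4 : |cutM₁ t * (far d t - limMinus (far₁ d) - loc d t)| ≤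
      117 * B * ‖d‖ * (1 + |t|)⁻¹ ^ 2 := by
    by_cases ht : -t - 1 ∈ Icc (0 : ℝ) 1
    · have h0 : t ≤ 0 := by linarith [ht.1]
      exact aux _ (by rw [abs_of_nonpos h0]; linarith [ht.2]) (abs_far_sub_limMinus_le d h0) _
        (by rw [cutM₁, abs_neg]; exact hB _)
    · rw [cutM₁, deriv_smoothTransition_eq_zero ht, neg_zero, zero_mul, abs_zero]; positivity
  calc |glue₁ d t| ≤ _ := (abs_add_le _ _).trans (add_le_add (abs_add_le _ _) (abs_add_le _ _))
    _ ≤ 54 * ‖d‖ * (1 + |t|)⁻¹ ^ 2 + 2 * ‖d‖ * (1 + |t|)⁻¹ ^ 2 +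
        (117 * B * ‖d‖ * (1 + |t|)⁻¹ ^ 2 + 117 * B * ‖d‖ * (1 + |t|)⁻¹ ^ 2) :=
        add_le_add (add_le_add h1 h2) (add_le_add h3 h4)
    _ = _ := by ring

theorem glue₁_eq_loc₁ (d : DataT) {t : ℝ} (ht : t ∈ Ioo (-1 : ℝ) 1) : glue₁ d t = loc₁ d t := by
  have h1 : t - 1 ∉ Icc (0 : ℝ) 1 := fun h => by linarith [h.1, ht.2]
  have h2 : -t - 1 ∉ Icc (0 : ℝ) 1 := fun h => by linarith [h.1, ht.1]
  rw [glue₁, cut_eq_one (Ioo_subset_Icc_self ht), cutP_eq_zero ht.2.le, cutM_eq_zero ht.1.le,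
    cutP₁, cutM₁, deriv_smoothTransition_eq_zero h1, deriv_smoothTransition_eq_zero h2]
  ring

/-- The estimate holds for all data, even if the three components do not come from one function. So
`glue` is a bounded linear map on a whole Banach space, and smoothness of the data in the parameters
passes to `M₁`. -/
theorem exists_glue_bound : ∃ K : ℝ, ∀ d : DataT,
    ∃ h : MemM1 (pull (glue d)), ‖M1.of (pull (glue d)) h‖ ≤ K * ‖d‖ := by
  obtain ⟨K, hK, hb⟩ := exists_abs_glue₁_le
  refine ⟨50 * K, fun d => ?_⟩
  have hD := norm_nonneg d
  have hKD : 38 * ‖d‖ ≤ K * ‖d‖ := by gcongr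
  have h2 : ∀ t ∈ Ioo (-1 : ℝ) 1, HasDerivAt (glue₁ d) (loc₂ d t) t := fun t ht =>
    (hasDerivAt_loc₁ d t).congr_of_eventuallyEq (by
      filter_upwards [isOpen_Ioo.mem_nhds ht] with s hs using glue₁_eq_loc₁ d hs)
  have habs : ∀ t ∈ Ioo (-1 : ℝ) 1, |t| ≤ 2 := fun t ht =>
    abs_le.2 ⟨by linarith [ht.1], by linarith [ht.2]⟩
  obtain ⟨h, hn⟩ := exists_M1_pull (C := K * ‖d‖) (hasDerivAt_glue d) (continuous_glue₁ d) h2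
    (fun t _ => hasDerivAt_loc₂ d t) d.2.1.continuous.continuousOn
    (fun t => (abs_glue_le d t).trans (by
      have := inv_pos.2 (one_add_abs_pos t)
      gcongr))
    (hb d) (fun t ht => (abs_loc_le d (habs t ht)).1.trans (by linarith))
    (fun t _ => (d.2.1.abs_le t).trans
      (((norm_fst_le d.2).trans (norm_snd_le d)).trans (by linarith)))
  exact ⟨h, hn.trans (by linarith)⟩

theorem far₁_add (c d : DataT) : far₁ (c + d) = far₁ c + far₁ d := by
  simp [far₁, mul_add]

theorem far₁_smul (r : ℝ) (d : DataT) : far₁ (r • d) = r • far₁ d := by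
  simp [far₁]

theorem glue_add (c d : DataT) : glue (c + d) = fun t => glue c t + glue d t := by
  have h2 : ∀ t, loc₂ (c + d) t = loc₂ c t + loc₂ d t := fun t => by
    simp only [loc₂, Prod.fst_add, Prod.snd_add, BC.add_apply]
    rw [intervalIntegral.integral_add (c.2.1.continuous.intervalIntegrable _ _)
      (d.2.1.continuous.intervalIntegrable _ _)]
    ring
  have h1 : ∀ t, loc₁ (c + d) t = loc₁ c t + loc₁ d t := fun t => by
    simp only [loc₁, h2]
    exact intervalIntegral.integral_add ((continuous_loc₂ c).intervalIntegrable _ _)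
      ((continuous_loc₂ d).intervalIntegrable _ _)
  have h0 : ∀ t, loc (c + d) t = loc c t + loc d t := fun t => by
    simp only [loc, h1]
    exact intervalIntegral.integral_add ((continuous_loc₁ c).intervalIntegrable _ _)
      ((continuous_loc₁ d).intervalIntegrable _ _)
  have hf : ∀ t, far (c + d) t = far c t + far d t := fun t => by
    simp only [far, far₁_add, BC.add_apply]
    exact intervalIntegral.integral_add ((far₁ c).continuous.intervalIntegrable _ _)
      ((far₁ d).continuous.intervalIntegrable _ _)
  have hp : limPlus (far₁ (c + d)) = limPlus (far₁ c) + limPlus (far₁ d) := by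
    rw [far₁_add]
    exact limPlus_add (integrableOn_Ioi_of_sq_bound (far₁ c).continuous (abs_far₁_le c))
      (integrableOn_Ioi_of_sq_bound (far₁ d).continuous (abs_far₁_le d))
  have hm : limMinus (far₁ (c + d)) = limMinus (far₁ c) + limMinus (far₁ d) := by
    rw [far₁_add]
    exact limMinus_add (integrableOn_Iic_of_sq_bound (far₁ c).continuous (abs_far₁_le c))
      (integrableOn_Iic_of_sq_bound (far₁ d).continuous (abs_far₁_le d))
  ext t
  simp only [glue, h0, hf, hp, hm]
  ring

theorem glue_smul (r : ℝ) (d : DataT) : glue (r • d) = fun t => r * glue d t := by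
  have h2 : ∀ t, loc₂ (r • d) t = r * loc₂ d t := fun t => by
    simp only [loc₂, Prod.smul_fst, Prod.smul_snd, BC.smul_apply, smul_eq_mul,
      intervalIntegral.integral_const_mul]
    ring
  have h1 : ∀ t, loc₁ (r • d) t = r * loc₁ d t := fun t => by
    simp only [loc₁, h2, intervalIntegral.integral_const_mul]
  have h0 : ∀ t, loc (r • d) t = r * loc d t := fun t => by
    simp only [loc, h1, intervalIntegral.integral_const_mul]
  have hf : ∀ t, far (r • d) t = r * far d t := fun t => by
    simp only [far, far₁_smul, BC.smul_apply, intervalIntegral.integral_const_mul]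
  have hp : limPlus (far₁ (r • d)) = r * limPlus (far₁ d) := by
    rw [far₁_smul]; exact limPlus_smul r _
  have hm : limMinus (far₁ (r • d)) = r * limMinus (far₁ d) := by
    rw [far₁_smul]; exact limMinus_smul r _
  ext t
  simp only [glue, h0, hf, hp, hm]
  ring

/-- A function which vanishes at `±∞` is recovered from its data. -/
theorem eq_cut_add_glue {F F₁ F₂ : ℝ → ℝ} {k₃ k : BC} (h1 : ∀ t, HasDerivAt F (F₁ t) t)
    (h2 : ∀ t, HasDerivAt F₁ (F₂ t) t) (h3 : ∀ t, HasDerivAt F₂ (k₃ t) t)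
    (hk : ∀ t, F₁ t = (invW ^ 2 * k) t) (hp : Filter.Tendsto F Filter.atTop (𝓝 0))
    (hm : Filter.Tendsto F Filter.atBot (𝓝 0)) (t : ℝ) :
    F t = cut t * (F 0 + F₁ 0 * t) + glue (F₂ 0, k₃, k) t := by
  set d : DataT := (F₂ 0, k₃, k)
  have e2 : ∀ t, F₂ t = loc₂ d t := eq_add_primitive h3 k₃.continuous
  have e1 : ∀ t, F₁ t = F₁ 0 + loc₁ d t := fun t => by
    rw [eq_add_primitive h2 (by rw [funext e2]; exact continuous_loc₂ d) t, funext e2]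
    rfl
  have e0 : ∀ t, F t = F 0 + F₁ 0 * t + loc d t := fun t => by
    have hc : Continuous F₁ := continuous_iff_continuousAt.2 fun t => (h2 t).continuousAt
    rw [eq_add_primitive h1 hc t]
    rw [intervalIntegral.integral_congr (g := fun s => F₁ 0 + loc₁ d s) (fun s _ => e1 s)]
    rw [intervalIntegral.integral_add (by simp) ((continuous_loc₁ d).intervalIntegrable _ _)]
    simp only [intervalIntegral.integral_const, smul_eq_mul, loc]
    ring
  have ef : ∀ t, far d t = F t - F 0 := fun t => by
    have := eq_add_primitive (F := F) (f := far₁ d)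
      (fun t => (h1 t).congr_deriv (hk t)) (far₁ d).continuous t
    rw [this, far]; ring
  -- As `F` vanishes at `+∞`, its derivative integrates to `-F(0)` over the half-line, so the far
  -- part `far d - limPlus (far₁ d)` is `F` itself. The same happens at `-∞`.
  have lp : limPlus (far₁ d) = -F 0 := by
    have ha := tendsto_primitive_limPlus
      (integrableOn_Ioi_of_sq_bound (far₁ d).continuous (abs_far₁_le d))
    have hb : Filter.Tendsto (fun t => ∫ s in (0 : ℝ)..t, far₁ d s) Filter.atTop (𝓝 (0 - F 0)) :=
      (hp.sub_const (F 0)).congr fun t => (ef t).symm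
    rw [tendsto_nhds_unique ha hb, zero_sub]
  have lm : limMinus (far₁ d) = -F 0 := by
    have ha := tendsto_primitive_limMinus
      (integrableOn_Iic_of_sq_bound (far₁ d).continuous (abs_far₁_le d))
    have hb : Filter.Tendsto (fun t => ∫ s in (0 : ℝ)..t, far₁ d s) Filter.atBot (𝓝 (0 - F 0)) :=
      (hm.sub_const (F 0)).congr fun t => (ef t).symm
    rw [tendsto_nhds_unique ha hb, zero_sub]
  have hl : loc d t = F t - (F 0 + F₁ 0 * t) := by rw [e0 t]; ring
  rw [glue, ef, lp, lm, hl, cut]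
  ring

/-! ### The `φ`-component -/

/-- The primitive of a function in `BC`. -/
def prim (k : BC) (t : ℝ) : ℝ := ∫ s in (0 : ℝ)..t, k s

/-- The second primitive of a function in `BC`. -/
def prim₂ (k : BC) (t : ℝ) : ℝ := ∫ s in (0 : ℝ)..t, prim k s

theorem hasDerivAt_prim (k : BC) (t : ℝ) : HasDerivAt (prim k) (k t) t :=
  hasDerivAt_primitive k.continuous t

theorem continuous_prim (k : BC) : Continuous (prim k) := continuous_primitive_zero k.continuous

theorem hasDerivAt_prim₂ (k : BC) (t : ℝ) : HasDerivAt (prim₂ k) (prim k t) t :=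
  hasDerivAt_primitive (continuous_prim k) t

theorem abs_prim_le (k : BC) (t : ℝ) : |prim k t| ≤ ‖k‖ * |t| := by
  have := intervalIntegral.norm_integral_le_of_norm_le_const (a := 0) (b := t) (f := k)
    (C := ‖k‖) fun s _ => k.abs_le s
  rwa [sub_zero] at this

theorem abs_prim₂_le (k : BC) (t : ℝ) : |prim₂ k t| ≤ ‖k‖ * |t| * |t| := by
  have := intervalIntegral.norm_integral_le_of_norm_le_const (a := 0) (b := t) (f := prim k)
    (C := ‖k‖ * |t|) fun s hs => (abs_prim_le k s).trans (by
      have : |s| ≤ |t| := by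
        rcases le_total 0 t with ht | ht
        · rw [uIoc_of_le ht] at hs
          rw [abs_of_pos hs.1, abs_of_nonneg ht]; exact hs.2
        · rw [uIoc_of_ge ht] at hs
          rw [abs_of_nonpos hs.2, abs_of_nonpos ht]; linarith [hs.1]
      gcongr)
  rwa [sub_zero] at this

theorem exists_prim₂_bound {ε : ℝ} (hε : 0 < ε) (hε1 : ε < 1) (k : BC) :
    ∃ h : MemM2 ε (pull (prim₂ k)),
      ‖M2.of (pull (prim₂ k)) h‖ ≤ 5 * (4 * (1 + 1 / ε) ^ 2) * ‖k‖ := by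
  have hk := norm_nonneg k
  refine exists_M2_pull hε hε1 (hasDerivAt_prim₂ k) (hasDerivAt_prim k) k.continuous
    (fun t => (abs_prim₂_le k t).trans ?_) (fun t => (abs_prim_le k t).trans ?_) k.abs_le
  · have := abs_nonneg t
    rw [mul_assoc]
    gcongr
    nlinarith
  · have := abs_nonneg t
    gcongr
    nlinarith

theorem prim₂_add (k l : BC) : prim₂ (k + l) = fun t => prim₂ k t + prim₂ l t := by
  have h1 : ∀ t, prim (k + l) t = prim k t + prim l t := fun t => by
    simp only [prim, BC.add_apply]
    exact intervalIntegral.integral_add (k.continuous.intervalIntegrable _ _)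
      (l.continuous.intervalIntegrable _ _)
  ext t
  simp only [prim₂, h1]
  exact intervalIntegral.integral_add ((continuous_prim k).intervalIntegrable _ _)
    ((continuous_prim l).intervalIntegrable _ _)

theorem prim₂_smul (r : ℝ) (k : BC) : prim₂ (r • k) = fun t => r * prim₂ k t := by
  ext t
  simp only [prim₂, prim, BC.smul_apply, intervalIntegral.integral_const_mul]

/-! ### The operator into `X₁` -/

/-- The data of both components. -/
abbrev Data : Type := DataT × BC

/-- The element of `X` with given data. -/
def ofData {ε : ℝ} (hε : 0 < ε) (hε1 : ε < 1) (d : Data) : X ε :=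
  WithLp.toLp 1 (M1.of (pull (glue d.1)) (exists_glue_bound.choose_spec d.1).choose,
    M2.of (pull (prim₂ d.2)) (exists_prim₂_bound hε hε1 d.2).choose)

theorem glue_zero (d : DataT) : glue d 0 = 0 := by
  rw [glue, cutP_eq_zero zero_le_one, cutM_eq_zero (by norm_num), loc]
  simp

theorem artanh_zero_mem : (0 : ℝ) ∈ Ioo (-1 : ℝ) 1 := by norm_num

theorem pull_zero (F : ℝ → ℝ) : pull F 0 = F 0 := by
  rw [pull_of_mem F artanh_zero_mem, Real.artanh_zero]

theorem deriv_pull_zero {F F₁ : ℝ → ℝ} (h : ∀ t, HasDerivAt F (F₁ t) t) :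
    deriv (pull F) 0 = F₁ 0 := by
  rw [(hasDerivAt_pull artanh_zero_mem (h _)).deriv, Real.artanh_zero]; norm_num

theorem ofData_mem {ε : ℝ} (hε : 0 < ε) (hε1 : ε < 1) (d : Data) : ofData hε hε1 d ∈ X1 ε := by
  refine ⟨⟨⟨?_, ?_⟩, ?_⟩, ?_⟩
  · change pull (glue d.1) 0 = 0
    rw [pull_zero, glue_zero]
  · change deriv (pull (glue d.1)) 0 = 0
    rw [deriv_pull_zero (hasDerivAt_glue d.1), glue₁_eq_loc₁ d.1 artanh_zero_mem]
    simp [loc₁]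
  · change deriv (pull (prim₂ d.2)) 0 = 0
    rw [deriv_pull_zero (hasDerivAt_prim₂ d.2)]
    simp [prim]
  · change pull (prim₂ d.2) 0 = 0
    rw [pull_zero]
    simp [prim₂]

/-- The bounded operator from data to `X₁`. -/
def dataOp {ε : ℝ} (hε : 0 < ε) (hε1 : ε < 1) : Data →L[ℝ] X1 ε :=
  LinearMap.mkContinuous
    { toFun := fun d => ⟨ofData hε hε1 d, ofData_mem hε hε1 d⟩
      map_add' := fun c d => by
        refine Subtype.ext ?_
        refine congrArg (WithLp.toLp 1) (Prod.ext (M1.ext ?_) (M2.ext ?_))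
        · change pull (glue (c.1 + d.1)) = pull (glue c.1) + pull (glue d.1)
          rw [glue_add, pull_add]
        · change pull (prim₂ (c.2 + d.2)) = pull (prim₂ c.2) + pull (prim₂ d.2)
          rw [prim₂_add, pull_add]
      map_smul' := fun r d => by
        refine Subtype.ext ?_
        refine congrArg (WithLp.toLp 1) (Prod.ext (M1.ext ?_) (M2.ext ?_))
        · change pull (glue (r • d.1)) = r • pull (glue d.1)
          rw [glue_smul, pull_smul]
        · change pull (prim₂ (r • d.2)) = r • pull (prim₂ d.2)
          rw [prim₂_smul, pull_smul] }
    (max exists_glue_bound.choose 0 + 5 * (4 * (1 + 1 / ε) ^ 2)) fun d => by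
    change ‖ofData hε hε1 d‖ ≤ _
    rw [X.norm_eq, add_mul]
    refine add_le_add ?_ ?_
    · refine (exists_glue_bound.choose_spec d.1).choose_spec.trans ?_
      have := norm_fst_le d
      gcongr
      exact le_max_left _ _
    · refine (exists_prim₂_bound hε hε1 d.2).choose_spec.trans ?_
      have := norm_snd_le d
      gcongr

theorem dataOp_θ {ε : ℝ} (hε : 0 < ε) (hε1 : ε < 1) (d : Data) :
    X.θ (dataOp hε hε1 d : X ε) = pull (glue d.1) := rfl

theorem dataOp_φ {ε : ℝ} (hε : 0 < ε) (hε1 : ε < 1) (d : Data) :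
    X.φ (dataOp hε hε1 d : X ε) = pull (prim₂ d.2) := rfl

/-! ## The solutions without swirl -/

/-! ### Riccati equations and linear equations -/

theorem isLinSol_exp {Φ R : ℝ → ℝ} (h : ∀ t, HasDerivAt Φ (R t - Φ t ^ 2 / 2) t) :
    IsLinSol (fun t => R t / 2) (fun t => Real.exp ((∫ s in (0 : ℝ)..t, Φ s) / 2))
      (fun t => Φ t / 2 * Real.exp ((∫ s in (0 : ℝ)..t, Φ s) / 2)) := by
  have hc : Continuous Φ := continuous_iff_continuousAt.2 fun t => (h t).continuousAt
  have hd : ∀ t, HasDerivAt (fun t => Real.exp ((∫ s in (0 : ℝ)..t, Φ s) / 2))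
      (Φ t / 2 * Real.exp ((∫ s in (0 : ℝ)..t, Φ s) / 2)) t := fun t =>
    ((hasDerivAt_primitive hc t).div_const 2).exp.congr_deriv (by ring)
  refine ⟨hd, fun t => ?_, by simp⟩
  exact (((h t).div_const 2).mul (hd t)).congr_deriv (by ring)

theorem IsLinSol.hasDerivAt_ratio {R Z Z₁ : ℝ → ℝ} (h : IsLinSol (fun t => R t / 2) Z Z₁)
    (hpos : ∀ t, 0 < Z t) (t : ℝ) :
    HasDerivAt (fun t => 2 * Z₁ t / Z t) (R t - (2 * Z₁ t / Z t) ^ 2 / 2) t := by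
  have hz := (hpos t).ne'
  refine (((h.deriv2 t).const_mul 2).div (h.deriv t) hz).congr_deriv ?_
  field_simp

theorem IsLinSol.combo {m Z Z₁ Y Y₁ : ℝ → ℝ} (hZ : IsLinSol m Z Z₁) (hY : IsLinSol m Y Y₁)
    (r : ℝ) : IsLinSol m (fun t => (1 - r) * Z t + r * Y t)
      (fun t => (1 - r) * Z₁ t + r * Y₁ t) where
  deriv t := ((hZ.deriv t).const_mul _).add ((hY.deriv t).const_mul _)
  deriv2 t := (((hZ.deriv2 t).const_mul _).add ((hY.deriv2 t).const_mul _)).congr_deriv (by ring)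
  zero := by rw [hZ.zero, hY.zero]; ring

theorem IsLinSol.reflect {m Z Z₁ : ℝ → ℝ} (hZ : IsLinSol m Z Z₁) :
    IsLinSol (fun t => m (-t)) (fun t => Z (-t)) (fun t => -Z₁ (-t)) where
  deriv t := ((hZ.deriv (-t)).comp t (hasDerivAt_neg t)).congr_deriv (by ring)
  deriv2 t := ((hZ.deriv2 (-t)).comp t (hasDerivAt_neg t)).neg.congr_deriv (by ring)
  zero := by simp [hZ.zero]

/-- A positive solution which is not minimal at `+∞` grows at least linearly there. -/
theorem IsLinSol.exists_linear_lower_bound {m Z Z₁ Y Y₁ : ℝ → ℝ} (hm : ∀ t, 0 ≤ m t)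
    (hZ : IsLinSol m Z Z₁) (hY : IsLinSol m Y Y₁) (hZp : ∀ t, 0 < Z t) (hYp : ∀ t, 0 < Y t)
    (h0 : Y₁ 0 < Z₁ 0) : ∃ k : ℝ, 0 < k ∧ ∀ t, 0 ≤ t → k * (1 + t) ≤ Z t := by
  -- The solution is convex because `m Z ≥ 0`, so one point of positive slope suffices for linear
  -- growth.
  have hmono : Monotone Z₁ := monotone_of_hasDerivAt_nonneg hZ.deriv2
    fun t => mul_nonneg (hm t) (hZp t).le
  -- Otherwise `Z ≤ 1` on the half-line, and the constant Wronskian gives `(Y/Z)' = -w/Z² ≤ -w`.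
  -- Then `Y/Z`, which starts at `1`, would no longer be positive at `1/w`.
  obtain ⟨t₀, ht₀, hpos⟩ : ∃ t₀, 0 ≤ t₀ ∧ 0 < Z₁ t₀ := by
    by_contra! hcon
    set w := Z₁ 0 - Y₁ 0 with hw
    have hw0 : 0 < w := sub_pos.2 h0
    have hZ1 : ∀ t, 0 ≤ t → Z t ≤ 1 := fun t ht => by
      rw [← hZ.zero]
      refine antitoneOn_of_deriv_nonpos (convex_Ici (0 : ℝ)) hZ.continuous.continuousOn
        (fun s _ => (hZ.deriv s).differentiableAt.differentiableWithinAt) (fun s hs => ?_)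
        self_mem_Ici ht ht
      rw [interior_Ici] at hs
      rw [(hZ.deriv s).deriv]
      exact hcon s (le_of_lt hs)
    have hd : ∀ t, HasDerivAt (fun t => Y t / Z t + w * t) (-w / Z t ^ 2 + w) t := fun t => by
      have h1 := hZ.wronskian hY t
      refine (((hY.deriv t).div (hZ.deriv t) (hZp t).ne').add
        ((hasDerivAt_id t).const_mul w)).congr_deriv ?_
      rw [h1, mul_one, hw]; ring
    have hanti : AntitoneOn (fun t => Y t / Z t + w * t) (Ici 0) :=
      antitoneOn_of_deriv_nonpos (convex_Ici (0 : ℝ))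
        (fun s _ => (hd s).continuousAt.continuousWithinAt)
        (fun s _ => (hd s).differentiableAt.differentiableWithinAt) fun s hs => by
        rw [interior_Ici] at hs
        rw [(hd s).deriv, neg_div]
        have h1 : Z s ^ 2 ≤ 1 := pow_le_one₀ (hZp s).le (hZ1 s (le_of_lt hs))
        have h2 : w ≤ w / Z s ^ 2 := by
          rw [le_div_iff₀ (pow_pos (hZp s) 2)]; nlinarith
        linarith
    have h1 := hanti (self_mem_Ici (a := (0 : ℝ))) (show (1 / w) ∈ Ici (0 : ℝ) by
      exact (one_div_pos.2 hw0).le) (one_div_pos.2 hw0).le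
    have h2 : 0 < Y (1 / w) / Z (1 / w) := div_pos (hYp _) (hZp _)
    simp only [hY.zero, hZ.zero, mul_zero, mul_one_div_cancel hw0.ne'] at h1
    linarith
  have hlin : ∀ t, t₀ ≤ t → Z₁ t₀ * (t - t₀) ≤ Z t := fun t ht => by
    have hd : ∀ s, HasDerivAt (fun s => Z s - Z₁ t₀ * s) (Z₁ s - Z₁ t₀) s := fun s =>
      ((hZ.deriv s).sub ((hasDerivAt_id s).const_mul (Z₁ t₀))).congr_deriv (by ring)
    have hm2 : MonotoneOn (fun s => Z s - Z₁ t₀ * s) (Ici t₀) :=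
      monotoneOn_of_deriv_nonneg (convex_Ici t₀)
        (fun s _ => (hd s).continuousAt.continuousWithinAt)
        (fun s _ => (hd s).differentiableAt.differentiableWithinAt) fun s hs => by
        rw [interior_Ici] at hs
        rw [(hd s).deriv]
        exact sub_nonneg.2 (hmono (le_of_lt hs))
    have := hm2 self_mem_Ici ht ht
    have h2 := (hZp t₀).le
    simp only at this
    linarith
  obtain ⟨t₁, -, hmin⟩ := (isCompact_Icc (a := (0 : ℝ)) (b := 2 * t₀ + 1)).exists_isMinOn
    ⟨0, by constructor <;> linarith⟩ hZ.continuous.continuousOn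
  have hk := hZp t₁
  -- For `t ≥ 2 t₀ + 1` the lower bound `Z₁ t₀ (t - t₀)` applies and `1 + t ≤ 2 (t - t₀)`. Before
  -- that, `1 + t ≤ 2 + 2 t₀` and `Z` is at least its minimum `Z t₁`.
  refine ⟨min (Z₁ t₀ / 2) (Z t₁ / (2 + 2 * t₀)), lt_min (by positivity) (by positivity),
    fun t ht => ?_⟩
  rcases le_total t (2 * t₀ + 1) with h | h
  · calc min (Z₁ t₀ / 2) (Z t₁ / (2 + 2 * t₀)) * (1 + t)
        ≤ Z t₁ / (2 + 2 * t₀) * (2 + 2 * t₀) :=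
          mul_le_mul (min_le_right _ _) (by linarith) (by linarith) (by positivity)
      _ = Z t₁ := by field_simp
      _ ≤ Z t := hmin ⟨ht, h⟩
  · calc min (Z₁ t₀ / 2) (Z t₁ / (2 + 2 * t₀)) * (1 + t)
        ≤ Z₁ t₀ / 2 * (2 * (t - t₀)) := by
          gcongr
          · exact min_le_left _ _
          · linarith
      _ = Z₁ t₀ * (t - t₀) := by ring
      _ ≤ Z t := hlin t (by linarith)

/-! ### No-swirl solutions in the variable `t` -/

section

variable {c : Fin 3 → ℝ} {U : ℝ → ℝ}

theorem P_eq (h0 : c 0 = -1) (h1 : c 1 = -1) (x : ℝ) : P c x = -2 + c 2 * (1 - x ^ 2) := by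
  rw [P, h0, h1]; ring

/-- Adding `2x` to `U` completes the square in `2xU + U²/2`, and `(1 - x²) d/dx` is `d/dt`. With `c₁
= c₂ = -1` the constants cancel, leaving the right hand side `c₃ sech² t`. -/
theorem IsNoSwirlSolution.hasDerivAt_tanh (hU : IsNoSwirlSolution c U) (h0 : c 0 = -1)
    (h1 : c 1 = -1) (t : ℝ) : HasDerivAt (fun t => 2 * Real.tanh t + U (Real.tanh t))
      (c 2 * sechSq t - (2 * Real.tanh t + U (Real.tanh t)) ^ 2 / 2) t := by
  have hx := tanh_mem_Ioo t
  have hd := ((contDiffAt_of_Ioo hU.1 hx).differentiableAt one_ne_zero).hasDerivAt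
  have he := hU.2 _ hx
  rw [P_eq h0 h1, one_sub_tanh_sq] at he
  refine (((LogSwirl.hasDerivAt_tanh t).const_mul 2).add
    (hd.comp t (LogSwirl.hasDerivAt_tanh t))).congr_deriv ?_
  have := one_sub_tanh_sq t
  linear_combination he - 2 * this

theorem isNoSwirlSolution_of_riccati (h0 : c 0 = -1) (h1 : c 1 = -1) {Φ : ℝ → ℝ}
    (h : ∀ t, HasDerivAt Φ (c 2 * sechSq t - Φ t ^ 2 / 2) t) :
    IsNoSwirlSolution c (fun x => -2 * x + Φ (Real.artanh x)) := by
  have hc : Continuous Φ := continuous_iff_continuousAt.2 fun t => (h t).continuousAt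
  have hcd : ContDiff ℝ 1 Φ := by
    rw [contDiff_one_iff_deriv]
    refine ⟨fun t => (h t).differentiableAt, ?_⟩
    rw [funext fun t => (h t).deriv]
    have := continuous_sechSq
    fun_prop
  refine ⟨?_, fun x hx => ?_⟩
  · exact (contDiffOn_const.mul contDiffOn_id).add
      (hcd.comp_contDiffOn contDiffOn_artanh)
  · have hd := ((hasDerivAt_id x).const_mul (-2)).add (hasDerivAt_comp_artanh hx (h _))
    have hd' : deriv (fun x => -2 * x + Φ (Real.artanh x)) x = _ := hd.deriv
    rw [hd', P_eq h0 h1, sechSq_artanh hx]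
    have := (one_sub_sq_pos hx).ne'
    field_simp
    ring

theorem IsNoSwirlSolution.isLinSol (hU : IsNoSwirlSolution c U) (h0 : c 0 = -1) (h1 : c 1 = -1) :
    ∃ Z Z₁ : ℝ → ℝ, IsLinSol (fun t => c 2 * sechSq t / 2) Z Z₁ ∧ (∀ t, 0 < Z t) ∧
      Z₁ 0 = U 0 / 2 ∧ ∀ t, 2 * Z₁ t / Z t = 2 * Real.tanh t + U (Real.tanh t) := by
  refine ⟨_, _, isLinSol_exp (hU.hasDerivAt_tanh h0 h1), fun t => Real.exp_pos _, by simp,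
    fun t => ?_⟩
  field_simp [Real.exp_ne_zero]

end

/-! ### The parameters in `I41` -/

section

variable {p : Param}

theorem I41_fst_zero (hp : p ∈ I41) : p.1 0 = -1 := hp.2.1.2.1
theorem I41_fst_one (hp : p ∈ I41) : p.1 1 = -1 := hp.2.1.2.2.1

theorem I41_fst_two_pos (hp : p ∈ I41) : 0 < p.1 2 := by
  have h := hp.2.1.2.2.2
  rw [I41_fst_zero hp, I41_fst_one hp] at h
  simpa [cbar3] using h

/-- The infimum and supremum of the empty set of reals are both `0`, which would contradict `γ⁻ < γ
< γ⁺`. -/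
theorem initialValues_nonempty (hp : p ∈ I41) : (initialValues p.1).Nonempty := by
  by_contra h
  rw [not_nonempty_iff_eq_empty] at h
  have := hp.2.2.1.trans hp.2.2.2
  rw [gammaMinus, gammaPlus, h, Real.sInf_empty, Real.sSup_empty] at this
  exact lt_irrefl _ this

/-- A positive solution of the linear equation attached to `p`, with its growth. -/
theorem exists_base_isLinSol (hp : p ∈ I41) : ∃ Z Z₁ : ℝ → ℝ,
    IsLinSol (fun t => p.1 2 * sechSq t / 2) Z Z₁ ∧ (∀ t, 0 < Z t) ∧ Z₁ 0 = p.2 / 2 ∧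
      ∃ k : ℝ, 0 < k ∧ ∀ t, k * (1 + |t|) ≤ Z t := by
  have h0 := I41_fst_zero hp
  have h1 := I41_fst_one hp
  have h2 := I41_fst_two_pos hp
  obtain ⟨γ₁, ⟨U₁, hU₁, rfl⟩, hlt₁⟩ := exists_lt_of_csInf_lt (initialValues_nonempty hp) hp.2.2.1
  obtain ⟨γ₂, ⟨U₂, hU₂, rfl⟩, hlt₂⟩ := exists_lt_of_lt_csSup (initialValues_nonempty hp) hp.2.2.2
  obtain ⟨Y, Y₁, hY, hYp, hY0, -⟩ := hU₁.isLinSol h0 h1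
  obtain ⟨W, W₁, hW, hWp, hW0, -⟩ := hU₂.isLinSol h0 h1
  -- The equation for `Z` is linear, so a convex combination of the positive solutions below and
  -- above `γ` is a positive solution; `r` gives it the initial slope `γ/2`.
  set r := (p.2 - U₁ 0) / (U₂ 0 - U₁ 0) with hr
  have hd : 0 < U₂ 0 - U₁ 0 := by linarith
  have hr0 : 0 < r := div_pos (by linarith) hd
  have hr1 : r < 1 := (div_lt_one hd).2 (by linarith)
  have hZ := hY.combo hW r
  have hZp : ∀ t, 0 < (1 - r) * Y t + r * W t := fun t =>
    add_pos (mul_pos (by linarith) (hYp t)) (mul_pos hr0 (hWp t))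
  have hZ0 : (1 - r) * Y₁ 0 + r * W₁ 0 = p.2 / 2 := by
    rw [hY0, hW0, hr]; field_simp; ring
  have hm : ∀ t, 0 ≤ p.1 2 * sechSq t / 2 := fun t => by have := sechSq_pos t; positivity
  -- The slope of `Y` at `0` is smaller, so comparison with `Y` gives growth at `+∞`. After
  -- reflection `W` has the smaller slope, which gives growth at `-∞`.
  obtain ⟨k, hk, hkb⟩ := hZ.exists_linear_lower_bound hm hY hZp hYp (by rw [hZ0, hY0]; linarith)
  obtain ⟨l, hl, hlb⟩ := hZ.reflect.exists_linear_lower_bound (fun t => hm (-t)) hW.reflect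
    (fun t => hZp (-t)) (fun t => hWp (-t)) (by rw [neg_zero, hZ0, hW0]; linarith)
  refine ⟨_, _, hZ, hZp, hZ0, min k l, lt_min hk hl, fun t => ?_⟩
  rcases le_total 0 t with ht | ht
  · rw [abs_of_nonneg ht]
    refine le_trans ?_ (hkb t ht)
    gcongr
    exact min_le_left _ _
  · rw [abs_of_nonpos ht]
    have := hlb (-t) (by linarith)
    rw [neg_neg] at this
    refine le_trans ?_ this
    have : 0 ≤ -t := by linarith
    gcongr
    exact min_le_right _ _

theorem Ubar_spec (hp : p ∈ I41) : IsNoSwirlSolution p.1 (Ubar p) ∧ Ubar p 0 = p.2 := by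
  have h : ∃ U : ℝ → ℝ, IsNoSwirlSolution p.1 U ∧ U 0 = p.2 := by
    obtain ⟨Z, Z₁, hZ, hZp, hZ0, -⟩ := exists_base_isLinSol hp
    refine ⟨_, isNoSwirlSolution_of_riccati (I41_fst_zero hp) (I41_fst_one hp)
      (hZ.hasDerivAt_ratio hZp), ?_⟩
    simp only [Real.artanh_zero, hZ.zero, hZ0]
    ring
  rw [Ubar, dif_pos h]
  exact Classical.choose_spec h

/-- The coordinates of the no-swirl solution with parameter `p`. -/
def baseCoord (p : Param) : Coord := (p.1 2, p.2 / 2, 0, 0)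

theorem psiInt_raw_zero (α : Expo) : psiInt (raw α 0) = fun _ => 0 := by
  have := psiInt_raw_smul α 0 0
  simpa using this

theorem rhs_raw_zero (α : Expo) (ρ t : ℝ) : rhs ρ (raw α 0) t = ρ * sechSq t := by
  simp [rhs, psiInt_raw_zero, interp, limPlus, limMinus]

theorem isLinSol_base (α : Expo) (p : Param) :
    IsLinSol (fun t => p.1 2 * sechSq t / 2) (solZ α (baseCoord p, 0))
      (solZ₁ α (baseCoord p, 0)) := by
  have h := isLinSol_solZ α (baseCoord p, 0)
  simpa only [rhs_raw_zero, baseCoord] using h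

/-- A function in `BC` with a positive lower bound is a unit. -/
theorem BC.isUnit_of_le {u : BC} {k : ℝ} (hk : 0 < k) (h : ∀ t, k ≤ u t) : IsUnit u := by
  have hne : ∀ t, u t ≠ 0 := fun t => (hk.trans_le (h t)).ne'
  refine IsUnit.of_mul_eq_one (mkBC (fun t => (u t)⁻¹) (u.continuous.inv₀ hne) k⁻¹ fun t => ?_)
    (BC.ext fun t => ?_)
  · rw [abs_of_pos (inv_pos.2 (hk.trans_le (h t)))]
    exact inv_anti₀ hk (h t)
  · exact mul_inv_cancel₀ (hne t)

/-- This is where the strict inequalities `γ⁻ < γ < γ⁺` become an open condition: `k (1 + |t|) ≤ Z`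
says that `u` is bounded below, hence invertible in `BC`. -/
theorem base_mem_unitSet (α : Expo) (hp : p ∈ I41) : (baseCoord p, (0 : BC)) ∈ unitSet α := by
  obtain ⟨Z, Z₁, hZ, hZp, hZ0, k, hk, hkb⟩ := exists_base_isLinSol hp
  have h := hZ.unique (isLinSol_base α p) hZp (by rw [solZ₁_zero, hZ0]; rfl)
  refine BC.isUnit_of_le hk fun t => ?_
  have h1 := hkb t
  rw [← h t, solZ, mul_comm k] at h1
  exact le_of_mul_le_mul_left h1 (one_add_abs_pos t)

theorem phi_base (α : Expo) (hp : p ∈ I41) (t : ℝ) :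
    phi α (baseCoord p, 0) t = 2 * Real.tanh t + Ubar p (Real.tanh t) := by
  obtain ⟨hU, hU0⟩ := Ubar_spec hp
  obtain ⟨Z, Z₁, hZ, hZp, hZ0, hr⟩ := hU.isLinSol (I41_fst_zero hp) (I41_fst_one hp)
  have h := hZ.unique (isLinSol_base α p) hZp (by rw [solZ₁_zero, hZ0, hU0]; rfl)
  have h1 : solZ₁ α (baseCoord p, 0) t = Z₁ t := by
    have hf : solZ α (baseCoord p, 0) = Z := funext h
    have := (isLinSol_base α p).deriv t
    rw [hf] at this
    exact this.unique (hZ.deriv t)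
  rw [phi_apply (base_mem_unitSet α hp), h, h1, hr]

end

/-! ## The reduced system in the variable `t` -/

/-! ### Integrals in the variable `x` -/

theorem integral_eq_of_artanh {φ F F₁ : ℝ → ℝ} (hF : ∀ t, HasDerivAt F (F₁ t) t)
    (hF₁ : Continuous F₁) (hφ : ∀ s ∈ Ioo (-1 : ℝ) 1, φ s = F₁ (Real.artanh s) * (1 - s ^ 2)⁻¹)
    {x : ℝ} (hx : x ∈ Ioo (-1 : ℝ) 1) : ∫ s in (0 : ℝ)..x, φ s = F (Real.artanh x) - F 0 := by
  have hsub : uIcc 0 x ⊆ Ioo (-1 : ℝ) 1 := (ordConnected_Ioo).uIcc_subset artanh_zero_mem hx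
  rw [intervalIntegral.integral_congr (g := fun s => F₁ (Real.artanh s) * (1 - s ^ 2)⁻¹)
    fun s hs => hφ s (hsub hs)]
  have hc : ContinuousOn (fun s : ℝ => F₁ (Real.artanh s) * (1 - s ^ 2)⁻¹) (uIcc 0 x) :=
    (hF₁.comp_continuousOn ((contDiffOn_artanh (n := 0)).continuousOn.mono hsub)).mul
      (ContinuousOn.inv₀ (by fun_prop) fun s hs => (one_sub_sq_pos (hsub hs)).ne')
  rw [intervalIntegral.integral_eq_sub_of_hasDerivAt (f := fun s => F (Real.artanh s))
    (fun s hs => hasDerivAt_comp_artanh (hsub hs) (hF _)) hc.intervalIntegrable,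
    Real.artanh_zero]

theorem strictMono_tanh : StrictMono Real.tanh :=
  strictMono_of_hasDerivAt_pos hasDerivAt_tanh sechSq_pos

theorem image_tanh_Ioi : Real.tanh '' Ioi 0 = Ioo 0 1 := by
  ext x
  constructor
  · rintro ⟨t, ht, rfl⟩
    refine ⟨?_, (tanh_mem_Ioo t).2⟩
    rw [← Real.tanh_zero]
    exact strictMono_tanh ht
  · rintro ⟨h0, h1⟩
    have hx : x ∈ Ioo (-1 : ℝ) 1 := ⟨by linarith, h1⟩
    refine ⟨Real.artanh x, ?_, Real.tanh_artanh hx⟩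
    rw [mem_Ioi, ← Real.artanh_zero]
    exact Real.strictMonoOn_artanh artanh_zero_mem hx h0

theorem image_tanh_Iic : Real.tanh '' Iic 0 = Ioc (-1) 0 := by
  ext x
  constructor
  · rintro ⟨t, ht, rfl⟩
    refine ⟨(tanh_mem_Ioo t).1, ?_⟩
    rw [← Real.tanh_zero]
    exact strictMono_tanh.monotone ht
  · rintro ⟨h0, h1⟩
    have hx : x ∈ Ioo (-1 : ℝ) 1 := ⟨h0, by linarith⟩
    refine ⟨Real.artanh x, ?_, Real.tanh_artanh hx⟩
    rw [mem_Iic, ← Real.artanh_zero]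
    exact Real.strictMonoOn_artanh.monotoneOn hx artanh_zero_mem h1

section

variable {g G G₁ : ℝ → ℝ}

theorem deriv_eq_of_artanh (hg : ∀ x ∈ Ioo (-1 : ℝ) 1, g x = G (Real.artanh x))
    (hG : ∀ t, HasDerivAt G (G₁ t) t) {x : ℝ} (hx : x ∈ Ioo (-1 : ℝ) 1) :
    deriv g x = G₁ (Real.artanh x) * (1 - x ^ 2)⁻¹ := by
  have h : g =ᶠ[𝓝 x] fun x => G (Real.artanh x) :=
    Filter.eventuallyEq_of_mem (isOpen_Ioo.mem_nhds hx) hg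
  rw [h.deriv_eq, (hasDerivAt_comp_artanh hx (hG _)).deriv]

/-- Since `dx = sech² t dt` and `g' = G₁ cosh² t`, the innermost integrand becomes `2 cosh² t G G₁`,
and each further integration brings a factor `sech² t`. -/
theorem psi_inner_eq (hg : ∀ x ∈ Ioo (-1 : ℝ) 1, g x = G (Real.artanh x))
    (hG : ∀ t, HasDerivAt G (G₁ t) t) (hG₁ : Continuous G₁) {l : ℝ} (hl : l ∈ Ioo (-1 : ℝ) 1) :
    (∫ t in (0 : ℝ)..l, ∫ s in (0 : ℝ)..t, 2 * g s * deriv g s / (1 - s ^ 2)) =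
      psi1 (fun t => G t * G₁ t) (Real.artanh l) := by
  have hGc : Continuous G := continuous_iff_continuousAt.2 fun t => (hG t).continuousAt
  have hc : Continuous fun t => G t * G₁ t := hGc.mul hG₁
  have h2 : ∀ t ∈ Ioo (-1 : ℝ) 1, (∫ s in (0 : ℝ)..t, 2 * g s * deriv g s / (1 - s ^ 2)) =
      psi2 (fun t => G t * G₁ t) (Real.artanh t) := fun t ht => by
    rw [integral_eq_of_artanh (hasDerivAt_psi2 hc)
      ((continuous_const.mul (Real.continuous_cosh.pow 2)).mul hc) (fun s hs => ?_) ht]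
    · simp [psi2]
    · have h1 := sechSq_mul_cosh_sq (Real.artanh s)
      rw [sechSq_artanh hs] at h1
      have h3 := (one_sub_sq_pos hs).ne'
      have h4 : Real.cosh (Real.artanh s) ^ 2 = (1 - s ^ 2)⁻¹ :=
        eq_inv_of_mul_eq_one_right h1
      rw [hg s hs, deriv_eq_of_artanh hg hG hs, h4]
      ring
  rw [integral_eq_of_artanh (hasDerivAt_psi1 hc) (continuous_sechSq.mul (continuous_psi2 hc))
    (fun s hs => ?_) hl]
  · simp [psi1]
  · rw [h2 s hs, sechSq_artanh hs]
    have h3 := (one_sub_sq_pos hs).ne'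
    field_simp

theorem psi_eq (hg : ∀ x ∈ Ioo (-1 : ℝ) 1, g x = G (Real.artanh x))
    (hG : ∀ t, HasDerivAt G (G₁ t) t) (hG₁ : Continuous G₁) {x : ℝ} (hx : x ∈ Ioo (-1 : ℝ) 1) :
    psi g g x = ∫ t in (0 : ℝ)..Real.artanh x, psiInt (fun t => G t * G₁ t) t := by
  have hGc : Continuous G := continuous_iff_continuousAt.2 fun t => (hG t).continuousAt
  have hc : Continuous fun t => G t * G₁ t := hGc.mul hG₁
  rw [psi, integral_eq_of_artanh (hasDerivAt_primitive (continuous_psiInt hc))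
    (continuous_psiInt hc) (fun s hs => ?_) hx]
  · simp
  · rw [psi_inner_eq hg hG hG₁ hs, psiInt, sechSq_artanh hs]
    have h3 := (one_sub_sq_pos hs).ne'
    field_simp

/-- The pole corresponds to `t = +∞`, so the outermost integral is transformed as a set integral
over the image of `Ioi 0` under `tanh`; this change of variables requires no integrability. -/
theorem psi_one (hg : ∀ x ∈ Ioo (-1 : ℝ) 1, g x = G (Real.artanh x))
    (hG : ∀ t, HasDerivAt G (G₁ t) t) (hG₁ : Continuous G₁) :
    psi g g 1 = limPlus (psiInt fun t => G t * G₁ t) := by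
  rw [psi, intervalIntegral.integral_of_le zero_le_one, integral_Ioc_eq_integral_Ioo,
    ← image_tanh_Ioi, integral_image_eq_integral_abs_deriv_smul measurableSet_Ioi
      (fun t _ => (hasDerivAt_tanh t).hasDerivWithinAt) Real.tanh_injective.injOn, limPlus]
  refine setIntegral_congr_fun measurableSet_Ioi fun t _ => ?_
  rw [psi_inner_eq hg hG hG₁ (tanh_mem_Ioo t), Real.artanh_tanh, abs_of_pos (sechSq_pos t)]
  rfl

theorem psi_neg_one (hg : ∀ x ∈ Ioo (-1 : ℝ) 1, g x = G (Real.artanh x))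
    (hG : ∀ t, HasDerivAt G (G₁ t) t) (hG₁ : Continuous G₁) :
    psi g g (-1) = limMinus (psiInt fun t => G t * G₁ t) := by
  rw [psi, intervalIntegral.integral_of_ge (by norm_num),
    ← image_tanh_Iic, integral_image_eq_integral_abs_deriv_smul measurableSet_Iic
      (fun t _ => (hasDerivAt_tanh t).hasDerivWithinAt) Real.tanh_injective.injOn, limMinus]
  refine congrArg Neg.neg (setIntegral_congr_fun measurableSet_Iic fun t _ => ?_)
  rw [psi_inner_eq hg hG hG₁ (tanh_mem_Ioo t), Real.artanh_tanh, abs_of_pos (sechSq_pos t)]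
  rfl

end

/-! ### Solutions -/

/-- `Φ = 2x + Uθ` and `G = Uφ` solve the reduced system in the variable `t`. -/
structure IsSwirlPair (ρ : ℝ) (Φ G G₁ : ℝ → ℝ) : Prop where
  θ : ∀ t, HasDerivAt Φ (rhs ρ (fun t => G t * G₁ t) t - Φ t ^ 2 / 2) t
  φ : ∀ t, HasDerivAt G (G₁ t) t
  φ₁ : ∀ t, HasDerivAt G₁ (-(Φ t * G₁ t)) t

/-- The constants of the reduced system. -/
def swirlConst (ρ : ℝ) (h : ℝ → ℝ) : Fin 3 → ℝ :=
  ![-1 + 1 / 2 * limMinus (psiInt h), -1 + 1 / 2 * limPlus (psiInt h),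
    ρ - 1 / 2 * (limPlus (psiInt h) + limMinus (psiInt h))]

/-- A quadratic is determined by its values at `1`, `-1` and `0`. The constants are those for which
`P_ĉ + 2` takes there the values `ψ(1)`, `ψ(-1)` and `ρ`, so that `P_ĉ + 2 - ψ` is `rhs`. -/
theorem P_swirlConst (ρ : ℝ) (h : ℝ → ℝ) {x : ℝ} (hx : x ∈ Ioo (-1 : ℝ) 1) :
    P (swirlConst ρ h) x =
      -2 + rhs ρ h (Real.artanh x) + ∫ t in (0 : ℝ)..Real.artanh x, psiInt h t := by
  rw [rhs, sechSq_artanh hx, interp, Real.tanh_artanh hx]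
  simp only [P, swirlConst, Matrix.cons_val]
  ring

section

variable {ρ : ℝ} {Φ G G₁ Uθ Uφ : ℝ → ℝ}

theorem IsSwirlPair.continuous_θ (h : IsSwirlPair ρ Φ G G₁) : Continuous Φ :=
  continuous_iff_continuousAt.2 fun t => (h.θ t).continuousAt

theorem IsSwirlPair.continuous_φ (h : IsSwirlPair ρ Φ G G₁) : Continuous G :=
  continuous_iff_continuousAt.2 fun t => (h.φ t).continuousAt

theorem IsSwirlPair.continuous_φ₁ (h : IsSwirlPair ρ Φ G G₁) : Continuous G₁ :=
  continuous_iff_continuousAt.2 fun t => (h.φ₁ t).continuousAt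

theorem continuous_rhs (ρ : ℝ) {f : ℝ → ℝ} (hf : Continuous f) : Continuous (rhs ρ f) :=
  (continuous_const.mul continuous_sechSq).add (continuous_interp (continuous_psiInt hf))

theorem IsSwirlPair.isReducedSolution (h : IsSwirlPair ρ Φ G G₁)
    (hθ : ∀ x ∈ Ioo (-1 : ℝ) 1, Uθ x = -2 * x + Φ (Real.artanh x))
    (hφ : ∀ x ∈ Ioo (-1 : ℝ) 1, Uφ x = G (Real.artanh x)) :
    IsReducedSolution (swirlConst ρ fun t => G t * G₁ t) Uθ Uφ := by
  have hΦ1 : ContDiff ℝ 1 Φ := by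
    rw [contDiff_one_iff_deriv]
    refine ⟨fun t => (h.θ t).differentiableAt, ?_⟩
    rw [funext fun t => (h.θ t).deriv]
    exact (continuous_rhs ρ (h.continuous_φ.mul h.continuous_φ₁)).sub
      ((h.continuous_θ.pow 2).div_const 2)
  have hG1 : ContDiff ℝ 1 G₁ := by
    rw [contDiff_one_iff_deriv]
    refine ⟨fun t => (h.φ₁ t).differentiableAt, ?_⟩
    rw [funext fun t => (h.φ₁ t).deriv]
    exact (h.continuous_θ.mul h.continuous_φ₁).neg
  have hG2 : ContDiff ℝ 2 G := by
    rw [← contDiffOn_univ]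
    exact contDiffOn_succ_of_hasDerivAt (n := 1) isOpen_univ (fun t _ => h.φ t)
      (contDiffOn_univ.2 hG1)
  refine ⟨?_, ?_, fun x hx => ⟨?_, ?_⟩⟩
  · exact ((contDiffOn_const.mul contDiffOn_id).add
      (hΦ1.comp_contDiffOn contDiffOn_artanh)).congr hθ
  · exact (hG2.comp_contDiffOn contDiffOn_artanh).congr hφ
  · have hd : deriv Uθ x = -2 + (rhs ρ (fun t => G t * G₁ t) (Real.artanh x) -
        Φ (Real.artanh x) ^ 2 / 2) * (1 - x ^ 2)⁻¹ := by
      have he : Uθ =ᶠ[𝓝 x] fun x => -2 * x + Φ (Real.artanh x) :=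
        Filter.eventuallyEq_of_mem (isOpen_Ioo.mem_nhds hx) hθ
      rw [he.deriv_eq]
      have := ((hasDerivAt_id x).const_mul (-2)).add (hasDerivAt_comp_artanh hx (h.θ _))
      rw [mul_one] at this
      exact this.deriv
    rw [psi_eq hφ h.φ h.continuous_φ₁ hx, P_swirlConst ρ _ hx, hd, hθ x hx]
    have := (one_sub_sq_pos hx).ne'
    field_simp
    ring
  · have hd : deriv (deriv Uφ) x = (1 - x ^ 2)⁻¹ ^ 2 *
        (-(Φ (Real.artanh x) * G₁ (Real.artanh x)) + 2 * x * G₁ (Real.artanh x)) := by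
      have he : deriv Uφ =ᶠ[𝓝 x] deriv (pull G) :=
        Filter.eventuallyEq_of_mem (isOpen_Ioo.mem_nhds hx) fun y hy => by
          rw [deriv_eq_of_artanh hφ h.φ hy, (hasDerivAt_pull hy (h.φ _)).deriv]
      rw [he.deriv_eq]
      exact (hasDerivAt_deriv_pull (F₂ := fun t => -(Φ t * G₁ t)) isOpen_Ioo subset_rfl
        (fun x _ => h.φ _) (fun x _ => h.φ₁ _) hx).deriv
    rw [hd, deriv_eq_of_artanh hφ h.φ hx, hθ x hx]
    have := (one_sub_sq_pos hx).ne'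
    field_simp
    ring

/-- The constants `ĉ` of the theorem are those of the reduced system. -/
theorem IsSwirlPair.cHat_eq (h : IsSwirlPair ρ Φ G G₁) {p : Param} (hp : p ∈ I41) {f : ℝ → ℝ}
    (hθ : ∀ x ∈ Ioo (-1 : ℝ) 1, Ubar p x + f x = -2 * x + Φ (Real.artanh x))
    (hφ : ∀ x ∈ Ioo (-1 : ℝ) 1, Uφ x = G (Real.artanh x)) :
    cHat p f Uφ = swirlConst ρ fun t => G t * G₁ t := by
  set H : ℝ → ℝ := fun t => G t * G₁ t with hH
  have hHc : Continuous H := h.continuous_φ.mul h.continuous_φ₁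
  set lp := limPlus (psiInt H)
  set lm := limMinus (psiInt H)
  obtain ⟨hU, -⟩ := Ubar_spec hp
  have hred := h.isReducedSolution (Uθ := fun x => Ubar p x + f x) hθ hφ
  -- Subtracting the equation of `Ubar p` from the reduced one cancels the base flow and leaves
  -- exactly `φ_{c,γ}[f] = R - c₃ (1 - x²)`.
  have hE : ∀ x ∈ Ioo (-1 : ℝ) 1, varphi p f x =
      (ρ - p.1 2) * (1 - x ^ 2) + lp * ((x ^ 2 + x) / 2) + lm * ((x ^ 2 - x) / 2) -
        ∫ t in (0 : ℝ)..Real.artanh x, psiInt H t := fun x hx => by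
    have hUd := (contDiffAt_of_Ioo hU.1 hx).differentiableAt one_ne_zero
    have hfd : DifferentiableAt ℝ f x := by
      have := ((contDiffAt_of_Ioo hred.1 hx).differentiableAt one_ne_zero).sub hUd
      refine this.congr_of_eventuallyEq (Filter.Eventually.of_forall fun y => ?_)
      simp
    have h1 := (hred.2.2 x hx).1
    have h2 := hU.2 x hx
    have h3 : deriv (fun x => Ubar p x + f x) x = deriv (Ubar p) x + deriv f x :=
      deriv_add hUd hfd
    rw [h3, psi_eq hφ h.φ h.continuous_φ₁ hx, P_swirlConst ρ _ hx, rhs, sechSq_artanh hx,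
      interp, Real.tanh_artanh hx] at h1
    rw [P_eq (I41_fst_zero hp) (I41_fst_one hp)] at h2
    rw [varphi]
    linear_combination h1 - h2
  have hE' : varphi p f =ᶠ[𝓝 0] fun x => (ρ - p.1 2) * (1 - x ^ 2) + lp * ((x ^ 2 + x) / 2) +
      lm * ((x ^ 2 - x) / 2) - ∫ t in (0 : ℝ)..Real.artanh x, psiInt H t :=
    Filter.eventuallyEq_of_mem (isOpen_Ioo.mem_nhds artanh_zero_mem) hE
  have hd1 : ∀ x ∈ Ioo (-1 : ℝ) 1, HasDerivAt (fun x => (ρ - p.1 2) * (1 - x ^ 2) +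
      lp * ((x ^ 2 + x) / 2) + lm * ((x ^ 2 - x) / 2) -
        ∫ t in (0 : ℝ)..Real.artanh x, psiInt H t)
      (-2 * (ρ - p.1 2) * x + lp * (x + 1 / 2) + lm * (x - 1 / 2) - psi1 H (Real.artanh x))
      x := fun x hx => by
    have hsq := (hasDerivAt_id x).pow 2
    have hid := hasDerivAt_id x
    refine (((((hsq.const_sub 1).const_mul (ρ - p.1 2)).add
      (((hsq.add hid).div_const 2).const_mul lp)).add
      (((hsq.sub hid).div_const 2).const_mul lm)).sub (hasDerivAt_comp_artanh hx
        (hasDerivAt_primitive (continuous_psiInt hHc) _))).congr_deriv ?_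
    have := (one_sub_sq_pos hx).ne'
    simp only [psiInt, sechSq_artanh hx, id]
    field_simp
    ring
  -- At `x = 0` the second derivative of `ψ` is an integral over an empty interval, so only the
  -- quadratic polynomial contributes.
  have hd2 : HasDerivAt (fun x => -2 * (ρ - p.1 2) * x + lp * (x + 1 / 2) + lm * (x - 1 / 2) -
      psi1 H (Real.artanh x)) (-2 * (ρ - p.1 2) + lp + lm) 0 := by
    have hid := hasDerivAt_id (0 : ℝ)
    refine ((((hid.const_mul (-2 * (ρ - p.1 2))).add ((hid.add_const (1 / 2)).const_mul lp)).add
      ((hid.sub_const (1 / 2)).const_mul lm)).sub (hasDerivAt_comp_artanh artanh_zero_mem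
        (hasDerivAt_psi1 hHc _))).congr_deriv ?_
    simp [psi2]
  have hit : iteratedDeriv 2 (varphi p f) 0 = -2 * (ρ - p.1 2) + lp + lm := by
    rw [hE'.iteratedDeriv_eq, iteratedDeriv_succ, iteratedDeriv_one]
    refine (Filter.EventuallyEq.deriv_eq ?_).trans hd2.deriv
    exact Filter.eventuallyEq_of_mem (isOpen_Ioo.mem_nhds artanh_zero_mem)
      fun x hx => (hd1 x hx).deriv
  rw [cHat, swirlConst, I41_fst_zero hp, I41_fst_one hp, hit, psi_one hφ h.φ h.continuous_φ₁,
    psi_neg_one hφ h.φ h.continuous_φ₁]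
  congr 3
  change p.1 2 - 1 / 2 * (-2 * (ρ - p.1 2) + lp + lm) = ρ - 1 / 2 * (lp + lm)
  ring

end

/-! ## The family of solutions -/

/-- A smooth solution of the fixed point equation over an open set of coordinates. -/
structure Density (α : Expo) where
  dom : Set Coord
  fn : Coord → BC
  isOpen_dom : IsOpen dom
  contDiffOn_fn : ContDiffOn ℝ ∞ fn dom
  mem_unitSet : ∀ y ∈ dom, (y, fn y) ∈ unitSet α
  fixE_eq : ∀ y ∈ dom, fixE α (y, fn y) = 0

/-- The coordinates belonging to the parameter `p` and the vector `β`. -/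
def coord (q : Param × EuclideanSpace ℝ (Fin 4)) : Coord :=
  (q.1.1 2 + q.2 1 + q.2 0 ^ 2 / 2, (q.1.2 + q.2 0) / 2, q.2 2 * q.2 3, q.2 2 ^ 2)

theorem contDiff_coord : ContDiff ℝ ∞ coord := by
  unfold coord
  fun_prop

theorem coord_zero (p : Param) : coord (p, 0) = baseCoord p := by
  simp [coord, baseCoord]

theorem tendsto_invW_mul (w : BC) :
    Filter.Tendsto (fun t => (invW * w) t) Filter.atTop (𝓝 0) ∧
      Filter.Tendsto (fun t => (invW * w) t) Filter.atBot (𝓝 0) := by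
  have key : ∀ l : Filter ℝ, Filter.Tendsto (fun t : ℝ => |t|) l Filter.atTop →
      Filter.Tendsto (fun t => (invW * w) t) l (𝓝 0) := fun l hl => by
    have h1 : Filter.Tendsto (fun t : ℝ => (1 + |t|)⁻¹ * ‖w‖) l (𝓝 (0 * ‖w‖)) :=
      ((Filter.tendsto_atTop_add_const_left _ 1 hl).inv_tendsto_atTop).mul_const _
    rw [zero_mul] at h1
    refine squeeze_zero_norm (fun t => ?_) h1
    rw [BC.mul_apply, invW_apply, norm_mul, Real.norm_eq_abs, Real.norm_eq_abs,
      abs_of_pos (inv_pos.2 (one_add_abs_pos t))]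
    have := w.abs_le t
    have := one_add_abs_pos t
    gcongr
  exact ⟨key _ Filter.tendsto_abs_atTop_atTop, key _ Filter.tendsto_abs_atBot_atTop⟩

theorem primitive_solG {α : Expo} {y : Coord × BC} (hy : y ∈ unitSet α) (t : ℝ) :
    ∫ s in (0 : ℝ)..t, solG α y s = t + prim₂ (solG₁ α y) t := by
  have h : ∀ s, solG α y s = 1 + prim (solG₁ α y) s := fun s => by
    rw [eq_add_primitive (hasDerivAt_solG hy) (solG₁ α y).continuous s, solG_zero hy]; rfl
  rw [intervalIntegral.integral_congr (g := fun s => 1 + prim (solG₁ α y) s) fun s _ => h s,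
    intervalIntegral.integral_add (by simp) ((continuous_prim _).intervalIntegrable _ _)]
  simp [prim₂]

namespace Density

variable {α : Expo} (S : Density α) {q : Param × EuclideanSpace ℝ (Fin 4)}

/-- The parameters at which the family is defined. -/
def params : Set (Param × EuclideanSpace ℝ (Fin 4)) := coord ⁻¹' S.dom

theorem isOpen_params : IsOpen S.params := S.isOpen_dom.preimage contDiff_coord.continuous

/-- The coordinates and the density at a parameter. -/
def pt (q : Param × EuclideanSpace ℝ (Fin 4)) : Coord × BC := (coord q, S.fn (coord q))

theorem pt_mem (hq : q ∈ S.params) : S.pt q ∈ unitSet α := S.mem_unitSet _ hq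

theorem contDiffOn_pt : ContDiffOn ℝ ∞ S.pt S.params :=
  contDiff_coord.contDiffOn.prodMk
    (S.contDiffOn_fn.comp contDiff_coord.contDiffOn fun _ h => h)

/-- The swirl in the variable `t`. -/
def swirl (q : Param × EuclideanSpace ℝ (Fin 4)) (t : ℝ) : ℝ :=
  q.2 3 + q.2 2 * ∫ s in (0 : ℝ)..t, solG α (S.pt q) s

theorem hasDerivAt_swirl (t : ℝ) :
    HasDerivAt (S.swirl q) (q.2 2 * solG α (S.pt q) t) t :=
  ((hasDerivAt_primitive (solG α (S.pt q)).continuous t).const_mul _).const_add _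

/-- The choice `κ = β 2`, `G(0) = β 3` reproduces `μ` and `ν` in `coord`. The density used to build
`Z` is thus the density of the swirl obtained from `Z`, and the system closes. -/
theorem swirl_mul_eq_raw (hq : q ∈ S.params) :
    (fun t => S.swirl q t * (q.2 2 * solG α (S.pt q) t)) = raw α (S.pt q).2 := by
  have h := (fixE_eq_zero_iff (S.pt_mem hq)).1 (S.fixE_eq _ hq)
  ext t
  rw [h t]
  simp only [← solG_apply (S.pt_mem hq), swirl]
  change _ = q.2 2 * q.2 3 * _ + q.2 2 ^ 2 * _
  ring

theorem isSwirlPair (hq : q ∈ S.params) : IsSwirlPair (coord q).1 (phi α (S.pt q)) (S.swirl q)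
    (fun t => q.2 2 * solG α (S.pt q) t) where
  θ t := by
    rw [S.swirl_mul_eq_raw hq]
    exact (hasDerivAt_phi (S.pt_mem hq) t).congr_deriv (phi₁_apply _ t)
  φ := S.hasDerivAt_swirl
  φ₁ t := ((hasDerivAt_solG (S.pt_mem hq) t).const_mul _).congr_deriv (by rw [solG₁_apply]; ring)

/-- The data of the solution at a parameter. -/
def data (q : Param × EuclideanSpace ℝ (Fin 4)) : Data :=
  ((phi₂ α (S.pt q) 0, phi₃ α (S.pt q), phi₁W α (S.pt q)), q.2 2 • solG₁ α (S.pt q))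

theorem contDiffOn_data : ContDiffOn ℝ ∞ S.data S.params := by
  have hp := S.contDiffOn_pt
  have hm : MapsTo S.pt S.params (unitSet α) := fun _ h => S.pt_mem h
  have h2 := (contDiffOn_phi₂ α).comp hp hm
  have h3 := (contDiffOn_phi₃ α).comp hp hm
  have h1 := (contDiffOn_phi₁W α).comp hp hm
  have hG := (contDiffOn_solG₁ α).comp hp hm
  have he : ContDiffOn ℝ ∞ (fun q => phi₂ α (S.pt q) 0) S.params :=
    (evalBC 0).contDiff.comp_contDiffOn h2
  have hβ : ContDiff ℝ ∞ fun q : Param × EuclideanSpace ℝ (Fin 4) => q.2 2 := by fun_prop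
  exact (he.prodMk (h3.prodMk h1)).prodMk (hβ.contDiffOn.smul hG)

/-- The term `(β 0)² / 2` in `coord` cancels the quadratic part of `Φ(0)² / 2`, so `Φ(0)` and
`Φ'(0)` are affine in `β`. The cutoff term therefore disappears from the Taylor remainder, which is
given by `glue` alone and belongs to `X₁`. -/
theorem phi_eq_glue (hq : q ∈ S.params) (t : ℝ) : phi α (S.pt q) t =
    cut t * ((q.1.2 + q.2 0) + (q.1.1 2 + q.2 1 - q.1.2 ^ 2 / 2 - q.1.2 * q.2 0) * t) +
      glue (S.data q).1 t := by
  have hy := S.pt_mem hq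
  have hl := tendsto_invW_mul (phiW α (S.pt q))
  have h := eq_cut_add_glue (hasDerivAt_phi hy) (hasDerivAt_phi₁ hy) (hasDerivAt_phi₂ hy)
    (k := phi₁W α (S.pt q)) (fun _ => rfl) hl.1 hl.2 t
  rw [phi_zero hy, phi₁_zero hy] at h
  rw [h]
  change cut t * (2 * ((q.1.2 + q.2 0) / 2) + (q.1.1 2 + q.2 1 + q.2 0 ^ 2 / 2 -
    2 * ((q.1.2 + q.2 0) / 2) ^ 2) * t) + glue (S.data q).1 t = _
  ring

theorem swirl_eq (hq : q ∈ S.params) (t : ℝ) :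
    S.swirl q t = q.2 3 + q.2 2 * t + prim₂ (S.data q).2 t := by
  rw [swirl, primitive_solG (S.pt_mem hq), data, prim₂_smul]
  ring

/-- The data of the correction term. -/
def corrData (q : Param × EuclideanSpace ℝ (Fin 4)) : Data :=
  S.data q - S.data (q.1, 0) - fderiv ℝ S.data (q.1, 0) (0, q.2)

/-- The parameters at which the correction term is defined. -/
def corrParams : Set (Param × EuclideanSpace ℝ (Fin 4)) :=
  {q | q ∈ S.params ∧ (q.1, 0) ∈ S.params}

theorem isOpen_corrParams : IsOpen S.corrParams :=
  S.isOpen_params.inter (S.isOpen_params.preimage (by fun_prop))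

theorem contDiffOn_corrData : ContDiffOn ℝ ∞ S.corrData S.corrParams := by
  have h := S.contDiffOn_data
  have hb : ContDiff ℝ ∞ fun q : Param × EuclideanSpace ℝ (Fin 4) =>
    ((q.1, 0) : Param × EuclideanSpace ℝ (Fin 4)) := by fun_prop
  have hf : ContDiffOn ℝ ∞ (fderiv ℝ S.data) S.params :=
    h.fderiv_of_isOpen S.isOpen_params (by simp)
  refine ((h.mono fun _ hq => hq.1).sub (h.comp hb.contDiffOn fun _ hq => hq.2)).sub ?_
  refine (hf.comp hb.contDiffOn fun _ hq => hq.2).clm_apply (ContDiff.contDiffOn ?_)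
  fun_prop

/-- The correction term. -/
def corr {ε : ℝ} (hε : 0 < ε) (hε1 : ε < 1) (q : Param × EuclideanSpace ℝ (Fin 4)) : X1 ε :=
  dataOp hε hε1 (S.corrData q)

theorem contDiffOn_corr {ε : ℝ} (hε : 0 < ε) (hε1 : ε < 1) :
    ContDiffOn ℝ ∞ (S.corr hε hε1) S.corrParams :=
  (dataOp hε hε1).contDiff.comp_contDiffOn S.contDiffOn_corrData

theorem corr_zero {ε : ℝ} (hε : 0 < ε) (hε1 : ε < 1) (p : Param) :
    S.corr hε hε1 (p, 0) = 0 := by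
  have h : S.corrData (p, 0) = 0 := by
    have : ((0, 0) : Param × EuclideanSpace ℝ (Fin 4)) = 0 := rfl
    simp [corrData, this]
  rw [corr, h, map_zero]

variable {p : Param}

theorem hasDerivAt_data (hp : (p, 0) ∈ S.params) (β : EuclideanSpace ℝ (Fin 4)) :
    HasDerivAt (fun r : ℝ => S.data (p, r • β)) (fderiv ℝ S.data (p, 0) (0, β)) 0 := by
  have h1 : HasFDerivAt S.data (fderiv ℝ S.data (p, 0)) (p, (0 : ℝ) • β) := by
    rw [zero_smul]
    exact ((S.contDiffOn_data.contDiffAt (S.isOpen_params.mem_nhds hp)).differentiableAt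
      (by simp)).hasFDerivAt
  have h2 : HasDerivAt (fun r : ℝ => ((p, r • β) : Param × EuclideanSpace ℝ (Fin 4)))
      (0, β) 0 := by
    refine (hasDerivAt_const (0 : ℝ) p).prodMk ?_
    simpa using (hasDerivAt_id (0 : ℝ)).smul_const β
  exact h1.comp_hasDerivAt 0 h2

/-- `corrData` subtracts from the data their first order expansion in `β`, so its velocity along any
line through `β = 0` is zero, whatever the linear part is. -/
theorem hasDerivAt_corr {ε : ℝ} (hε : 0 < ε) (hε1 : ε < 1) (hp : (p, 0) ∈ S.params)
    (i : Fin 4) :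
    HasDerivAt (fun t : ℝ => S.corr hε hε1 (p, EuclideanSpace.single i t)) 0 0 := by
  set β : EuclideanSpace ℝ (Fin 4) := EuclideanSpace.single i 1
  have hs : ∀ t : ℝ, EuclideanSpace.single i t = t • β := fun t => by
    ext j; simp [β]
  simp only [hs]
  have h1 := S.hasDerivAt_data hp β
  set L := fderiv ℝ S.data (p, 0)
  have h2 : HasDerivAt (fun r : ℝ => L (0, r • β)) (L (0, β)) 0 := by
    have : ∀ r : ℝ, L (0, r • β) = r • L (0, β) := fun r => by
      rw [← map_smul, Prod.smul_mk, smul_zero]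
    simp only [this]
    simpa using (hasDerivAt_id (0 : ℝ)).smul_const (L (0, β))
  have h3 := (dataOp hε hε1).hasFDerivAt.comp_hasDerivAt (0 : ℝ)
    ((h1.sub_const (S.data (p, 0))).sub h2)
  rw [sub_self, map_zero] at h3
  exact h3

end Density

/-! ## The linearization at the solutions without swirl -/

/-- The integral up to `t`, as a functional. -/
def primAt (t : ℝ) : BC →L[ℝ] ℝ :=
  LinearMap.mkContinuous
    { toFun := fun w => prim w t
      map_add' := fun v w => intervalIntegral.integral_add (v.continuous.intervalIntegrable _ _)
        (w.continuous.intervalIntegrable _ _)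
      map_smul' := fun r w => intervalIntegral.integral_const_mul r _ } |t| fun w => by
    rw [mul_comm]; exact abs_prim_le w t

/-- The value of `glue` at `t`, as a functional. -/
def glueAt (t : ℝ) : DataT →L[ℝ] ℝ :=
  LinearMap.mkContinuous
    { toFun := fun d => glue d t
      map_add' := fun c d => congrFun (glue_add c d) t
      map_smul' := fun r d => congrFun (glue_smul r d) t } (38 * (1 + |t|)⁻¹) fun d => by
    refine (abs_glue_le d t).trans (le_of_eq ?_)
    ring

theorem prim₂_sub (k l : BC) (t : ℝ) : prim₂ (k - l) t = prim₂ k t - prim₂ l t := by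
  have h := congrFun (prim₂_add (k - l) l) t
  rw [sub_add_cancel] at h
  linarith

theorem rhs_eq_add (ρ : ℝ) (f : ℝ → ℝ) (t : ℝ) : rhs ρ f t = ρ * sechSq t + rhs 0 f t := by
  simp [rhs]

/-- `R` is linear in `(ρ, h)`, so a curve of densities with zero velocity leaves only the variation
of `ρ`. -/
theorem hasDerivAt_rhs_of_density (α : Expo) {h : ℝ → BC} (hh : HasDerivAt h 0 0) {ρ : ℝ → ℝ}
    {ρ' : ℝ} (hρ : HasDerivAt ρ ρ' 0) (t : ℝ) :
    HasDerivAt (fun r => rhs (ρ r) (raw α (h r)) t) (ρ' * sechSq t) 0 := by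
  have h1 : HasDerivAt (fun r => pot α (0, h r)) 0 0 := by
    have hd := ((contDiff_pot α).differentiable (by simp) (0, h 0)).hasFDerivAt
    have := hd.comp_hasDerivAt (0 : ℝ) ((hasDerivAt_const (0 : ℝ) (0 : ℝ)).prodMk hh)
    rw [show ((0 : ℝ), (0 : BC)) = 0 from rfl, map_zero] at this
    exact this
  have h2 := (((evalBC t).hasFDerivAt.comp_hasDerivAt (0 : ℝ) h1).const_mul
    (sechSq t * Real.exp (α * |t|))).const_mul 2
  have h3 : HasDerivAt (fun r => rhs 0 (raw α (h r)) t) 0 0 := by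
    simp only [← two_mul_sechSq_mul_pot]
    exact h2.congr_deriv (by simp)
  have h4 := (hρ.mul_const (sechSq t)).add h3
  rw [add_zero] at h4
  exact h4.congr_of_eventuallyEq (Filter.Eventually.of_forall fun r => rhs_eq_add _ _ t)

namespace Density

variable {α : Expo} (S : Density α) {p : Param}

theorem pt_zero (hp : (p, 0) ∈ S.params) : S.pt (p, 0) = (baseCoord p, 0) := by
  have h := S.fixE_eq _ hp
  rw [coord_zero] at h
  rw [pt, coord_zero]
  rw [baseCoord, fixE_of_no_swirl] at h
  rw [baseCoord, h]

variable (β : EuclideanSpace ℝ (Fin 4))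

theorem eventually_mem_params (hp : (p, 0) ∈ S.params) : ∀ᶠ r : ℝ in 𝓝 0, (p, r • β) ∈ S.params := by
  have hc : Continuous fun r : ℝ => ((p, r • β) : Param × EuclideanSpace ℝ (Fin 4)) := by fun_prop
  refine hc.continuousAt.eventually_mem (S.isOpen_params.mem_nhds ?_)
  simpa using hp

theorem differentiableAt_curve {E : Type*} [NormedAddCommGroup E] [NormedSpace ℝ E]
    {F : Coord × BC → E} (hF : ContDiffOn ℝ ∞ F (unitSet α)) (hp : (p, 0) ∈ S.params) :
    DifferentiableAt ℝ (fun r : ℝ => F (S.pt (p, r • β))) 0 := by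
  have h1 : DifferentiableAt ℝ (fun q => F (S.pt q)) (p, (0 : ℝ) • β) := by
    rw [zero_smul]
    exact ((hF.comp S.contDiffOn_pt fun _ h => S.pt_mem h).contDiffAt
      (S.isOpen_params.mem_nhds hp)).differentiableAt (by simp)
  exact h1.comp (0 : ℝ) (f := fun r : ℝ => ((p, r • β) : Param × EuclideanSpace ℝ (Fin 4)))
    (by fun_prop)

/-- The density has no linear part at the solutions without swirl. -/
theorem hasDerivAt_density (hp : (p, 0) ∈ S.params) :
    HasDerivAt (fun r : ℝ => (S.pt (p, r • β)).2) 0 0 := by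
  have hd := (S.differentiableAt_curve β (F := Prod.snd) contDiff_snd.contDiffOn hp).hasDerivAt
  have hG := (S.differentiableAt_curve β (contDiffOn_solG α) hp).hasDerivAt
  refine hd.congr_deriv (BC.ext fun t => ?_)
  have h1 := ((evalBC t).hasFDerivAt.comp_hasDerivAt (0 : ℝ) hd).const_mul (Real.exp (α * |t|))
  have h2 : HasDerivAt (fun r : ℝ => r * β 2) (1 * β 2) 0 := (hasDerivAt_id (0 : ℝ)).mul_const _
  have h3 : HasDerivAt (fun r : ℝ => r * β 3) (1 * β 3) 0 := (hasDerivAt_id (0 : ℝ)).mul_const _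
  -- At each `t` the density is the swirl times its derivative. Both factors vanish at `r = 0`, so
  -- the product rule gives zero; the derivative in `BC` already exists and may be evaluated
  -- pointwise.
  have h4 := (h3.add (h2.mul ((primAt t).hasFDerivAt.comp_hasDerivAt (0 : ℝ) hG))).mul
    (h2.mul ((evalBC t).hasFDerivAt.comp_hasDerivAt (0 : ℝ) hG))
  have h5 := h1.congr_of_eventuallyEq (f₁ := ((fun r : ℝ => r * β 3) + (fun r => r * β 2) *
      (⇑(primAt t) ∘ fun r => solG α (S.pt (p, r • β)))) *
      ((fun r => r * β 2) * (⇑(evalBC t) ∘ fun r => solG α (S.pt (p, r • β))))) (by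
    filter_upwards [S.eventually_mem_params β hp] with r hr
    exact congrFun (S.swirl_mul_eq_raw hr) t)
  have h6 := h5.unique h4
  simp only [Pi.add_apply, Pi.mul_apply, zero_mul, mul_zero, add_zero] at h6
  exact (mul_eq_zero.1 h6).resolve_left (Real.exp_ne_zero _)

/-- This linearizes `Φ' = R - Φ²/2` at the base flow: the density does not vary to first order, and
`ρ` varies at rate `β 1` since `(β 0)²/2` is of second order. -/
theorem deriv_phi₁ (hp : (p, 0) ∈ S.params) (t : ℝ) :
    deriv (fun r : ℝ => phi₁ α (S.pt (p, r • β))) 0 t = β 1 * sechSq t -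
      phi α (baseCoord p, 0) t * deriv (fun r : ℝ => phi α (S.pt (p, r • β))) 0 t := by
  have h1 := (evalBC t).hasFDerivAt.comp_hasDerivAt (0 : ℝ)
    (S.differentiableAt_curve β (contDiffOn_phi₁ α) hp).hasDerivAt
  have h0 := (evalBC t).hasFDerivAt.comp_hasDerivAt (0 : ℝ)
    (S.differentiableAt_curve β (contDiffOn_phi α) hp).hasDerivAt
  have hρ : HasDerivAt (fun r : ℝ => p.1 2 + r * β 1 + (r * β 0) ^ 2 / 2) (β 1) 0 := by
    have hid := hasDerivAt_id (0 : ℝ)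
    refine (((hid.mul_const (β 1)).const_add (p.1 2)).add
      (((hid.mul_const (β 0)).pow 2).div_const 2)).congr_deriv ?_
    simp
  have h2 := (hasDerivAt_rhs_of_density α (S.hasDerivAt_density β hp) hρ t).sub
    ((h0.pow 2).div_const 2)
  have h3 := h1.congr_of_eventuallyEq (Filter.Eventually.of_forall fun r =>
    (phi₁_apply (S.pt (p, r • β)) t).symm)
  refine (h3.unique h2).trans ?_
  simp only [Function.comp, zero_smul, S.pt_zero hp]
  change _ - (2 : ℕ) * (phi α (baseCoord p, 0) t) ^ (2 - 1) * _ / 2 = _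
  rw [pow_one]
  push_cast
  rw [mul_assoc, mul_div_cancel_left₀ _ two_ne_zero]
  rfl

/-- Integration up to `t` is a continuous functional on `BC`, so it commutes with differentiation in
the parameter `r`. This makes the linearization of `Φ` differentiable in `t`. -/
theorem deriv_phi_eq_primitive (hp : (p, 0) ∈ S.params) (t : ℝ) :
    deriv (fun r : ℝ => phi α (S.pt (p, r • β))) 0 t =
      β 0 + ∫ s in (0 : ℝ)..t, deriv (fun r : ℝ => phi₁ α (S.pt (p, r • β))) 0 s := by
  have h1 := (primAt t).hasFDerivAt.comp_hasDerivAt (0 : ℝ)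
    (S.differentiableAt_curve β (contDiffOn_phi₁ α) hp).hasDerivAt
  have h0 := (evalBC t).hasFDerivAt.comp_hasDerivAt (0 : ℝ)
    (S.differentiableAt_curve β (contDiffOn_phi α) hp).hasDerivAt
  have h2 := (((hasDerivAt_id (0 : ℝ)).mul_const (β 0)).const_add p.2).add h1
  have h3 := h2.congr_of_eventuallyEq
    (f₁ := ⇑(evalBC t) ∘ fun r : ℝ => phi α (S.pt (p, r • β))) (by
      filter_upwards [S.eventually_mem_params β hp] with r hr
      have hy := S.pt_mem hr
      refine (eq_add_primitive (hasDerivAt_phi hy) (phi₁ α _).continuous t).trans ?_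
      rw [phi_zero hy]
      change 2 * ((p.2 + r * β 0) / 2) + _ = (p.2 + r * β 0) + _
      rw [mul_div_cancel₀ _ two_ne_zero]
      rfl)
  refine (h0.unique h3).trans ?_
  rw [one_mul]
  rfl

/-- The linearization of `Φ`, by variation of constants. -/
theorem deriv_phi_mul_sq (hp : (p, 0) ∈ S.params) (t : ℝ) :
    deriv (fun r : ℝ => phi α (S.pt (p, r • β))) 0 t * solZ α (baseCoord p, 0) t ^ 2 =
      β 0 + β 1 * ∫ s in (0 : ℝ)..t, sechSq s * solZ α (baseCoord p, 0) s ^ 2 := by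
  set Ψ := deriv (fun r : ℝ => phi α (S.pt (p, r • β))) 0
  set Ψ₁ := deriv (fun r : ℝ => phi₁ α (S.pt (p, r • β))) 0
  have hy : (baseCoord p, (0 : BC)) ∈ unitSet α := by
    have := S.pt_mem hp
    rwa [S.pt_zero hp] at this
  have hZ := isLinSol_base α p
  have hΨ : ∀ t, HasDerivAt Ψ (Ψ₁ t) t := fun t => by
    have h : (Ψ : ℝ → ℝ) = fun t => β 0 + ∫ s in (0 : ℝ)..t, Ψ₁ s :=
      funext (S.deriv_phi_eq_primitive β hp)
    rw [h]
    exact (hasDerivAt_primitive Ψ₁.continuous t).const_add _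
  -- Because `Φ = 2 Z'/Z`, the function `Z²` is an integrating factor for `Ψ' + Φ Ψ = β 1 sech²`.
  have hd : ∀ t, HasDerivAt (fun t => Ψ t * solZ α (baseCoord p, 0) t ^ 2)
      (β 1 * (sechSq t * solZ α (baseCoord p, 0) t ^ 2)) t := fun t => by
    refine ((hΨ t).mul ((hZ.deriv t).pow 2)).congr_deriv ?_
    have hne := (solZ_pos hy t).ne'
    have e : Ψ₁ t = β 1 * sechSq t - phi α (baseCoord p, 0) t * Ψ t := S.deriv_phi₁ β hp t
    rw [e, phi_apply hy, Pi.pow_apply]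
    push_cast
    field_simp
    ring
  have hcont : Continuous fun t => β 1 * (sechSq t * solZ α (baseCoord p, 0) t ^ 2) :=
    continuous_const.mul (continuous_sechSq.mul (hZ.continuous.pow 2))
  rw [eq_add_primitive hd hcont t, hZ.zero, S.deriv_phi_eq_primitive β hp 0,
    intervalIntegral.integral_const_mul]
  simp

/-- Differentiating `phi_eq_glue` in `β` expresses the linearization through the data. Comparison
with `deriv_phi_mul_sq` identifies the subtracted first order term with `∑ βᵢ Vⁱ`. -/
theorem deriv_phi_eq_glue (hp : (p, 0) ∈ S.params) (t : ℝ) :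
    deriv (fun r : ℝ => phi α (S.pt (p, r • β))) 0 t =
      cut t * (β 0 + (β 1 - p.2 * β 0) * t) +
        glue (fderiv ℝ S.data (p, 0) (0, β)).1 t := by
  have h0 := (evalBC t).hasFDerivAt.comp_hasDerivAt (0 : ℝ)
    (S.differentiableAt_curve β (contDiffOn_phi α) hp).hasDerivAt
  have hid := hasDerivAt_id (0 : ℝ)
  have h1 := ((glueAt t).comp (ContinuousLinearMap.fst ℝ DataT BC)).hasFDerivAt.comp_hasDerivAt
    (0 : ℝ) (S.hasDerivAt_data hp β)
  have h2 := ((((hid.mul_const (β 0)).const_add p.2).add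
    ((((hid.mul_const (β 1)).const_add (p.1 2)).sub_const (p.2 ^ 2 / 2)).sub
      ((hid.mul_const (β 0)).const_mul p.2) |>.mul_const t)).const_mul (cut t)).add h1
  have h3 := h2.congr_of_eventuallyEq
    (f₁ := ⇑(evalBC t) ∘ fun r : ℝ => phi α (S.pt (p, r • β))) (by
      filter_upwards [S.eventually_mem_params β hp] with r hr
      exact S.phi_eq_glue hr t)
  refine (h0.unique h3).trans ?_
  rw [one_mul, one_mul]
  rfl

theorem fderiv_data_snd (hp : (p, 0) ∈ S.params) :
    (fderiv ℝ S.data (p, 0) (0, β)).2 = β 2 • solG₁ α (baseCoord p, 0) := by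
  have h1 := (ContinuousLinearMap.snd ℝ DataT BC).hasFDerivAt.comp_hasDerivAt
    (0 : ℝ) (S.hasDerivAt_data hp β)
  have h2 := ((hasDerivAt_id (0 : ℝ)).mul_const (β 2)).smul
    (S.differentiableAt_curve β (contDiffOn_solG₁ α) hp).hasDerivAt
  refine (h1.unique h2).trans ?_
  simp only [id, zero_mul, zero_smul, zero_add, one_mul, S.pt_zero hp]

end Density

/-! ### The functions `Vⁱ` -/

section

variable {p : Param} (α : Expo)

/-- In the variable `t` the integrand is `Φ = 2 Z'/Z`, so the integral is `2 log Z`. For `b` the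
integrand is `Φ - 2 tanh t`, which adds `log sech²`. -/
theorem a_eq (hp : p ∈ I41) {x : ℝ} (hx : x ∈ Ioo (-1 : ℝ) 1) :
    a p x = 2 * Real.log (solZ α (baseCoord p, 0) (Real.artanh x)) := by
  have hy := base_mem_unitSet α hp
  have hZ := isLinSol_base α p
  have hd : ∀ t, HasDerivAt (fun t => 2 * Real.log (solZ α (baseCoord p, 0) t))
      (phi α (baseCoord p, 0) t) t := fun t => by
    refine (((hZ.deriv t).log (solZ_pos hy t).ne').const_mul 2).congr_deriv ?_
    rw [phi_apply hy]; ring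
  rw [a, integral_eq_of_artanh hd (phi α _).continuous (fun s hs => ?_) hx, hZ.zero]
  · simp
  · rw [phi_base α hp, Real.tanh_artanh hs, div_eq_mul_inv]

theorem b_eq (hp : p ∈ I41) {x : ℝ} (hx : x ∈ Ioo (-1 : ℝ) 1) :
    b p x = 2 * Real.log (solZ α (baseCoord p, 0) (Real.artanh x)) + Real.log (1 - x ^ 2) := by
  have hy := base_mem_unitSet α hp
  have hZ := isLinSol_base α p
  have hd : ∀ t, HasDerivAt (fun t => 2 * Real.log (solZ α (baseCoord p, 0) t) +
      Real.log (sechSq t)) (phi α (baseCoord p, 0) t - 2 * Real.tanh t) t := fun t => by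
    refine ((((hZ.deriv t).log (solZ_pos hy t).ne').const_mul 2).add
      ((hasDerivAt_sechSq t).log (sechSq_pos t).ne')).congr_deriv ?_
    rw [phi_apply hy]
    have := (sechSq_pos t).ne'
    field_simp
    ring
  rw [b, integral_eq_of_artanh hd ((phi α _).continuous.sub
    (continuous_const.mul continuous_tanh)) (fun s hs => ?_) hx, hZ.zero, sechSq_artanh hx]
  · simp [sechSq]
  · rw [phi_base α hp, Real.tanh_artanh hs, div_eq_mul_inv]
    ring

theorem exp_neg_a (hp : p ∈ I41) {x : ℝ} (hx : x ∈ Ioo (-1 : ℝ) 1) :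
    Real.exp (-a p x) = (solZ α (baseCoord p, 0) (Real.artanh x) ^ 2)⁻¹ := by
  have hpos := solZ_pos (base_mem_unitSet α hp) (Real.artanh x)
  rw [Real.exp_neg, a_eq α hp hx, two_mul, Real.exp_add, Real.exp_log hpos, sq]

theorem integral_exp_a (hp : p ∈ I41) {x : ℝ} (hx : x ∈ Ioo (-1 : ℝ) 1) :
    ∫ s in (0 : ℝ)..x, Real.exp (a p s) =
      ∫ s in (0 : ℝ)..Real.artanh x, sechSq s * solZ α (baseCoord p, 0) s ^ 2 := by
  have hc : Continuous fun s => sechSq s * solZ α (baseCoord p, 0) s ^ 2 :=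
    continuous_sechSq.mul ((isLinSol_base α p).continuous.pow 2)
  rw [integral_eq_of_artanh (hasDerivAt_primitive hc) hc (fun s hs => ?_) hx]
  · simp
  · have hpos := solZ_pos (base_mem_unitSet α hp) (Real.artanh s)
    have h3 := (one_sub_sq_pos hs).ne'
    rw [a_eq α hp hs, two_mul, Real.exp_add, Real.exp_log hpos, sechSq_artanh hs]
    field_simp

theorem integral_exp_neg_b (hp : p ∈ I41) {x : ℝ} (hx : x ∈ Ioo (-1 : ℝ) 1) :
    ∫ s in (0 : ℝ)..x, Real.exp (-b p s) =
      ∫ s in (0 : ℝ)..Real.artanh x, solG α (baseCoord p, 0) s := by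
  have hc := (solG α (baseCoord p, 0)).continuous
  rw [integral_eq_of_artanh (hasDerivAt_primitive hc) hc (fun s hs => ?_) hx]
  · simp
  · have hpos := solZ_pos (base_mem_unitSet α hp) (Real.artanh s)
    have h3 := one_sub_sq_pos hs
    rw [b_eq α hp hs, solG_apply (base_mem_unitSet α hp), Real.exp_neg, Real.exp_add, two_mul,
      Real.exp_add, Real.exp_log hpos, Real.exp_log h3, ← sq, mul_inv]

theorem sum_Vθ (hp : p ∈ I41) (β : EuclideanSpace ℝ (Fin 4)) {x : ℝ} (hx : x ∈ Ioo (-1 : ℝ) 1) :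
    ∑ i, β i * Vθ p i x = (solZ α (baseCoord p, 0) (Real.artanh x) ^ 2)⁻¹ * (β 0 + β 1 *
      ∫ s in (0 : ℝ)..Real.artanh x, sechSq s * solZ α (baseCoord p, 0) s ^ 2) := by
  rw [Fin.sum_univ_four]
  simp only [Vθ, Matrix.cons_val]
  rw [exp_neg_a α hp hx, integral_exp_a α hp hx]
  ring

theorem sum_Vφ (hp : p ∈ I41) (β : EuclideanSpace ℝ (Fin 4)) {x : ℝ} (hx : x ∈ Ioo (-1 : ℝ) 1) :
    ∑ i, β i * Vφ p i x =
      β 3 + β 2 * (Real.artanh x + prim₂ (solG₁ α (baseCoord p, 0)) (Real.artanh x)) := by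
  rw [Fin.sum_univ_four]
  simp only [Vφ, Matrix.cons_val]
  rw [integral_exp_neg_b α hp hx, primitive_solG (base_mem_unitSet α hp)]
  ring

end

/-! ### The family as base flow, linear part and correction. -/

namespace Density

variable {α : Expo} (S : Density α) {p : Param} {β : EuclideanSpace ℝ (Fin 4)} {ε : ℝ}
  (hε : 0 < ε) (hε1 : ε < 1)

/-- Three representations by `glue` are combined: of `Φ` at `(p, β)`, of `Φ` at `(p, 0)`, and of the
linearization. Their cutoff terms cancel because they are affine in `β`, and the linearization is `∑
βᵢ Vⁱ_θ`. -/
theorem Ubar_add_pertθ (hp : p ∈ I41) (hq : (p, β) ∈ S.corrParams) {x : ℝ}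
    (hx : x ∈ Ioo (-1 : ℝ) 1) :
    Ubar p x + pertθ p β (S.corr hε hε1 (p, β) : X ε) x =
      -2 * x + phi α (S.pt (p, β)) (Real.artanh x) := by
  have h0 := hq.2
  set t := Real.artanh x
  have hpos := solZ_pos (base_mem_unitSet α hp) t
  have hb := phi_base α hp t
  have h1 := S.phi_eq_glue hq.1 t
  have h2 := S.phi_eq_glue h0 t
  have h3 := S.deriv_phi_eq_glue β h0 t
  have h4 := S.deriv_phi_mul_sq β h0 t
  rw [S.pt_zero h0] at h2
  have h5 : glue (S.corrData (p, β)).1 t = glue (S.data (p, β)).1 t - glue (S.data (p, 0)).1 t -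
      glue (fderiv ℝ S.data (p, 0) (0, β)).1 t := by
    change glueAt t ((S.data (p, β)).1 - (S.data (p, 0)).1 - _) = _
    rw [map_sub, map_sub]
    rfl
  rw [pertθ, sum_Vθ α hp β hx, ← h4, h3, corr, dataOp_θ, pull_of_mem _ hx]
  change Ubar p x + (_ + glue (S.corrData (p, β)).1 t) = _
  rw [h5]
  rw [Real.tanh_artanh hx] at hb
  have h6 : (solZ α (baseCoord p, 0) t ^ 2)⁻¹ * ((cut t * (β 0 + (β 1 - p.2 * β 0) * t) +
      glue (fderiv ℝ S.data (p, 0) (0, β)).1 t) * solZ α (baseCoord p, 0) t ^ 2) =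
      cut t * (β 0 + (β 1 - p.2 * β 0) * t) + glue (fderiv ℝ S.data (p, 0) (0, β)).1 t := by
    field_simp
  rw [h6]
  simp only [PiLp.zero_apply] at h1 h2
  linear_combination h2 - h1 - hb

theorem pertφ_eq (hp : p ∈ I41) (hq : (p, β) ∈ S.corrParams) {x : ℝ}
    (hx : x ∈ Ioo (-1 : ℝ) 1) :
    pertφ p β (S.corr hε hε1 (p, β) : X ε) x = S.swirl (p, β) (Real.artanh x) := by
  have h0 := hq.2
  set t := Real.artanh x
  have h1 := S.swirl_eq hq.1 t
  have h2 : (S.data (p, 0)).2 = 0 := by simp [data]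
  have h3 : prim₂ (S.corrData (p, β)).2 t =
      prim₂ (S.data (p, β)).2 t - β 2 * prim₂ (solG₁ α (baseCoord p, 0)) t := by
    change prim₂ ((S.data (p, β)).2 - (S.data (p, 0)).2 - _) t = _
    rw [h2, sub_zero, S.fderiv_data_snd β h0, prim₂_sub, prim₂_smul]
  rw [pertφ, sum_Vφ α hp β hx, corr, dataOp_φ, pull_of_mem _ hx, h3, h1]
  ring

end Density

/-! ## Uniqueness -/

/-- By the mean value theorem on `[t, t + 1]`, the derivative takes the value `F(t + 1) - F(t)`,
which tends to `0`, at points tending to infinity. -/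
theorem eq_zero_of_tendsto_deriv {F F₁ : ℝ → ℝ} {l L : ℝ} (hF : ∀ t, HasDerivAt F (F₁ t) t)
    (hl : Filter.Tendsto F Filter.atTop (𝓝 l)) (hL : Filter.Tendsto F₁ Filter.atTop (𝓝 L)) :
    L = 0 := by
  have h : ∀ t : ℝ, ∃ c ∈ Ioo t (t + 1), F₁ c = (F (t + 1) - F t) / (t + 1 - t) := fun t =>
    exists_hasDerivAt_eq_slope F F₁ (by linarith)
      (fun s _ => (hF s).continuousAt.continuousWithinAt) fun s _ => hF s
  choose c hc hcF using h
  have h1 : Filter.Tendsto c Filter.atTop Filter.atTop :=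
    Filter.tendsto_atTop_mono (fun t => (hc t).1.le) Filter.tendsto_id
  have h2 : Filter.Tendsto (fun t => F (t + 1) - F t) Filter.atTop (𝓝 (l - l)) :=
    (hl.comp (Filter.tendsto_atTop_add_const_right _ 1 Filter.tendsto_id)).sub hl
  rw [sub_self] at h2
  refine tendsto_nhds_unique ((hL.comp h1).congr fun t => ?_) h2
  rw [Function.comp, hcF]
  simp

theorem eq_zero_of_tendsto_deriv_atBot {F F₁ : ℝ → ℝ} {l L : ℝ}
    (hF : ∀ t, HasDerivAt F (F₁ t) t) (hl : Filter.Tendsto F Filter.atBot (𝓝 l))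
    (hL : Filter.Tendsto F₁ Filter.atBot (𝓝 L)) : L = 0 := by
  have h := eq_zero_of_tendsto_deriv (F := fun t => F (-t)) (F₁ := fun t => -F₁ (-t))
    (fun t => ((hF (-t)).comp t (hasDerivAt_neg t)).congr_deriv (by ring))
    (hl.comp Filter.tendsto_neg_atTop_atBot) (hL.comp Filter.tendsto_neg_atTop_atBot).neg
  linarith

theorem tendsto_tanh_atTop : Filter.Tendsto Real.tanh Filter.atTop (𝓝 1) := by
  refine tendsto_order.2 ⟨fun x hx => ?_, fun x hx =>
    Filter.Eventually.of_forall fun t => (tanh_mem_Ioo t).2.trans hx⟩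
  have hm : max x 0 ∈ Ioo (-1 : ℝ) 1 :=
    ⟨lt_of_lt_of_le (by norm_num) (le_max_right _ _), max_lt hx one_pos⟩
  filter_upwards [Filter.eventually_gt_atTop (Real.artanh (max x 0))] with t ht
  calc x ≤ max x 0 := le_max_left _ _
    _ = Real.tanh (Real.artanh (max x 0)) := (Real.tanh_artanh hm).symm
    _ < Real.tanh t := strictMono_tanh ht

theorem tendsto_tanh_atBot : Filter.Tendsto Real.tanh Filter.atBot (𝓝 (-1)) := by
  have h := (tendsto_tanh_atTop.comp Filter.tendsto_neg_atBot_atTop).neg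
  refine h.congr fun t => ?_
  simp [Real.tanh_neg]

section

variable {chat : Fin 3 → ℝ} {Uθ Uφ : ℝ → ℝ}

theorem IsReducedSolution.hasDerivAt_φ (hU : IsReducedSolution chat Uθ Uφ) (t : ℝ) :
    HasDerivAt (fun t => Uφ (Real.tanh t)) (deriv Uφ (Real.tanh t) * sechSq t) t :=
  ((contDiffAt_of_Ioo hU.2.1 (tanh_mem_Ioo t)).differentiableAt two_ne_zero).hasDerivAt.comp t
    (hasDerivAt_tanh t)

theorem IsReducedSolution.hasDerivAt_φ₁ (hU : IsReducedSolution chat Uθ Uφ) (t : ℝ) :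
    HasDerivAt (fun t => deriv Uφ (Real.tanh t) * sechSq t)
      (-((2 * Real.tanh t + Uθ (Real.tanh t)) * (deriv Uφ (Real.tanh t) * sechSq t))) t := by
  have hx := tanh_mem_Ioo t
  have h1 : ContDiffOn ℝ 1 (deriv Uφ) (Ioo (-1) 1) :=
    ((contDiffOn_succ_iff_deriv_of_isOpen (n := 1) isOpen_Ioo).1
      (by simpa [one_add_one_eq_two] using hU.2.1)).2.2
  have h2 := ((contDiffAt_of_Ioo h1 hx).differentiableAt one_ne_zero).hasDerivAt
  have h3 := (hU.2.2 _ hx).2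
  rw [one_sub_tanh_sq] at h3
  refine ((h2.comp t (hasDerivAt_tanh t)).mul (hasDerivAt_sechSq t)).congr_deriv ?_
  simp only [Function.comp]
  linear_combination sechSq t * h3

theorem IsReducedSolution.hasDerivAt_θ (hU : IsReducedSolution chat Uθ Uφ) (t : ℝ) :
    HasDerivAt (fun t => 2 * Real.tanh t + Uθ (Real.tanh t)) (P chat (Real.tanh t) + 2 -
      (∫ s in (0 : ℝ)..t, psiInt (fun t => Uφ (Real.tanh t) *
        (deriv Uφ (Real.tanh t) * sechSq t)) s) -
      (2 * Real.tanh t + Uθ (Real.tanh t)) ^ 2 / 2) t := by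
  have hx := tanh_mem_Ioo t
  have h2 := ((contDiffAt_of_Ioo hU.1 hx).differentiableAt one_ne_zero).hasDerivAt
  have h3 := (hU.2.2 _ hx).1
  rw [psi_eq (G := fun t => Uφ (Real.tanh t)) (fun x hx => by rw [Real.tanh_artanh hx])
    hU.hasDerivAt_φ (continuous_iff_continuousAt.2 fun t => (hU.hasDerivAt_φ₁ t).continuousAt) hx,
    Real.artanh_tanh, one_sub_tanh_sq] at h3
  refine (((hasDerivAt_tanh t).const_mul 2).add (h2.comp t (hasDerivAt_tanh t))).congr_deriv ?_
  have := one_sub_tanh_sq t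
  linear_combination h3 - 2 * this

/-- The bound on the density makes `ψ` converge at the poles, so `Φ'` has limits at `±∞`, which must
be `0` since `Φ → 0`. These two relations determine `ĉ₁` and `ĉ₂`; the free constant `ĉ₃` is renamed
by `ρ = R(0)`. -/
theorem IsReducedSolution.exists_isSwirlPair (hU : IsReducedSolution chat Uθ Uφ) (α : Expo)
    {h : BC} (hh : ∀ t, raw α h t = Uφ (Real.tanh t) * (deriv Uφ (Real.tanh t) * sechSq t))
    (hp : Filter.Tendsto (fun t => 2 * Real.tanh t + Uθ (Real.tanh t)) Filter.atTop (𝓝 0))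
    (hm : Filter.Tendsto (fun t => 2 * Real.tanh t + Uθ (Real.tanh t)) Filter.atBot (𝓝 0)) :
    ∃ ρ, IsSwirlPair ρ (fun t => 2 * Real.tanh t + Uθ (Real.tanh t))
      (fun t => Uφ (Real.tanh t)) (fun t => deriv Uφ (Real.tanh t) * sechSq t) := by
  have hθ := hU.hasDerivAt_θ
  rw [← funext hh] at hθ
  set y := psiInt (raw α h) with hy
  have hPc : Continuous (P chat) := by unfold P; fun_prop
  have lp : 2 * chat 1 + 2 - limPlus y = 0 := by
    refine eq_zero_of_tendsto_deriv hθ hp ?_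
    have h1 := (((hPc.tendsto 1).comp tendsto_tanh_atTop).add_const 2).sub
      (tendsto_primitive_limPlus (integrableOn_Ioi_psiInt_raw α h))
    have h2 := h1.sub ((hp.pow 2).div_const 2)
    have e : P chat 1 = 2 * chat 1 := by rw [P]; ring
    rw [e, zero_pow two_ne_zero, zero_div, sub_zero] at h2
    exact h2
  have lm : 2 * chat 0 + 2 - limMinus y = 0 := by
    refine eq_zero_of_tendsto_deriv_atBot hθ hm ?_
    have h1 := (((hPc.tendsto (-1)).comp tendsto_tanh_atBot).add_const 2).sub
      (tendsto_primitive_limMinus (integrableOn_Iic_psiInt_raw α h))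
    have h2 := h1.sub ((hm.pow 2).div_const 2)
    have e : P chat (-1) = 2 * chat 0 := by rw [P]; ring
    rw [e, zero_pow two_ne_zero, zero_div, sub_zero] at h2
    exact h2
  refine ⟨chat 2 + (limPlus y + limMinus y) / 2, fun t => (hθ t).congr_deriv ?_,
    hU.hasDerivAt_φ, hU.hasDerivAt_φ₁⟩
  rw [← funext hh, rhs, interp, ← one_sub_tanh_sq, P]
  linear_combination ((1 + Real.tanh t) / 2) * lp + ((1 - Real.tanh t) / 2) * lm

end

/-- The construction is run backwards: `exp (½ ∫ Φ)` and `solZ` solve the same initial value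
problem, hence agree, and then `G₁ Z²` is constant. So the density has the form prescribed by
`fixE`. -/
theorem IsSwirlPair.fixE_eq_zero {α : Expo} {ρ : ℝ} {Φ G G₁ : ℝ → ℝ} {h : BC} {y : Coord}
    (hs : IsSwirlPair ρ Φ G G₁) (hh : ∀ t, raw α h t = G t * G₁ t)
    (hy : y = (ρ, Φ 0 / 2, G₁ 0 * G 0, G₁ 0 ^ 2)) (hu : (y, h) ∈ unitSet α) :
    fixE α (y, h) = 0 ∧ (∀ t, phi α (y, h) t = Φ t) ∧
      ∀ t, G t = G 0 + G₁ 0 * ∫ s in (0 : ℝ)..t, solG α (y, h) s := by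
  have hθ := hs.θ
  rw [← funext hh] at hθ
  have hZ := isLinSol_exp hθ
  have hZ' := isLinSol_solZ α (y, h)
  have h1 : IsLinSol (fun t => rhs ρ (raw α h) t / 2) (solZ α (y, h)) (solZ₁ α (y, h)) := by
    rw [hy] at hZ' ⊢; exact hZ'
  have hpos := solZ_pos hu
  have e0 := hZ.unique h1 (fun t => Real.exp_pos _) (by rw [solZ₁_zero, hy]; simp)
  have e1 : ∀ t, solZ₁ α (y, h) t = Φ t / 2 * solZ α (y, h) t := fun t => by
    have := h1.deriv t
    rw [funext e0] at this
    rw [this.unique (hZ.deriv t), e0]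
  have hphi : ∀ t, phi α (y, h) t = Φ t := fun t => by
    have := (hpos t).ne'
    rw [phi_apply hu, e1]
    field_simp
  have hG₁ : ∀ t, G₁ t = G₁ 0 * solG α (y, h) t := fun t => by
    have h2 := eq_of_hasDerivAt_zero (F := fun t => G₁ t * solZ α (y, h) t ^ 2) (fun t => by
      refine ((hs.φ₁ t).mul ((h1.deriv t).pow 2)).congr_deriv ?_
      rw [e1, Pi.pow_apply]
      push_cast
      ring) t
    have h3 := pow_pos (hpos t) 2
    rw [h1.zero] at h2
    rw [solG_apply hu, eq_mul_inv_iff_mul_eq₀ h3.ne', h2]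
    ring
  have hG : ∀ t, G t = G 0 + G₁ 0 * ∫ s in (0 : ℝ)..t, solG α (y, h) s := fun t => by
    rw [eq_add_primitive hs.φ hs.continuous_φ₁ t,
      intervalIntegral.integral_congr (g := fun s => G₁ 0 * solG α (y, h) s) fun s _ => hG₁ s,
      intervalIntegral.integral_const_mul]
  refine ⟨(fixE_eq_zero_iff hu).2 fun t => ?_, hphi, hG⟩
  simp only [← solG_apply hu]
  rw [hh t, hG t, hG₁ t, hy]
  ring

/-! ### Bounds from the norm of `X` -/

section

variable {ε : ℝ}

theorem logWeight_zero_ge : 1 ≤ logWeight 0 := by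
  have h : 1 ≤ Real.log 3 := by
    rw [Real.le_log_iff_exp_le (by norm_num)]
    linarith [Real.exp_one_lt_d9]
  have h2 : logWeight 0 = Real.log 3 * Real.log 3 := by
    rw [logWeight, add_zero, sub_zero, one_div, Real.log_inv]; ring
  rw [h2]
  nlinarith

theorem X.abs_θ_zero_le (V : X ε) : |X.θ V 0| ≤ ‖V‖ := by
  have h := le_supNorm V.fst.mem.bdd0 artanh_zero_mem
  have hn := supNorm_nonneg
  have h1 := V.norm_eq
  have h2 := M1.norm_def V.fst
  have h3 := norm_nonneg V.snd
  have h4 := logWeight_zero_ge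
  rw [abs_mul, abs_of_nonneg (by linarith)] at h
  have h5 : |X.θ V 0| ≤ logWeight 0 * |V.fst.fn 0| :=
    le_mul_of_one_le_left (abs_nonneg _) h4
  linarith [hn (Ioo (-1) 1) (fun x => (1 - x ^ 2) * logWeight x ^ 2 * deriv V.fst.fn x),
    hn (Ioo (-1 / 2) (1 / 2)) (iteratedDeriv 2 V.fst.fn),
    hn (Ioo (-1 / 2) (1 / 2)) (iteratedDeriv 3 V.fst.fn)]

theorem X.abs_deriv_θ_zero_le (V : X ε) : |deriv (X.θ V) 0| ≤ ‖V‖ := by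
  have h := le_supNorm V.fst.mem.bdd1 artanh_zero_mem
  have hn := supNorm_nonneg
  have h1 := V.norm_eq
  have h2 := M1.norm_def V.fst
  have h3 := norm_nonneg V.snd
  have h4 : 1 ≤ logWeight 0 ^ 2 := one_le_pow₀ logWeight_zero_ge
  rw [abs_mul, zero_pow two_ne_zero, sub_zero, one_mul, abs_of_nonneg (by linarith)] at h
  have h5 : |deriv (X.θ V) 0| ≤ logWeight 0 ^ 2 * |deriv V.fst.fn 0| :=
    le_mul_of_one_le_left (abs_nonneg _) h4
  linarith [hn (Ioo (-1) 1) (fun x => logWeight x * V.fst.fn x),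
    hn (Ioo (-1 / 2) (1 / 2)) (iteratedDeriv 2 V.fst.fn),
    hn (Ioo (-1 / 2) (1 / 2)) (iteratedDeriv 3 V.fst.fn)]

theorem sechSq_rpow_ge (hε : 0 < ε) (t : ℝ) : Real.exp (-(2 * ε) * |t|) ≤ sechSq t ^ ε := by
  have h := Real.rpow_le_rpow (Real.exp_pos _).le (le_sechSq t) hε.le
  rw [← Real.exp_mul] at h
  refine le_trans (le_of_eq ?_) h
  congr 1; ring

/-- The weight of `M₂` is at least `exp (-2 ε |t|)`, so the swirl grows at most at rate `2 ε`. Its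
`t`-derivative obeys the same bound, the additional weight `1 - x²` being the Jacobian; the density
thus has rate at most `4 ε`. -/
theorem X.abs_φ_le (hε : 0 < ε) (V : X ε) (t : ℝ) :
    |X.φ V (Real.tanh t)| ≤ ‖V‖ * Real.exp (2 * ε * |t|) := by
  have h := le_supNorm V.snd.mem.bdd0 (tanh_mem_Ioo t)
  have hn := supNorm_nonneg
  have h1 := V.norm_eq
  have h2 := M2.norm_def V.snd
  have h3 := norm_nonneg V.fst
  rw [one_sub_tanh_sq, abs_mul, abs_of_nonneg (Real.rpow_nonneg (sechSq_pos t).le _)] at h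
  have h4 : Real.exp (-(2 * ε) * |t|) * |X.φ V (Real.tanh t)| ≤ ‖V‖ := by
    refine (mul_le_mul_of_nonneg_right (sechSq_rpow_ge hε t) (abs_nonneg _)).trans (h.trans ?_)
    linarith [hn (Ioo (-1) 1) (fun x => (1 - x ^ 2) ^ (1 + ε) * deriv V.snd.fn x),
      hn (Ioo (-1) 1) (fun x => (1 - x ^ 2) ^ (2 + ε) * iteratedDeriv 2 V.snd.fn x)]
  rw [neg_mul, Real.exp_neg, inv_mul_le_iff₀ (Real.exp_pos _)] at h4
  linarith

theorem X.abs_deriv_φ_le (hε : 0 < ε) (V : X ε) (t : ℝ) :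
    |deriv (X.φ V) (Real.tanh t) * sechSq t| ≤ ‖V‖ * Real.exp (2 * ε * |t|) := by
  have h := le_supNorm V.snd.mem.bdd1 (tanh_mem_Ioo t)
  have hn := supNorm_nonneg
  have h1 := V.norm_eq
  have h2 := M2.norm_def V.snd
  have h3 := norm_nonneg V.fst
  rw [one_sub_tanh_sq, Real.rpow_add (sechSq_pos t), Real.rpow_one, mul_comm (sechSq t), mul_assoc,
    abs_mul, abs_of_nonneg (Real.rpow_nonneg (sechSq_pos t).le _), mul_comm (sechSq t)] at h
  have h4 : Real.exp (-(2 * ε) * |t|) * |deriv (X.φ V) (Real.tanh t) * sechSq t| ≤ ‖V‖ := by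
    refine (mul_le_mul_of_nonneg_right (sechSq_rpow_ge hε t) (abs_nonneg _)).trans (h.trans ?_)
    linarith [hn (Ioo (-1) 1) (fun x => (1 - x ^ 2) ^ ε * V.snd.fn x),
      hn (Ioo (-1) 1) (fun x => (1 - x ^ 2) ^ (2 + ε) * iteratedDeriv 2 V.snd.fn x)]
  rw [neg_mul, Real.exp_neg, inv_mul_le_iff₀ (Real.exp_pos _)] at h4
  linarith

/-- The density of an element of `X`. -/
theorem X.exists_density (hε : 0 < ε) (α : Expo) (hα : (α : ℝ) = 4 * ε) (V : X ε)
    (hc : Continuous fun t => X.φ V (Real.tanh t) * (deriv (X.φ V) (Real.tanh t) * sechSq t)) :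
    ∃ h : BC, ‖h‖ ≤ ‖V‖ ^ 2 ∧
      ∀ t, raw α h t = X.φ V (Real.tanh t) * (deriv (X.φ V) (Real.tanh t) * sechSq t) := by
  set H := fun t => X.φ V (Real.tanh t) * (deriv (X.φ V) (Real.tanh t) * sechSq t)
  have hb : ∀ t, |Real.exp (-(α * |t|)) * H t| ≤ ‖V‖ ^ 2 := fun t => by
    have h1 := mul_le_mul (X.abs_φ_le hε V t) (X.abs_deriv_φ_le hε V t) (abs_nonneg _)
      (by positivity)
    rw [← abs_mul] at h1
    have h2 : ‖V‖ * Real.exp (2 * ε * |t|) * (‖V‖ * Real.exp (2 * ε * |t|)) =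
        ‖V‖ ^ 2 * Real.exp (α * |t|) := by
      rw [hα, show 4 * ε * |t| = 2 * ε * |t| + 2 * ε * |t| by ring, Real.exp_add]; ring
    rw [h2] at h1
    rw [abs_mul, abs_of_pos (Real.exp_pos _), Real.exp_neg, inv_mul_le_iff₀ (Real.exp_pos _),
      mul_comm]
    exact h1
  have hcc : Continuous fun t => Real.exp (-(α * |t|)) * H t :=
    Continuous.mul (by fun_prop) hc
  refine ⟨mkBC _ hcc _ hb, BC.norm_le (by positivity) hb, fun t => ?_⟩
  rw [raw, mkBC_apply, ← mul_assoc, ← Real.exp_add, add_neg_cancel, Real.exp_zero, one_mul]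

theorem M1.tendsto_tanh (f : M1) :
    Filter.Tendsto (fun t => f.fn (Real.tanh t)) Filter.atTop (𝓝 0) ∧
      Filter.Tendsto (fun t => f.fn (Real.tanh t)) Filter.atBot (𝓝 0) := by
  have key : ∀ (l : Filter ℝ) (x : ℝ), x ∈ Icc (-1 : ℝ) 1 → f.fn x = 0 →
      Filter.Tendsto Real.tanh l (𝓝 x) →
      Filter.Tendsto (fun t => f.fn (Real.tanh t)) l (𝓝 0) := fun l x hx h0 hl => by
    rw [← h0]
    refine (f.mem.cont x hx).tendsto.comp (tendsto_nhdsWithin_iff.2 ⟨hl, ?_⟩)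
    exact Filter.Eventually.of_forall fun t => Ioo_subset_Icc_self (tanh_mem_Ioo t)
  exact ⟨key _ 1 (by norm_num) (f.mem.zero_off _ (by norm_num)) tendsto_tanh_atTop,
    key _ (-1) (by norm_num) (f.mem.zero_off _ (by norm_num)) tendsto_tanh_atBot⟩

end

/-- Solutions close to a solution without swirl satisfy the fixed point equation. -/
theorem exists_coord_of_isReducedSolution {ε : ℝ} (hε : 0 < ε) (α : Expo) (hα : (α : ℝ) = 4 * ε)
    {p : Param} (hp : p ∈ I41) (V : X ε) {chat : Fin 3 → ℝ}
    (hU : IsReducedSolution chat (fun x => Ubar p x + X.θ V x) (X.φ V)) :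
    ∃ (β : EuclideanSpace ℝ (Fin 4)) (h : BC), ‖β‖ ≤ (4 + |p.2|) * ‖V‖ ∧ ‖h‖ ≤ ‖V‖ ^ 2 ∧
      ((coord (p, β), h) ∈ unitSet α → fixE α (coord (p, β), h) = 0 ∧
        (∀ x ∈ Ioo (-1 : ℝ) 1, Ubar p x + X.θ V x =
          -2 * x + phi α (coord (p, β), h) (Real.artanh x)) ∧
        ∀ x ∈ Ioo (-1 : ℝ) 1, X.φ V x =
          β 3 + β 2 * ∫ s in (0 : ℝ)..Real.artanh x, solG α (coord (p, β), h) s) := by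
  have hφc : Continuous fun t => X.φ V (Real.tanh t) :=
    continuous_iff_continuousAt.2 fun t => (hU.hasDerivAt_φ t).continuousAt
  have hφ₁c : Continuous fun t => deriv (X.φ V) (Real.tanh t) * sechSq t :=
    continuous_iff_continuousAt.2 fun t => (hU.hasDerivAt_φ₁ t).continuousAt
  obtain ⟨h, hhn, hh⟩ := X.exists_density hε α hα V (hφc.mul hφ₁c)
  have hbase := base_mem_unitSet α hp
  have hl := tendsto_invW_mul (phiW α (baseCoord p, 0))
  have hphi : ∀ t, (invW * phiW α (baseCoord p, 0)) t =
    2 * Real.tanh t + Ubar p (Real.tanh t) := phi_base α hp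
  have hf := M1.tendsto_tanh V.fst
  obtain ⟨ρ, hs⟩ := hU.exists_isSwirlPair α hh
    (by
      have := (hl.1.congr hphi).add hf.1
      rw [add_zero] at this
      exact this.congr fun t => by rw [add_assoc]; rfl)
    (by
      have := (hl.2.congr hphi).add hf.2
      rw [add_zero] at this
      exact this.congr fun t => by rw [add_assoc]; rfl)
  obtain ⟨hUb, hU0⟩ := Ubar_spec hp
  -- The vector `β` is read off at `x = 0`, where the correction and its first derivatives vanish.
  -- There `V¹_θ` has value `1` and derivative `-γ`, while `V²_θ` has value `0` and derivative `1`;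
  -- this explains the second entry.
  set β : EuclideanSpace ℝ (Fin 4) := !₂[X.θ V 0, deriv (X.θ V) 0 + p.2 * X.θ V 0,
    deriv (X.φ V) 0, X.φ V 0] with hβ
  have b0 : β 0 = X.θ V 0 := rfl
  have b1 : β 1 = deriv (X.θ V) 0 + p.2 * X.θ V 0 := rfl
  have b2 : β 2 = deriv (X.φ V) 0 := rfl
  have b3 : β 3 = X.φ V 0 := rfl
  have s0 : sechSq 0 = 1 := by simp [sechSq]
  have hρ : ρ = p.1 2 + β 1 + β 0 ^ 2 / 2 := by
    have h1 := hs.θ 0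
    have h2 := hUb.hasDerivAt_tanh (I41_fst_zero hp) (I41_fst_one hp) 0
    have h3 : HasDerivAt (fun t => X.θ V (Real.tanh t)) (deriv (X.θ V) 0) 0 := by
      have hd : HasDerivAt (X.θ V) (deriv (X.θ V) 0) (Real.tanh 0) := by
        rw [Real.tanh_zero]
        exact ((contDiffAt_of_Ioo V.fst.mem.c1 artanh_zero_mem).differentiableAt
          one_ne_zero).hasDerivAt
      exact (hd.comp 0 (hasDerivAt_tanh 0)).congr_deriv (by rw [s0, mul_one])
    have h4 := h1.unique ((h2.add h3).congr_of_eventuallyEq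
      (Filter.Eventually.of_forall fun t => (add_assoc _ _ _).symm))
    rw [rhs_zero, Real.tanh_zero, hU0, s0] at h4
    rw [b0, b1]
    linear_combination h4
  have hcoord : coord (p, β) = (ρ, (2 * Real.tanh 0 + (Ubar p (Real.tanh 0) +
      X.θ V (Real.tanh 0))) / 2, deriv (X.φ V) (Real.tanh 0) * sechSq 0 * X.φ V (Real.tanh 0),
      (deriv (X.φ V) (Real.tanh 0) * sechSq 0) ^ 2) := by
    rw [Real.tanh_zero, s0, hU0, hρ, mul_zero, zero_add, mul_one]
    rfl
  refine ⟨β, h, ?_, hhn, fun hu => ?_⟩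
  · have n0 := X.abs_θ_zero_le V
    have n1 := X.abs_deriv_θ_zero_le V
    have n2 := X.abs_deriv_φ_le hε V 0
    have n3 := X.abs_φ_le hε V 0
    rw [Real.tanh_zero, s0, mul_one, abs_zero, mul_zero, Real.exp_zero, mul_one] at n2
    rw [Real.tanh_zero, abs_zero, mul_zero, Real.exp_zero, mul_one] at n3
    have hsum : ‖β‖ ≤ |β 0| + |β 1| + |β 2| + |β 3| := by
      rw [EuclideanSpace.norm_eq, Fin.sum_univ_four]
      refine Real.sqrt_le_iff.2 ⟨by positivity, ?_⟩
      simp only [Real.norm_eq_abs]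
      have := abs_nonneg (β 0)
      have := abs_nonneg (β 1)
      have := abs_nonneg (β 2)
      have := abs_nonneg (β 3)
      nlinarith [mul_nonneg (abs_nonneg (β 0)) (abs_nonneg (β 1)),
        mul_nonneg (abs_nonneg (β 0)) (abs_nonneg (β 2)),
        mul_nonneg (abs_nonneg (β 0)) (abs_nonneg (β 3)),
        mul_nonneg (abs_nonneg (β 1)) (abs_nonneg (β 2)),
        mul_nonneg (abs_nonneg (β 1)) (abs_nonneg (β 3)),
        mul_nonneg (abs_nonneg (β 2)) (abs_nonneg (β 3))]
    have n4 : |β 1| ≤ ‖V‖ + |p.2| * ‖V‖ := by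
      rw [b1]
      refine (abs_add_le _ _).trans (add_le_add n1 ?_)
      rw [abs_mul]
      gcongr
    rw [b0, b2, b3] at hsum
    linarith
  · obtain ⟨h1, h2, h3⟩ := hs.fixE_eq_zero hh hcoord hu
    refine ⟨h1, fun x hx => ?_, fun x hx => ?_⟩
    · rw [h2, Real.tanh_artanh hx]; ring
    · have := h3 (Real.artanh x)
      rw [Real.tanh_artanh hx, Real.tanh_zero, s0, mul_one] at this
      exact this

/-! ## The theorem -/

theorem exists_ball_of_isCompact {E F : Type*} [TopologicalSpace E] [NormedAddCommGroup F]
    {K : Set E} (hK : IsCompact K) {n : Set (E × F)} (hn : IsOpen n) (h : ∀ p ∈ K, (p, (0 : F)) ∈ n) :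
    ∃ δ : ℝ, 0 < δ ∧ ∀ p ∈ K, ∀ v : F, ‖v‖ < δ → (p, v) ∈ n := by
  obtain ⟨u, v, -, hv, hKu, h0v, huv⟩ := generalized_tube_lemma hK
    (isCompact_singleton (x := (0 : F))) hn (by
      rintro ⟨p, w⟩ ⟨hp, hw⟩
      have hw0 : w = 0 := hw
      rw [hw0]
      exact h p hp)
  obtain ⟨δ, hδ, hb⟩ := Metric.isOpen_iff.1 hv 0 (h0v rfl)
  exact ⟨δ, hδ, fun p hp w hw => huv ⟨hKu hp, hb (by simpa using hw)⟩⟩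

theorem continuous_baseCoord : Continuous baseCoord := by
  unfold baseCoord
  fun_prop

end LogSwirl

end

theorem theorem5p1 (ε : ℝ) (hε0 : 0 < ε) (hε1 : ε < 1 / 2)
    (K : Set ((Fin 3 → ℝ) × ℝ)) (hK : IsCompact K) (hKI : K ⊆ I41) :
    ∃ δ : ℝ, 0 < δ ∧
    ∃ V : ((Fin 3 → ℝ) × ℝ) × EuclideanSpace ℝ (Fin 4) → X1 ε,
      SmoothOn V (K ×ˢ Metric.ball 0 δ) ∧
      (∀ p ∈ K, V (p, 0) = 0) ∧
      (∀ p ∈ K, ∀ i : Fin 4,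
        HasDerivAt (fun t : ℝ => V (p, EuclideanSpace.single i t)) 0 0) ∧
      (∀ p ∈ K, ∀ β ∈ Metric.ball (0 : EuclideanSpace ℝ (Fin 4)) δ,
        IsReducedSolution
          (cHat p (pertθ p β (V (p, β) : X ε)) (pertφ p β (V (p, β) : X ε)))
          (fun x => Ubar p x + pertθ p β (V (p, β) : X ε) x)
          (pertφ p β (V (p, β) : X ε))) ∧
      ∃ δ' : ℝ, 0 < δ' ∧
        ∀ p ∈ K, ∀ Ut : X ε, ‖Ut‖ < δ' →
          (∃ chat : Fin 3 → ℝ,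
            IsReducedSolution chat (fun x => Ubar p x + X.θ Ut x) (X.φ Ut)) →
          ∃ β : EuclideanSpace ℝ (Fin 4), ‖β‖ < δ ∧
            ∀ x ∈ Set.Ioo (-1 : ℝ) 1,
              X.θ Ut x = pertθ p β (V (p, β) : X ε) x ∧
              X.φ Ut x = pertφ p β (V (p, β) : X ε) x := by
  have hε2 : ε < 1 := by linarith
  -- The swirl and its `t`-derivative each have growth rate `2 ε`, so the density has rate `4 ε`; it
  -- is admissible because `ε < 1/2`.
  let α : Expo := ⟨4 * ε, by constructor <;> linarith⟩
  obtain ⟨O, s, N, hO, hCO, hs, hN, hCN, hNu, hON, huniq⟩ := exists_density α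
    (hK.image continuous_baseCoord) (by rintro _ ⟨p, -, rfl⟩; rfl)
    (by rintro _ ⟨p, hp, rfl⟩; exact base_mem_unitSet α (hKI hp))
  let S : Density α := ⟨O, s, hO, hs, fun y hy => hNu (hON y hy).1, fun y hy => (hON y hy).2⟩
  have hS : ∀ p ∈ K, (p, (0 : EuclideanSpace ℝ (Fin 4))) ∈ S.params := fun p hp => by
    change coord (p, 0) ∈ O
    rw [coord_zero]
    exact hCO (mem_image_of_mem _ hp)
  obtain ⟨δ, hδ, hmem⟩ := exists_ball_of_isCompact hK S.isOpen_corrParams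
    fun p hp => ⟨hS p hp, hS p hp⟩
  refine ⟨δ, hδ, S.corr hε0 hε2, ⟨S.corrParams, S.isOpen_corrParams, ?_,
    S.contDiffOn_corr hε0 hε2⟩, fun p _ => S.corr_zero hε0 hε2 p,
    fun p hp i => S.hasDerivAt_corr hε0 hε2 (hS p hp) i, fun p hp β hβ => ?_, ?_⟩
  · rintro ⟨p, β⟩ ⟨hp, hβ⟩
    exact hmem p hp β (by simpa using hβ)
  · have hq := hmem p hp β (by simpa using hβ)
    have hpair := S.isSwirlPair hq.1
    rw [hpair.cHat_eq (hKI hp) (fun x hx => S.Ubar_add_pertθ hε0 hε2 (hKI hp) hq hx)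
      fun x hx => S.pertφ_eq hε0 hε2 (hKI hp) hq hx]
    exact hpair.isReducedSolution (fun x hx => S.Ubar_add_pertθ hε0 hε2 (hKI hp) hq hx)
      fun x hx => S.pertφ_eq hε0 hε2 (hKI hp) hq hx
  · have hn : IsOpen {z : Param × (EuclideanSpace ℝ (Fin 4) × BC) |
        (coord (z.1, z.2.1), z.2.2) ∈ N} :=
      hN.preimage ((contDiff_coord.continuous.comp (by fun_prop)).prodMk (by fun_prop))
    obtain ⟨δ₁, hδ₁, hmem₁⟩ := exists_ball_of_isCompact hK hn fun p hp => by
      change (coord (p, 0), (0 : BC)) ∈ N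
      rw [coord_zero]
      exact hCN _ (mem_image_of_mem _ hp)
    obtain ⟨Γ, hΓ⟩ := hK.exists_bound_of_continuousOn (f := Prod.snd) continuous_snd.continuousOn
    have hΓ0 : 0 < 4 + |Γ| := by positivity
    -- The quotient controls `β`, whose norm is at most `(4 + |γ|) ‖Ut‖`. The bound `1` turns the
    -- estimate `‖Ut‖²` for the density into `‖Ut‖`.
    refine ⟨min 1 (min δ δ₁ / (4 + |Γ|)), lt_min one_pos (div_pos (lt_min hδ hδ₁) hΓ0),
      fun p hp Ut hUt => ?_⟩
    rintro ⟨chat, hU⟩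
    obtain ⟨β, h, hβ, hh, hsol⟩ := exists_coord_of_isReducedSolution hε0 α rfl (hKI hp) Ut hU
    have hn1 : ‖Ut‖ < 1 := hUt.trans_le (min_le_left _ _)
    have hn2 : ‖Ut‖ * (4 + |Γ|) < min δ δ₁ :=
      (lt_div_iff₀ hΓ0).1 (hUt.trans_le (min_le_right _ _))
    have hn0 := norm_nonneg Ut
    have hβ' : ‖β‖ < min δ δ₁ := by
      refine (hβ.trans ?_).trans_lt hn2
      rw [mul_comm]
      have h1 : |p.2| ≤ |Γ| := (hΓ p hp).trans (le_abs_self Γ)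
      gcongr
    have hh' : ‖h‖ < δ₁ := by
      have h1 : ‖Ut‖ ≤ ‖Ut‖ * (4 + |Γ|) :=
        le_mul_of_one_le_right hn0 (by linarith [abs_nonneg Γ])
      have h2 := min_le_right δ δ₁
      nlinarith
    have hβδ : ‖β‖ < δ := hβ'.trans_le (min_le_left _ _)
    have hyN : (coord (p, β), h) ∈ N := hmem₁ p hp (β, h)
      (max_lt (hβ'.trans_le (min_le_right _ _)) hh')
    obtain ⟨hfix, hθ, hφ⟩ := hsol (hNu hyN)
    -- The density of the given solution is now the one of the family at `(p, β)`, so both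
    -- components coincide with those of the family.
    obtain ⟨-, rfl⟩ := huniq _ _ hyN hfix
    have hq := hmem p hp β hβδ
    refine ⟨β, hβδ, fun x hx => ⟨?_, ?_⟩⟩
    · have h1 := S.Ubar_add_pertθ hε0 hε2 (hKI hp) hq hx
      have h2 := hθ x hx
      exact add_left_cancel (h2.trans h1.symm)
    · rw [S.pertφ_eq hε0 hε2 (hKI hp) hq hx]
      exact hφ x hx
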